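/- Lemma (induction lemma). Let $q$ be an odd prime power, $m\in\{1,2\}$, $n\ge 0$, $F=\mathbb F_{q^m}$ and $G=GL_n(F)$, regarded as the group of $\mathbb F_q$-points of the algebraic group $\mathrm{Res}_{F/\mathbb F_q}GL_n$. Let $\sigma$ be an algebraic involution of this group defined over $\mathbb F_q$ (an automorphism with $\sigma^2=1$; the identity is allowed) and let $H=G^\sigma$. Let $P=L\ltimes U$ be a parabolic subgroup of $G$ with Levi subgroup $L$ and unipotent radical $U$, let $\pi$ be a complex representation of $L$, and let $i_L^G(\pi)=\mathrm{Ind}_P^G(\pi)$ be its parabolic induction, where $\pi$ is inflated from $L$ to $P$. A representation is called distinguished with respect to a subgroup $K$ if it has a nonzero $K$-invariant vector. If $i_L^G(\pi)$ is distinguished with respect to $H$, then there are a Levi subgroup $L'\subseteq L$ and an element $A\in G$ such that: 1. the map $\sigma_A\colon X\mapsto A\,\sigma(X)A^{-1}$ is an involution of $G$, that is $\sigma_A^2=1$, and $\sigma_A\ne 1$ on $G$ if $\sigma\neq 1$ on $G$; 2. $\sigma_A(L')=L'$; 3. the Jacquet restriction $r_{L'}^L(\pi)$ is distinguished with respect to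 $\sigma_A$, that is, with respect to $(L')^{\sigma_A}$. Here $r_{L'}^L(\pi)=\pi^{U'}$, with the action of $L'$, where $U'$ is the unipotent radical of a parabolic subgroup of $L$ with Levi subgroup $L'$; the assertion holds for every choice of this parabolic subgroup. -/

import Mathlib

open scoped TensorProduct

universe u v

/-- An algebraic involution, defined over `k`, of `GL_n` over `F` regarded as an algebraic group
over `k`, i.e. of the Weil restriction `Res_{F/k} GL_n`. This group is given by its functor of
points `R ↦ GL_n(R ⊗_k F)` on commutative `k`-algebras `R`, and a morphism of algebraic groups is a
natural family of group homomorphisms. As usual for involutions, the identity is not excluded. -/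
structure AlgInvolution (k F : Type u) [Field k] [Field F] [Algebra k F] (n : ℕ) where
  /-- the action on `R`-points -/
  app : ∀ (R : Type u) [CommRing R] [Algebra k R],
    GL (Fin n) (R ⊗[k] F) →* GL (Fin n) (R ⊗[k] F)
  naturality : ∀ (R S : Type u) [CommRing R] [Algebra k R] [CommRing S] [Algebra k S]
    (φ : R →ₐ[k] S) (X : GL (Fin n) (R ⊗[k] F)),
    app S (Matrix.GeneralLinearGroup.map
        (Algebra.TensorProduct.map φ (AlgHom.id k F)).toRingHom X) =
      Matrix.GeneralLinearGroup.map
        (Algebra.TensorProduct.map φ (AlgHom.id k F)).toRingHom (app R X)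
  involutive : ∀ (R : Type u) [CommRing R] [Algebra k R] (X : GL (Fin n) (R ⊗[k] F)),
    app R (app R X) = X

/-- The homomorphism which an algebraic involution induces on the group of `k`-points
`GL_n(k ⊗_k F) = GL_n(F)`. -/
noncomputable def AlgInvolution.points {k F : Type u} [Field k] [Field F] [Algebra k F] {n : ℕ}
    (σ : AlgInvolution k F n) : GL (Fin n) F →* GL (Fin n) F :=
  ((Matrix.GeneralLinearGroup.map (Algebra.TensorProduct.lid k F).toAlgHom.toRingHom).comp
    (σ.app k)).comp
    (Matrix.GeneralLinearGroup.map (Algebra.TensorProduct.lid k F).symm.toAlgHom.toRingHom)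

/-- The map `X ↦ A σ(X) A⁻¹`. -/
def conjTwist {G : Type*} [Group G] (A : G) (σ : G →* G) : G →* G :=
  (MulAut.conj A).toMonoidHom.comp σ

/-- The subgroup `G^σ` of fixed points of `σ`. -/
def fixedSubgroup {G : Type*} [Group G] (σ : G →* G) : Subgroup G :=
  σ.eqLocus (MonoidHom.id G)

/-- A representation `ρ` of `G` is distinguished with respect to the subgroup `K` if it has a
nonzero `K`-invariant vector. -/
def IsDistinguished {G : Type*} [Group G] {V : Type*} [AddCommGroup V] [Module ℂ V]
    (ρ : Representation ℂ G V) (K : Subgroup G) : Prop :=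
  ∃ w : V, w ≠ 0 ∧ ∀ x ∈ K, ρ x w = w

section Standard

variable {n : ℕ} {F : Type*} [Field F]

/-- The standard parabolic subgroup of block upper triangular matrices, for the ordered partition
of the index set into the fibres of `f`. -/
def stdParabolic (F : Type*) [Field F] (f : Fin n → ℕ) : Subgroup (GL (Fin n) F) where
  carrier := {X | ∀ i j, f j < f i → (X : Matrix (Fin n) (Fin n) F) i j = 0}
  one_mem' := fun i j h => Matrix.one_apply_ne (fun e => by subst e; exact lt_irrefl _ h)
  mul_mem' := fun {X Y} hX hY => by
    have h : ((X : Matrix (Fin n) (Fin n) F) * (Y : Matrix (Fin n) (Fin n) F)).BlockTriangular f :=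
      Matrix.BlockTriangular.mul (fun i j h => hX i j h) (fun i j h => hY i j h)
    exact fun i j hij => h hij
  inv_mem' := fun {X} hX => by
    have h1 : (X : Matrix (Fin n) (Fin n) F).BlockTriangular f := fun i j h => hX i j h
    have h : ((X : Matrix (Fin n) (Fin n) F)⁻¹).BlockTriangular f := by
      let _ : Invertible (X : Matrix (Fin n) (Fin n) F) := X.isUnit.invertible
      exact Matrix.blockTriangular_inv_of_blockTriangular h1
    intro i j hij
    rw [Matrix.coe_units_inv]
    exact h hij

/-- The standard Levi subgroup of block diagonal matrices. -/
def stdLevi (F : Type*) [Field F] (f : Fin n → ℕ) : Subgroup (GL (Fin n) F) where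
  carrier := {X | ∀ i j, f i ≠ f j → (X : Matrix (Fin n) (Fin n) F) i j = 0}
  one_mem' := fun i j h => Matrix.one_apply_ne (fun e => h (by rw [e]))
  mul_mem' := fun {X Y} hX hY i j h => by
    rw [Units.val_mul, Matrix.mul_apply]
    refine Finset.sum_eq_zero fun l _ => ?_
    by_cases hl : f i = f l
    · rw [hY l j (fun e => h (hl.trans e)), mul_zero]
    · rw [hX i l hl, zero_mul]
  inv_mem' := fun {X} hX => by
    have h1 : (X : Matrix (Fin n) (Fin n) F).BlockTriangular f := fun i j h => hX i j h.ne'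
    have h2 : (X : Matrix (Fin n) (Fin n) F).BlockTriangular (fun i => OrderDual.toDual (f i)) :=
      fun i j h => hX i j (ne_of_lt (OrderDual.toDual_lt_toDual.mp h))
    let _ : Invertible (X : Matrix (Fin n) (Fin n) F) := X.isUnit.invertible
    have h1' := Matrix.blockTriangular_inv_of_blockTriangular h1
    have h2' := Matrix.blockTriangular_inv_of_blockTriangular h2
    intro i j hij
    rw [Matrix.coe_units_inv]
    rcases lt_or_gt_of_ne hij with h | h
    · exact h2' (OrderDual.toDual_lt_toDual.mpr h)
    · exact h1' h

/-- The standard unipotent radical: block upper triangular matrices with identity matrices as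
diagonal blocks. -/
def stdUnipotent (F : Type*) [Field F] (f : Fin n → ℕ) : Subgroup (GL (Fin n) F) where
  carrier := {X | ∀ i j, f j ≤ f i →
    (X : Matrix (Fin n) (Fin n) F) i j = (1 : Matrix (Fin n) (Fin n) F) i j}
  one_mem' := fun i j _ => rfl
  mul_mem' := fun {X Y} hX hY i j h => by
    have key : ∀ l, (X : Matrix (Fin n) (Fin n) F) i l * (Y : Matrix (Fin n) (Fin n) F) l j =
        (1 : Matrix (Fin n) (Fin n) F) i l * (1 : Matrix (Fin n) (Fin n) F) l j := by
      intro l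
      by_cases hl : f l ≤ f i
      · rw [hX i l hl]
        by_cases hil : i = l
        · subst hil; rw [hY i j h]
        · rw [Matrix.one_apply_ne hil, zero_mul, zero_mul]
      · have hlj : f j ≤ f l := h.trans (le_of_lt (not_le.mp hl))
        have hne : l ≠ j := fun e => hl (e ▸ h)
        rw [hY l j hlj, Matrix.one_apply_ne hne, mul_zero, mul_zero]
    rw [Units.val_mul, Matrix.mul_apply, Finset.sum_congr rfl (fun l _ => key l),
      ← Matrix.mul_apply, one_mul]
  inv_mem' := fun {X} hX => by
    have hP : X⁻¹ ∈ stdParabolic F f := (stdParabolic F f).inv_mem fun i j h => by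
      rw [hX i j h.le]
      exact Matrix.one_apply_ne (fun e => by subst e; exact lt_irrefl _ h)
    intro i j h
    have h1 : (X : Matrix (Fin n) (Fin n) F) *
        ((X⁻¹ : GL (Fin n) F) : Matrix (Fin n) (Fin n) F) = 1 := by
      rw [← Units.val_mul, mul_inv_cancel, Units.val_one]
    have key : ∀ l, (X : Matrix (Fin n) (Fin n) F) i l *
        ((X⁻¹ : GL (Fin n) F) : Matrix (Fin n) (Fin n) F) l j =
        (1 : Matrix (Fin n) (Fin n) F) i l *
        ((X⁻¹ : GL (Fin n) F) : Matrix (Fin n) (Fin n) F) l j := by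
      intro l
      by_cases hl : f l ≤ f i
      · rw [hX i l hl]
      · rw [hP l j (lt_of_le_of_lt h (not_le.mp hl)), mul_zero, mul_zero]
    rw [← h1, Matrix.mul_apply, Finset.sum_congr rfl (fun l _ => key l), ← Matrix.mul_apply,
      one_mul]

theorem stdUnipotent_conj (f : Fin n → ℕ) {l x : GL (Fin n) F} (hl : l ∈ stdLevi F f)
    (hx : x ∈ stdUnipotent F f) : l * x * l⁻¹ ∈ stdUnipotent F f := by
  have hl' : l⁻¹ ∈ stdLevi F f := (stdLevi F f).inv_mem hl
  intro i j h
  have h1 : (l : Matrix (Fin n) (Fin n) F) *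
      ((l⁻¹ : GL (Fin n) F) : Matrix (Fin n) (Fin n) F) = 1 := by
    rw [← Units.val_mul, mul_inv_cancel, Units.val_one]
  rw [Units.val_mul, Units.val_mul, ← h1, Matrix.mul_apply, Matrix.mul_apply]
  refine Finset.sum_congr rfl fun b _ => ?_
  by_cases hb : f b = f j
  · congr 1
    rw [Matrix.mul_apply]
    have : ∀ a ∈ Finset.univ, (l : Matrix (Fin n) (Fin n) F) i a *
        (x : Matrix (Fin n) (Fin n) F) a b =
        (l : Matrix (Fin n) (Fin n) F) i a * (1 : Matrix (Fin n) (Fin n) F) a b := by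
      intro a _
      by_cases ha : f i = f a
      · rw [hx a b (by rw [hb, ← ha]; exact h)]
      · rw [hl i a ha, zero_mul, zero_mul]
    rw [Finset.sum_congr rfl this, ← Matrix.mul_apply, mul_one]
  · rw [hl' b j hb, mul_zero, mul_zero]

end Standard

/-- A parabolic subgroup of `GL_n(F)` together with a Levi subgroup of it: the conjugate by
`basis` of the standard pair given by the ordered partition of `{1, …, n}` into the fibres of
`blk`. (Equivalently, an ordered direct sum decomposition of `F^n`.) -/
structure ParabolicPair (n : ℕ) (F : Type*) [Field F] where
  /-- the conjugating matrix -/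
  basis : GL (Fin n) F
  /-- the block to which an index belongs -/
  blk : Fin n → ℕ

namespace ParabolicPair

variable {n : ℕ} {F : Type*} [Field F] {V : Type*} [AddCommGroup V] [Module ℂ V]

/-- The parabolic subgroup `P`. -/
def parabolic (D : ParabolicPair n F) : Subgroup (GL (Fin n) F) :=
  (stdParabolic F D.blk).map (MulAut.conj D.basis).toMonoidHom

/-- The Levi subgroup `L` of `P`. -/
def levi (D : ParabolicPair n F) : Subgroup (GL (Fin n) F) :=
  (stdLevi F D.blk).map (MulAut.conj D.basis).toMonoidHom

/-- The unipotent radical `U` of `P`, so that `P = L ⋉ U`. -/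
def unipotentRadical (D : ParabolicPair n F) : Subgroup (GL (Fin n) F) :=
  (stdUnipotent F D.blk).map (MulAut.conj D.basis).toMonoidHom

theorem unipotentRadical_conj (D : ParabolicPair n F) {l x : GL (Fin n) F} (hl : l ∈ D.levi)
    (hx : x ∈ D.unipotentRadical) : l * x * l⁻¹ ∈ D.unipotentRadical := by
  obtain ⟨l, hl, rfl⟩ := hl
  obtain ⟨x, hx, rfl⟩ := hx
  exact ⟨l * x * l⁻¹, stdUnipotent_conj D.blk hl hx, by simp only [map_mul, map_inv]⟩

/-- The space of the parabolic induction of `π`: the functions `φ : G → V` with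
`φ(p g) = π(l) φ(g)` whenever `p ∈ P` has the Levi component `l ∈ L`, i.e. `p ∈ l U`. -/
def inducedSpace (D : ParabolicPair n F) (π : Representation ℂ D.levi V) :
    Submodule ℂ (GL (Fin n) F → V) where
  carrier := {φ | ∀ p ∈ D.parabolic, ∀ l : D.levi,
    (l : GL (Fin n) F)⁻¹ * p ∈ D.unipotentRadical → ∀ g, φ (p * g) = π l (φ g)}
  zero_mem' := fun _ _ l _ _ => (map_zero (π l)).symm
  add_mem' := fun {φ ψ} hφ hψ p hp l hl g => by
    rw [Pi.add_apply, Pi.add_apply, hφ p hp l hl g, hψ p hp l hl g, map_add]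
  smul_mem' := fun c φ hφ p hp l hl g => by
    rw [Pi.smul_apply, Pi.smul_apply, hφ p hp l hl g, map_smul]

/-- The parabolic induction `i_L^G(π)` (through `P`): inflate `π` from `L` to `P` and induce to
`G`, which acts on functions by right translation. -/
def parabolicInduction (D : ParabolicPair n F) (π : Representation ℂ D.levi V) :
    Representation ℂ (GL (Fin n) F) (D.inducedSpace π) where
  toFun x :=
    { toFun := fun φ => ⟨fun g => φ.1 (g * x), fun p hp l hl g => by
        change φ.1 (p * g * x) = π l (φ.1 (g * x))
        rw [mul_assoc]
        exact φ.2 p hp l hl (g * x)⟩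
      map_add' := fun _ _ => rfl
      map_smul' := fun _ _ => rfl }
  map_one' := by
    ext φ g
    exact congrArg φ.1 (mul_one g)
  map_mul' x y := by
    ext φ g
    exact congrArg φ.1 (mul_assoc g x y).symm

/-- For a representation `π` of a Levi subgroup `L` which contains the Levi subgroup `L'` of `D`:
the space of vectors fixed by `U' ∩ L`, the unipotent radical of the parabolic subgroup
`P' ∩ L` of `L`, whose Levi subgroup is `L'`. -/
def jacquetSpace (D : ParabolicPair n F) {L : Subgroup (GL (Fin n) F)}
    (π : Representation ℂ L V) : Submodule ℂ V where
  carrier := {w | ∀ x : L, (x : GL (Fin n) F) ∈ D.unipotentRadical → π x w = w}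
  zero_mem' := fun x _ => map_zero (π x)
  add_mem' := fun {w w'} hw hw' x hx => by rw [map_add, hw x hx, hw' x hx]
  smul_mem' := fun c w hw x hx => by rw [map_smul, hw x hx]

/-- The Jacquet restriction `r_{L'}^L(π)` along the parabolic subgroup `P' ∩ L` of `L`, where `P'`
and `L'` belong to `D`: the representation of `L'` on the vectors fixed by the unipotent radical of
`P' ∩ L`. -/
def jacquetRestriction (D : ParabolicPair n F) {L : Subgroup (GL (Fin n) F)}
    (π : Representation ℂ L V) (h : D.levi ≤ L) :
    Representation ℂ D.levi (D.jacquetSpace π) where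
  toFun l :=
    { toFun := fun w => ⟨π (Subgroup.inclusion h l) w.1, fun x hx => by
        have hy := w.2 ((Subgroup.inclusion h l)⁻¹ * x * Subgroup.inclusion h l) (by
          have := D.unipotentRadical_conj (D.levi.inv_mem l.2) hx
          rwa [inv_inv] at this)
        calc π x (π (Subgroup.inclusion h l) w.1)
            = π (Subgroup.inclusion h l)
                (π ((Subgroup.inclusion h l)⁻¹ * x * Subgroup.inclusion h l) w.1) := by
              rw [← Module.End.mul_apply, ← Module.End.mul_apply, ← map_mul, ← map_mul]
              congr 2
              group
          _ = π (Subgroup.inclusion h l) w.1 := by rw [hy]⟩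
      map_add' := fun w w' => Subtype.ext (map_add (π (Subgroup.inclusion h l)) w.1 w'.1)
      map_smul' := fun c w => Subtype.ext (map_smul (π (Subgroup.inclusion h l)) c w.1) }
  map_one' := by
    ext w
    change π (Subgroup.inclusion h 1) w.1 = w.1
    rw [map_one, map_one, Module.End.one_apply]
  map_mul' x y := by
    ext w
    change π (Subgroup.inclusion h (x * y)) w.1 =
      π (Subgroup.inclusion h x) (π (Subgroup.inclusion h y) w.1)
    rw [map_mul, map_mul, Module.End.mul_apply]

end ParabolicPair

/-! Let φ be an `H`-invariant element of the induced space with φ(g) ≠ 0, put A = g σ(g)⁻¹ and let τ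
be the twist X ↦ A σ(X) A⁻¹ = g σ(g⁻¹ X g) g⁻¹. It is conjugate to σ, so it is an involution,
nontrivial if σ is. If p in P is fixed by τ, then g⁻¹ p g lies in `H`, and φ(p g) = φ(g); so the
Levi component of p fixes w = φ(g). Replacing g by q⁻¹ g with q in P only applies an element of L to
w, so g may be adjusted within P g.

Algebraicity of σ enters once, to show that σ permutes the triples (P, L, U)
(`AlgInvolution.exists_image_pair`): these are described by limits along cocharacters, cocharacters
are the group-like matrices over Laurent polynomials, and naturality in the coefficient ring lets σ
act on all of this. Next, g can be chosen so that L and τ(L) are block diagonal in one basis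
(`ParabolicPair.exists_levi_common_basis`). Bruhat decomposition provides such Levi subgroups for P
and τ(P) separately; making them interchanged by τ is a fixed point problem for a τ-stable group of
odd order, because q is odd.

Then L' = L ∩ τ(L) is a τ-stable Levi subgroup, and L ∩ τ(U) is the unipotent radical of a parabolic
subgroup of L with Levi subgroup L'. The vector w is fixed by (L')^τ, and also by L ∩ τ(U), since
each element of the latter is the Levi component of a τ-fixed element of P
(`ParabolicPair.exists_fixed_mem_parabolic`). This settles one parabolic subgroup with Levi subgroup
L'.

For the others, pass to the finite-dimensional span of the orbit of w and count invariants by a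
trace (`exists_fixed_vector`). The trace is built from sums of a character over cosets l U', and
these depend only on L' (`unipotentSum_eq`): two neighbouring blocks are exchanged by transposition,
which a class function does not notice because every matrix is similar to its transpose. -/

/-! ### Block calculus in standard parabolic subgroups -/

section StandardGroups

variable {n : ℕ} {F : Type*} [Field F]

/-- The block diagonal part of a matrix. -/
def blockDiag (f : Fin n → ℕ) (X : Matrix (Fin n) (Fin n) F) : Matrix (Fin n) (Fin n) F :=
  Matrix.of fun i j => if f i = f j then X i j else 0

theorem blockDiag_mul {f : Fin n → ℕ} {X Y : Matrix (Fin n) (Fin n) F}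
    (hX : ∀ i j, f j < f i → X i j = 0) (hY : ∀ i j, f j < f i → Y i j = 0) :
    blockDiag f (X * Y) = blockDiag f X * blockDiag f Y := by
  ext i j
  simp only [blockDiag, Matrix.of_apply, Matrix.mul_apply]
  by_cases h : f i = f j
  · rw [if_pos h]
    refine Finset.sum_congr rfl fun l _ => ?_
    rcases lt_trichotomy (f i) (f l) with hl | hl | hl
    · rw [hY l j (h ▸ hl), if_neg hl.ne, mul_zero, zero_mul]
    · rw [if_pos hl, if_pos (hl.symm.trans h)]
    · rw [hX i l hl, if_neg hl.ne', zero_mul, zero_mul]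
  · rw [if_neg h]
    refine (Finset.sum_eq_zero fun l _ => ?_).symm
    by_cases hl : f i = f l
    · rw [if_neg (fun e => h (hl.trans e)), mul_zero]
    · rw [if_neg hl, zero_mul]

theorem blockDiag_one (f : Fin n → ℕ) :
    blockDiag f (1 : Matrix (Fin n) (Fin n) F) = 1 := by
  ext i j
  by_cases h : i = j
  · subst h; simp [blockDiag]
  · simp [blockDiag, Matrix.one_apply_ne h]

/-- The Levi component of an element of a standard parabolic subgroup. -/
def leviPart {f : Fin n → ℕ} {p : GL (Fin n) F} (hp : p ∈ stdParabolic F f) : GL (Fin n) F where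
  val := blockDiag f p
  inv := blockDiag f (p⁻¹ : GL (Fin n) F)
  val_inv := by
    rw [← blockDiag_mul hp ((stdParabolic F f).inv_mem hp), ← Units.val_mul, mul_inv_cancel,
      Units.val_one, blockDiag_one]
  inv_val := by
    rw [← blockDiag_mul ((stdParabolic F f).inv_mem hp) hp, ← Units.val_mul, inv_mul_cancel,
      Units.val_one, blockDiag_one]

theorem leviPart_apply {f : Fin n → ℕ} {p : GL (Fin n) F} (hp : p ∈ stdParabolic F f)
    (i j : Fin n) : leviPart hp i j = if f i = f j then p i j else 0 := rfl

theorem leviPart_mem {f : Fin n → ℕ} {p : GL (Fin n) F} (hp : p ∈ stdParabolic F f) :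
    leviPart hp ∈ stdLevi F f := fun _ _ h => if_neg h

theorem stdLevi_le_stdParabolic (f : Fin n → ℕ) : stdLevi F f ≤ stdParabolic F f :=
  fun _ hx i j h => hx i j h.ne'

theorem stdUnipotent_le_stdParabolic (f : Fin n → ℕ) : stdUnipotent F f ≤ stdParabolic F f :=
  fun _ hx i j h => (hx i j h.le).trans (Matrix.one_apply_ne fun e => h.ne (e ▸ rfl))

/-- Exhibits U as the kernel of the multiplicative map `blockDiag` on P, from which normality and
the factorisation P = L U follow. -/
theorem mem_stdUnipotent_iff_blockDiag {f : Fin n → ℕ} {x : GL (Fin n) F}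
    (hx : x ∈ stdParabolic F f) :
    x ∈ stdUnipotent F f ↔ blockDiag f (x : Matrix (Fin n) (Fin n) F) = 1 := by
  constructor
  · intro h
    rw [← blockDiag_one f]
    ext i j
    simp only [blockDiag, Matrix.of_apply]
    split_ifs with hij
    · exact h i j hij.ge
    · rfl
  · intro h i j hij
    rcases hij.lt_or_eq with h1 | h1
    · rw [hx i j h1, Matrix.one_apply_ne fun e => h1.ne (congrArg f e.symm)]
    · rw [← h]
      simp [blockDiag, h1]

theorem stdParabolic_conj_mem_stdUnipotent {f : Fin n → ℕ} {p x : GL (Fin n) F}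
    (hp : p ∈ stdParabolic F f) (hx : x ∈ stdUnipotent F f) :
    p * x * p⁻¹ ∈ stdUnipotent F f := by
  have hx' := stdUnipotent_le_stdParabolic f hx
  have hpi := (stdParabolic F f).inv_mem hp
  rw [mem_stdUnipotent_iff_blockDiag
    ((stdParabolic F f).mul_mem ((stdParabolic F f).mul_mem hp hx') hpi), Units.val_mul,
    Units.val_mul, blockDiag_mul _ hpi, blockDiag_mul hp hx',
    (mem_stdUnipotent_iff_blockDiag hx').mp hx, mul_one, ← blockDiag_mul hp hpi, ← Units.val_mul,
    mul_inv_cancel, Units.val_one, blockDiag_one]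
  exact (stdParabolic F f).mul_mem hp hx'

theorem blockDiag_of_mem_stdLevi {f : Fin n → ℕ} {l : GL (Fin n) F} (hl : l ∈ stdLevi F f) :
    blockDiag f (l : Matrix (Fin n) (Fin n) F) = l := by
  ext i j
  simp only [blockDiag, Matrix.of_apply]
  split_ifs with h
  · rfl
  · exact (hl i j h).symm

theorem leviPart_inv_mul_mem {f : Fin n → ℕ} {p : GL (Fin n) F} (hp : p ∈ stdParabolic F f) :
    (leviPart hp)⁻¹ * p ∈ stdUnipotent F f := by
  have hl := (stdLevi F f).inv_mem (leviPart_mem hp)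
  have hl' := stdLevi_le_stdParabolic f hl
  rw [mem_stdUnipotent_iff_blockDiag ((stdParabolic F f).mul_mem hl' hp), Units.val_mul,
    blockDiag_mul hl' hp, blockDiag_of_mem_stdLevi hl]
  change ((leviPart hp)⁻¹ : GL (Fin n) F).val * (leviPart hp).val = 1
  rw [← Units.val_mul, inv_mul_cancel, Units.val_one]

/-- A strictly triangular matrix is nilpotent. -/
theorem isNilpotent_of_strictly_triangular (h : Fin n → ℕ) {N : Matrix (Fin n) (Fin n) F}
    (hN : ∀ i j, h j ≤ h i → N i j = 0) : IsNilpotent N := by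
  -- Each factor `N` raises the label by at least one.
  have key : ∀ m : ℕ, ∀ i j, h j < h i + m → (N ^ m) i j = 0 := by
    intro m
    induction m with
    | zero =>
      intro i j hij
      rw [pow_zero]
      exact Matrix.one_apply_ne fun e => by subst e; omega
    | succ m ih =>
      intro i j hij
      rw [pow_succ, Matrix.mul_apply]
      refine Finset.sum_eq_zero fun l _ => ?_
      by_cases hl : h l < h i + m
      · rw [ih i l hl, zero_mul]
      · rw [hN l j (by omega), mul_zero]
  refine ⟨Finset.univ.sup h + 1, ?_⟩
  ext i j
  refine key _ i j ?_
  have := Finset.le_sup (f := h) (Finset.mem_univ j)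
  omega

/-- In characteristic p, (x - 1)^(p^k) = x^(p^k) - 1, and the left side vanishes for large k. -/
theorem exists_pow_char_pow_eq_one (p : ℕ) [Fact p.Prime] [CharP F p] {x : GL (Fin n) F}
    (hx : IsNilpotent ((x : Matrix (Fin n) (Fin n) F) - 1)) : ∃ k : ℕ, x ^ p ^ k = 1 := by
  obtain ⟨m, hm⟩ := hx
  obtain ⟨k, hk⟩ : ∃ k, m ≤ p ^ k := ⟨m, (Nat.lt_pow_self (Fact.out : p.Prime).one_lt).le⟩
  refine ⟨k, Units.ext ?_⟩
  rcases isEmpty_or_nonempty (Fin n) with h | h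
  · exact Subsingleton.elim _ _
  have h2 := sub_pow_char_pow_of_commute p k (Commute.one_right (x : Matrix (Fin n) (Fin n) F))
  rw [pow_eq_zero_of_le hk hm, one_pow] at h2
  rw [Units.val_pow_eq_pow_val, Units.val_one]
  exact sub_eq_zero.mp h2.symm

theorem isPGroup_stdUnipotent (p : ℕ) [Fact p.Prime] [CharP F p] (f : Fin n → ℕ) :
    IsPGroup p (stdUnipotent F f) := by
  rintro ⟨x, hx⟩
  obtain ⟨k, hk⟩ := exists_pow_char_pow_eq_one p (x := x)
    (isNilpotent_of_strictly_triangular f fun i j h => by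
      rw [Matrix.sub_apply, hx i j h, sub_self])
  exact ⟨k, Subtype.ext hk⟩

end StandardGroups

/-! ### Bruhat decomposition by triangular elimination -/

section Bruhat

variable {n : ℕ} {F : Type*} [Field F]

/-- The permutation matrix which maps the `j`-th basis vector to the `s j`-th one. -/
def permGL (F : Type*) [Field F] (s : Equiv.Perm (Fin n)) : GL (Fin n) F where
  val := Matrix.of fun i j => if i = s j then 1 else 0
  inv := Matrix.of fun i j => if s i = j then 1 else 0
  val_inv := by
    ext i j
    simp only [Matrix.mul_apply, Matrix.of_apply, mul_ite, mul_one, mul_zero, Matrix.one_apply]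
    rw [Finset.sum_eq_single (s.symm j)]
    · simp
    · intro b _ hb
      rw [if_neg]
      rintro rfl
      simp at hb
    · simp
  inv_val := by
    ext i j
    simp [Matrix.mul_apply, Matrix.one_apply]

theorem mul_permGL_apply (s : Equiv.Perm (Fin n)) (X : Matrix (Fin n) (Fin n) F) (i j : Fin n) :
    (X * (permGL F s : GL (Fin n) F).val) i j = X i (s j) := by
  simp [permGL, Matrix.mul_apply]

theorem permGL_inv_mul_apply (s : Equiv.Perm (Fin n)) (X : Matrix (Fin n) (Fin n) F)
    (i j : Fin n) : ((permGL F s)⁻¹.val * X) i j = X (s i) j := by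
  change ((Matrix.of fun i j => if s i = j then (1 : F) else 0) * X) i j = _
  simp [Matrix.mul_apply]

theorem permGL_conj_apply (s : Equiv.Perm (Fin n)) (X : GL (Fin n) F) (i j : Fin n) :
    ((permGL F s)⁻¹ * X * permGL F s) i j = X (s i) (s j) := by
  rw [Units.val_mul, Units.val_mul, mul_permGL_apply, permGL_inv_mul_apply]

/-- The factor is the identity with column `r` replaced by `a`; the support of `a` makes it upper
triangular and `a r ≠ 0` makes it invertible. One multiplication thus rescales the pivot row and
clears the column above it. -/
theorem exists_upper_mul (r : Fin n) (a : Fin n → F) (ha : ∀ i, r < i → a i = 0)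
    (har : a r ≠ 0) :
    ∃ y ∈ stdParabolic F (Fin.val : Fin n → ℕ), ∀ (X : Matrix (Fin n) (Fin n) F) i j,
      (y.val * X) i j = (if i = r then 0 else X i j) + a i * X r j := by
  let Y : Matrix (Fin n) (Fin n) F :=
    Matrix.of fun i j => (if i = j then if i = r then 0 else 1 else 0) + if j = r then a i else 0
  have hmul : ∀ (X : Matrix (Fin n) (Fin n) F) i j,
      (Y * X) i j = (if i = r then 0 else X i j) + a i * X r j := by
    intro X i j
    simp only [Y, Matrix.mul_apply, Matrix.of_apply, add_mul, Finset.sum_add_distrib, ite_mul,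
      zero_mul, one_mul, Finset.sum_ite_eq, Finset.sum_ite_eq', Finset.mem_univ, if_true]
  have htri : Y.BlockTriangular id := by
    intro i j hij
    have h1 : i ≠ j := hij.ne'
    simp only [Y, Matrix.of_apply, if_neg h1, zero_add]
    split_ifs with h
    · subst h; exact ha i hij
    · rfl
  have hdet : IsUnit Y.det := by
    rw [Matrix.det_of_isUpperTriangular htri, isUnit_iff_ne_zero, Finset.prod_ne_zero_iff]
    intro i _
    by_cases h : i = r
    · subst h; simpa [Y] using har
    · simp [Y, h]
  refine ⟨Matrix.GeneralLinearGroup.mk'' Y hdet, fun i j hij => htri hij, hmul⟩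

theorem exists_mul_upper (r : Fin n) (a : Fin n → F) (ha : ∀ i, i < r → a i = 0)
    (har : a r ≠ 0) :
    ∃ y ∈ stdParabolic F (Fin.val : Fin n → ℕ), ∀ (X : Matrix (Fin n) (Fin n) F) i j,
      (X * y.val) i j = (if j = r then 0 else X i j) + X i r * a j := by
  let Y : Matrix (Fin n) (Fin n) F :=
    Matrix.of fun i j => (if i = j then if j = r then 0 else 1 else 0) + if i = r then a j else 0
  have hmul : ∀ (X : Matrix (Fin n) (Fin n) F) i j,
      (X * Y) i j = (if j = r then 0 else X i j) + X i r * a j := by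
    intro X i j
    simp only [Y, Matrix.mul_apply, Matrix.of_apply, mul_add, Finset.sum_add_distrib, mul_ite,
      mul_zero, mul_one, Finset.sum_ite_eq', Finset.mem_univ, if_true]
  have htri : Y.BlockTriangular id := by
    intro i j hij
    have h1 : i ≠ j := hij.ne'
    simp only [Y, Matrix.of_apply, if_neg h1, zero_add]
    split_ifs with h
    · subst h; exact ha j hij
    · rfl
  have hdet : IsUnit Y.det := by
    rw [Matrix.det_of_isUpperTriangular htri, isUnit_iff_ne_zero, Finset.prod_ne_zero_iff]
    intro i _
    by_cases h : i = r
    · subst h; simpa [Y] using har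
    · simp [Y, h]
  refine ⟨Matrix.GeneralLinearGroup.mk'' Y hdet, fun i j hij => htri hij, hmul⟩

/-- Column by column elimination. The pivot is the lowest nonzero entry of the new column, so adding
multiples of its row upwards suffices to clear it. Control of the earlier pivot rows is part of the
induction: they vanish in the new column, so neither operation spoils them. -/
theorem exists_monomial_columns (c : GL (Fin n) F) (m : ℕ) :
    ∃ b ∈ stdParabolic F (Fin.val : Fin n → ℕ), ∃ b' ∈ stdParabolic F (Fin.val : Fin n → ℕ),
      ∃ w : Fin n → Fin n, ∀ j : Fin n, j.val < m →
        (∀ i, (b * c * b').val i j = if i = w j then 1 else 0) ∧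
        (∀ l, (b * c * b').val (w j) l = if l = j then 1 else 0) := by
  classical
  induction m with
  | zero => exact ⟨1, one_mem _, 1, one_mem _, id, fun j hj => absurd hj (Nat.not_lt_zero _)⟩
  | succ m ih =>
    obtain ⟨b, hb, b', hb', w, hw⟩ := ih
    by_cases hmn : n ≤ m
    · exact ⟨b, hb, b', hb', w, fun j _ => hw j (by omega)⟩
    push Not at hmn
    set d := b * c * b' with hd
    let t : Fin n := ⟨m, hmn⟩
    have hne : (Finset.univ.filter fun i => d.val i t ≠ 0).Nonempty := by
      by_contra hcon
      rw [Finset.not_nonempty_iff_eq_empty, Finset.filter_eq_empty_iff] at hcon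
      have h0 : ∀ i, d.val i t = 0 := fun i => not_not.mp (hcon (Finset.mem_univ i))
      have h1 : (d⁻¹.val * d.val) t t = 1 := by
        rw [← Units.val_mul, inv_mul_cancel, Units.val_one, Matrix.one_apply_eq]
      rw [Matrix.mul_apply, Finset.sum_eq_zero fun i _ => by rw [h0 i, mul_zero]] at h1
      exact zero_ne_one h1
    set r := (Finset.univ.filter fun i => d.val i t ≠ 0).max' hne with hr
    have hrne : d.val r t ≠ 0 := (Finset.mem_filter.mp (Finset.max'_mem _ hne)).2
    have hrmax : ∀ i, r < i → d.val i t = 0 := by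
      intro i hi
      by_contra h
      exact absurd (Finset.le_max' _ i (Finset.mem_filter.mpr ⟨Finset.mem_univ i, h⟩))
        (not_le.mpr hi)
    have hrow : ∀ j : Fin n, j.val < m → d.val (w j) t = 0 := fun j hj => by
      rw [(hw j hj).2 t, if_neg (fun e => by rw [← e] at hj; exact lt_irrefl _ hj)]
    have hrw : ∀ j : Fin n, j.val < m → r ≠ w j := fun j hj e => hrne (e ▸ hrow j hj)
    have hrcol : ∀ j : Fin n, j.val < m → d.val r j = 0 := fun j hj => by
      rw [(hw j hj).1 r, if_neg (hrw j hj)]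
    obtain ⟨y, hy, hymul⟩ := exists_upper_mul (F := F) r
      (fun i => if i = r then (d.val r t)⁻¹ else - (d.val i t * (d.val r t)⁻¹))
      (fun i hi => by rw [if_neg hi.ne', hrmax i hi, zero_mul, neg_zero])
      (by rw [if_pos rfl]; exact inv_ne_zero hrne)
    set e := y * d with he
    have hecol : ∀ i, e.val i t = if i = r then 1 else 0 := by
      intro i
      rw [he, Units.val_mul, hymul]
      split_ifs with hi
      · rw [zero_add, inv_mul_cancel₀ hrne]
      · rw [neg_mul, mul_assoc, inv_mul_cancel₀ hrne, mul_one, add_neg_cancel]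
    have hecol' : ∀ j : Fin n, j.val < m → ∀ i, e.val i j = if i = w j then 1 else 0 := by
      intro j hj i
      rw [he, Units.val_mul, hymul, hrcol j hj, mul_zero, add_zero, (hw j hj).1 i]
      split_ifs with h1 h2 h2
      · exact absurd (h1.symm.trans h2) (hrw j hj)
      all_goals rfl
    have herow' : ∀ j : Fin n, j.val < m → ∀ l, e.val (w j) l = if l = j then 1 else 0 := by
      intro j hj l
      rw [he, Units.val_mul, hymul, if_neg (hrw j hj).symm, if_neg (hrw j hj).symm, hrow j hj,
        zero_mul, neg_zero, zero_mul, add_zero, (hw j hj).2 l]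
    have hert : e.val r t = 1 := by rw [hecol r, if_pos rfl]
    have her : ∀ j : Fin n, j.val < m → e.val r j = 0 := fun j hj => by
      rw [hecol' j hj, if_neg (hrw j hj)]
    -- Clears the pivot row to the right; its entries in the earlier columns are already zero, which
    -- keeps the factor upper triangular.
    obtain ⟨z, hz, hzmul⟩ := exists_mul_upper (F := F) t
      (fun l => if l = t then 1 else - e.val r l)
      (fun i hi => by rw [if_neg hi.ne, her i hi, neg_zero]) (by simp)
    refine ⟨y * b, mul_mem hy hb, b' * z, mul_mem hb' hz, Function.update w t r, ?_⟩
    have hassoc : y * b * c * (b' * z) = e * z := by rw [he, hd]; simp only [mul_assoc]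
    rw [hassoc, Units.val_mul]
    intro j hj
    by_cases hjt : j = t
    · subst hjt
      rw [Function.update_self]
      refine ⟨fun i => ?_, fun l => ?_⟩
      · rw [hzmul, if_pos rfl, if_pos rfl, zero_add, mul_one, hecol]
      · rw [hzmul, hert, one_mul]
        split_ifs with h
        · rw [zero_add]
        · rw [add_neg_cancel]
    · have hj' : j.val < m := lt_of_le_of_ne (Nat.lt_succ_iff.mp hj) fun e => hjt (Fin.ext e)
      rw [Function.update_of_ne hjt]
      refine ⟨fun i => ?_, fun l => ?_⟩
      · rw [hzmul, if_neg hjt, if_neg hjt, her j hj', neg_zero, mul_zero, add_zero, hecol' j hj']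
      · rw [hzmul, herow' j hj', herow' j hj', if_neg (Ne.symm hjt), zero_mul, add_zero]
        split_ifs with h1 h2 h2
        · exact absurd (h2.symm.trans h1) hjt
        all_goals rfl

/-- The Bruhat decomposition of the general linear group. -/
theorem bruhat_decomposition (c : GL (Fin n) F) :
    ∃ b ∈ stdParabolic F (Fin.val : Fin n → ℕ), ∃ b' ∈ stdParabolic F (Fin.val : Fin n → ℕ),
      ∃ s : Equiv.Perm (Fin n), b * c * b' = permGL F s := by
  obtain ⟨b, hb, b', hb', w, hw⟩ := exists_monomial_columns c n
  have hinj : Function.Injective w := by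
    intro j j' h
    have h1 := (hw j j.isLt).2 j'
    rw [h, (hw j' j'.isLt).2 j', if_pos rfl] at h1
    by_contra hne
    rw [if_neg (Ne.symm hne)] at h1
    exact one_ne_zero h1
  refine ⟨b, hb, b', hb', Equiv.ofBijective w (Finite.injective_iff_bijective.mp hinj), ?_⟩
  refine Units.ext (Matrix.ext fun i j => ?_)
  rw [(hw j j.isLt).1 i]
  rfl

end Bruhat

/-! ### Conjugates of parabolic pairs and common bases -/

namespace ParabolicPair

variable {n : ℕ} {F : Type*} [Field F]

theorem mem_map_conj_iff {G : Type*} [Group G] (H : Subgroup G) (g x : G) :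
    x ∈ H.map (MulAut.conj g).toMonoidHom ↔ g⁻¹ * x * g ∈ H := by
  constructor
  · rintro ⟨y, hy, rfl⟩
    simpa [mul_assoc] using hy
  · intro h
    exact ⟨_, h, by simp [mul_assoc]⟩

theorem mem_parabolic (D : ParabolicPair n F) (x : GL (Fin n) F) :
    x ∈ D.parabolic ↔ D.basis⁻¹ * x * D.basis ∈ stdParabolic F D.blk := mem_map_conj_iff _ _ _

theorem mem_levi (D : ParabolicPair n F) (x : GL (Fin n) F) :
    x ∈ D.levi ↔ D.basis⁻¹ * x * D.basis ∈ stdLevi F D.blk := mem_map_conj_iff _ _ _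

theorem mem_unipotentRadical (D : ParabolicPair n F) (x : GL (Fin n) F) :
    x ∈ D.unipotentRadical ↔ D.basis⁻¹ * x * D.basis ∈ stdUnipotent F D.blk :=
  mem_map_conj_iff _ _ _

theorem levi_le_parabolic (D : ParabolicPair n F) : D.levi ≤ D.parabolic :=
  Subgroup.map_mono (stdLevi_le_stdParabolic _)

theorem unipotentRadical_le_parabolic (D : ParabolicPair n F) :
    D.unipotentRadical ≤ D.parabolic :=
  Subgroup.map_mono (stdUnipotent_le_stdParabolic _)

theorem conj_mem_unipotentRadical (D : ParabolicPair n F) {p x : GL (Fin n) F}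
    (hp : p ∈ D.parabolic) (hx : x ∈ D.unipotentRadical) :
    p * x * p⁻¹ ∈ D.unipotentRadical := by
  obtain ⟨p, hp, rfl⟩ := hp
  obtain ⟨x, hx, rfl⟩ := hx
  exact ⟨p * x * p⁻¹, stdParabolic_conj_mem_stdUnipotent hp hx, by simp only [map_mul, map_inv]⟩

theorem exists_levi_component (D : ParabolicPair n F) {p : GL (Fin n) F} (hp : p ∈ D.parabolic) :
    ∃ l : D.levi, (l : GL (Fin n) F)⁻¹ * p ∈ D.unipotentRadical := by
  obtain ⟨p, hp, rfl⟩ := hp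
  exact ⟨⟨_, leviPart hp, leviPart_mem hp, rfl⟩, _, leviPart_inv_mul_mem hp,
    by simp only [map_mul, map_inv]⟩

theorem isPGroup_unipotentRadical (p : ℕ) [Fact p.Prime] [CharP F p] (D : ParabolicPair n F) :
    IsPGroup p D.unipotentRadical :=
  (isPGroup_stdUnipotent p D.blk).map _

/-- Two pairs with the same parabolic subgroup, Levi subgroup and unipotent radical. -/
structure SameGroups (D E : ParabolicPair n F) : Prop where
  parabolic : D.parabolic = E.parabolic
  levi : D.levi = E.levi
  unipotentRadical : D.unipotentRadical = E.unipotentRadical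

/-- Renumbering the basis vectors together with their labels leaves the ordered decomposition of F^n
alone. This is used to sort the blocks and to absorb the permutation in Bruhat decomposition. -/
theorem sameGroups_reindex (b : GL (Fin n) F) (f : Fin n → ℕ) (s : Equiv.Perm (Fin n)) :
    SameGroups ⟨b * permGL F s, f ∘ s⟩ ⟨b, f⟩ := by
  have key : ∀ x : GL (Fin n) F, (b * permGL F s)⁻¹ * x * (b * permGL F s) =
      (permGL F s)⁻¹ * (b⁻¹ * x * b) * permGL F s := fun x => by group
  refine ⟨?_, ?_, ?_⟩ <;> ext x
  · rw [mem_parabolic, mem_parabolic]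
    simp only [key]
    change (∀ i j, f (s j) < f (s i) → _) ↔ ∀ i j, f j < f i → _
    simp only [permGL_conj_apply]
    exact ⟨fun h i j hij => by simpa using h (s.symm i) (s.symm j) (by simpa using hij),
      fun h i j hij => h _ _ hij⟩
  · rw [mem_levi, mem_levi]
    simp only [key]
    change (∀ i j, f (s i) ≠ f (s j) → _) ↔ ∀ i j, f i ≠ f j → _
    simp only [permGL_conj_apply]
    exact ⟨fun h i j hij => by simpa using h (s.symm i) (s.symm j) (by simpa using hij),
      fun h i j hij => h _ _ hij⟩
  · rw [mem_unipotentRadical, mem_unipotentRadical]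
    simp only [key]
    change (∀ i j, f (s j) ≤ f (s i) → _) ↔ ∀ i j, f j ≤ f i → _
    simp only [permGL_conj_apply]
    exact ⟨fun h i j hij => by
        simpa [Matrix.one_apply] using h (s.symm i) (s.symm j) (by simpa using hij),
      fun h i j hij => by simpa [Matrix.one_apply] using h _ _ hij⟩

/-- The pair obtained by conjugating with `p`. -/
def move (p : GL (Fin n) F) (D : ParabolicPair n F) : ParabolicPair n F := ⟨p * D.basis, D.blk⟩

theorem map_conj_mul {G : Type*} [Group G] (H : Subgroup G) (p g : G) :
    H.map (MulAut.conj (p * g)).toMonoidHom =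
      (H.map (MulAut.conj g).toMonoidHom).map (MulAut.conj p).toMonoidHom := by
  rw [Subgroup.map_map, map_mul]
  rfl

theorem move_parabolic (p : GL (Fin n) F) (D : ParabolicPair n F) :
    (D.move p).parabolic = D.parabolic.map (MulAut.conj p).toMonoidHom := map_conj_mul _ _ _

theorem move_levi (p : GL (Fin n) F) (D : ParabolicPair n F) :
    (D.move p).levi = D.levi.map (MulAut.conj p).toMonoidHom := map_conj_mul _ _ _

theorem move_unipotentRadical (p : GL (Fin n) F) (D : ParabolicPair n F) :
    (D.move p).unipotentRadical = D.unipotentRadical.map (MulAut.conj p).toMonoidHom :=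
  map_conj_mul _ _ _

theorem move_parabolic_of_mem {p : GL (Fin n) F} {D : ParabolicPair n F} (hp : p ∈ D.parabolic) :
    (D.move p).parabolic = D.parabolic := by
  rw [move_parabolic]
  ext x
  rw [mem_map_conj_iff, D.parabolic.mul_mem_cancel_right hp,
    D.parabolic.mul_mem_cancel_left (inv_mem hp)]

theorem move_unipotentRadical_of_mem {p : GL (Fin n) F} {D : ParabolicPair n F}
    (hp : p ∈ D.parabolic) : (D.move p).unipotentRadical = D.unipotentRadical := by
  rw [move_unipotentRadical]
  ext x
  rw [mem_map_conj_iff]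
  refine ⟨fun h => ?_, fun h => ?_⟩
  · have := D.conj_mem_unipotentRadical hp h
    simpa [mul_assoc] using this
  · have := D.conj_mem_unipotentRadical (inv_mem hp) h
    simpa [mul_assoc] using this

theorem upper_le_stdParabolic {f : Fin n → ℕ} (hf : Monotone f) :
    stdParabolic F (Fin.val : Fin n → ℕ) ≤ stdParabolic F f := fun _ hx i j h =>
  hx i j (Fin.lt_def.mp (hf.reflect_lt h))

/-- Two parabolic subgroups contain Levi subgroups which are standard in a common basis. -/
theorem exists_common_basis (D E : ParabolicPair n F) :
    ∃ p ∈ D.parabolic, ∃ q ∈ E.parabolic, ∃ (g : GL (Fin n) F) (α β : Fin n → ℕ),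
      SameGroups ⟨g, α⟩ (D.move p) ∧ SameGroups ⟨g, β⟩ (E.move q) := by
  -- In sorted bases both parabolic subgroups contain the upper triangular matrices. The triangular
  -- factors of the change of basis can then be absorbed into `p` and `q`, and the two bases left
  -- over differ by a permutation.
  let s := Tuple.sort D.blk
  let t := Tuple.sort E.blk
  obtain ⟨b, hb, b', hb', w, hw⟩ :=
    bruhat_decomposition ((D.basis * permGL F s)⁻¹ * (E.basis * permGL F t))
  have h1 := upper_le_stdParabolic (F := F) (Tuple.monotone_sort D.blk) (inv_mem hb)
  have h2 := upper_le_stdParabolic (F := F) (Tuple.monotone_sort E.blk) hb'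
  refine ⟨D.basis * permGL F s * b⁻¹ * (D.basis * permGL F s)⁻¹, ?_,
    E.basis * permGL F t * b' * (E.basis * permGL F t)⁻¹, ?_,
    E.basis * permGL F t * b', (D.blk ∘ s) ∘ w, E.blk ∘ t, ?_, ?_⟩
  · rw [show D.parabolic = _ from (sameGroups_reindex D.basis D.blk s).parabolic.symm]
    rw [mem_parabolic]
    simpa [mul_assoc] using h1
  · rw [show E.parabolic = _ from (sameGroups_reindex E.basis E.blk t).parabolic.symm]
    rw [mem_parabolic]
    simpa [mul_assoc] using h2
  · have e1 : E.basis * permGL F t * b' = (D.basis * permGL F s * b⁻¹) * permGL F w := by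
      rw [← hw]; group
    have e2 := sameGroups_reindex (D.basis * permGL F s * b⁻¹) (D.blk ∘ s) w
    rw [← e1] at e2
    have e3 := sameGroups_reindex
      (D.basis * permGL F s * b⁻¹ * (D.basis * permGL F s)⁻¹ * D.basis) D.blk s
    have e4 : D.basis * permGL F s * b⁻¹ * (D.basis * permGL F s)⁻¹ * D.basis * permGL F s =
      D.basis * permGL F s * b⁻¹ := by group
    rw [e4] at e3
    exact ⟨e2.1.trans e3.1, e2.2.trans e3.2, e2.3.trans e3.3⟩
  · have e3 := sameGroups_reindex
      (E.basis * permGL F t * b' * (E.basis * permGL F t)⁻¹ * E.basis) E.blk t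
    have e4 : E.basis * permGL F t * b' * (E.basis * permGL F t)⁻¹ * E.basis * permGL F t =
      E.basis * permGL F t * b' := by group
    rw [e4] at e3
    exact e3

end ParabolicPair

/-! ### The involution over monoid algebras -/

section Transport

variable {k F : Type u} [Field k] [Field F] [Algebra k F] {n : ℕ}

/-- The action of an algebraic involution on `GL_n(E)`, where `E` is identified with `R ⊗ F`. -/
noncomputable def AlgInvolution.transport (σ : AlgInvolution k F n) {R E : Type u} [CommRing R]
    [Algebra k R] [CommRing E] [Algebra k E] (θ : R ⊗[k] F ≃ₐ[k] E) :
    GL (Fin n) E →* GL (Fin n) E :=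
  ((Matrix.GeneralLinearGroup.map θ.toAlgHom.toRingHom).comp (σ.app R)).comp
    (Matrix.GeneralLinearGroup.map θ.symm.toAlgHom.toRingHom)

theorem AlgInvolution.points_eq_transport (σ : AlgInvolution k F n) :
    σ.points = σ.transport (Algebra.TensorProduct.lid k F) := rfl

/-- Naturality at `φ`, read through the identifications `θ` and `θ'`. It is applied to inclusions of
constants, to maps of exponents and to specialisations of the variable. -/
theorem AlgInvolution.transport_map (σ : AlgInvolution k F n) {R E S E' : Type u} [CommRing R]
    [Algebra k R] [CommRing E] [Algebra k E] [CommRing S] [Algebra k S] [CommRing E']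
    [Algebra k E'] {θ : R ⊗[k] F ≃ₐ[k] E} {θ' : S ⊗[k] F ≃ₐ[k] E'} (φ : R →ₐ[k] S)
    (ψ : E →+* E')
    (h : ∀ x, ψ (θ x) = θ' (Algebra.TensorProduct.map φ (AlgHom.id k F) x))
    (X : GL (Fin n) E) :
    σ.transport θ' (Matrix.GeneralLinearGroup.map ψ X) =
      Matrix.GeneralLinearGroup.map ψ (σ.transport θ X) := by
  have h1 : Matrix.GeneralLinearGroup.map θ'.symm.toAlgHom.toRingHom
      (Matrix.GeneralLinearGroup.map ψ X) = Matrix.GeneralLinearGroup.map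
        (Algebra.TensorProduct.map φ (AlgHom.id k F)).toRingHom
        (Matrix.GeneralLinearGroup.map θ.symm.toAlgHom.toRingHom X) := by
    refine Units.ext (Matrix.ext fun i j => ?_)
    simp only [Matrix.GeneralLinearGroup.map_apply]
    apply θ'.injective
    refine (θ'.apply_symm_apply _).trans ?_
    refine Eq.trans ?_ (h _)
    exact congrArg ψ (θ.apply_symm_apply _).symm
  simp only [transport, MonoidHom.comp_apply]
  rw [h1, σ.naturality]
  refine Units.ext (Matrix.ext fun i j => ?_)
  simp only [Matrix.GeneralLinearGroup.map_apply]
  exact (h _).symm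

theorem AlgInvolution.transport_involutive (σ : AlgInvolution k F n) {R E : Type u} [CommRing R]
    [Algebra k R] [CommRing E] [Algebra k E] (θ : R ⊗[k] F ≃ₐ[k] E) (X : GL (Fin n) E) :
    σ.transport θ (σ.transport θ X) = X := by
  have h1 : ∀ Y : GL (Fin n) (R ⊗[k] F), Matrix.GeneralLinearGroup.map θ.symm.toAlgHom.toRingHom
      (Matrix.GeneralLinearGroup.map θ.toAlgHom.toRingHom Y) = Y := fun Y =>
    Units.ext (Matrix.ext fun i j => θ.symm_apply_apply _)
  have h2 : ∀ Y : GL (Fin n) E, Matrix.GeneralLinearGroup.map θ.toAlgHom.toRingHom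
      (Matrix.GeneralLinearGroup.map θ.symm.toAlgHom.toRingHom Y) = Y := fun Y =>
    Units.ext (Matrix.ext fun i j => θ.apply_symm_apply _)
  simp only [transport, MonoidHom.comp_apply]
  rw [h1, σ.involutive, h2]

/-- The base change of a monoid algebra. -/
noncomputable def monoidAlgebraBaseChange (k F : Type u) [Field k] [Field F] [Algebra k F]
    (A : Type) [AddCommMonoid A] :
    AddMonoidAlgebra k A ⊗[k] F ≃ₐ[k] AddMonoidAlgebra F A :=
  (Algebra.TensorProduct.comm k _ F).trans
    ((AddMonoidAlgebra.scalarTensorEquiv k F (M := A)).restrictScalars k)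

theorem monoidAlgebraBaseChange_single_tmul (A : Type) [AddCommMonoid A] (a : A) (c : k) (x : F) :
    monoidAlgebraBaseChange k F A (AddMonoidAlgebra.single a c ⊗ₜ x) =
      AddMonoidAlgebra.single a (c • x) := by
  simp only [monoidAlgebraBaseChange, AlgEquiv.trans_apply, Algebra.TensorProduct.comm_tmul,
    AlgEquiv.restrictScalars_apply, AddMonoidAlgebra.scalarTensorEquiv_tmul]
  rw [AddMonoidAlgebra.mapAlgHom_single, AddMonoidAlgebra.smul_single, smul_eq_mul, mul_comm,
    Algebra.smul_def c x]
  rfl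

theorem tensor_monoidAlgebra_induction {A : Type} [AddCommMonoid A]
    {P : AddMonoidAlgebra k A ⊗[k] F → Prop} (h0 : P 0) (hadd : ∀ x y, P x → P y → P (x + y))
    (hs : ∀ a c x, P (AddMonoidAlgebra.single a c ⊗ₜ x)) (x) : P x := by
  induction x using TensorProduct.induction_on with
  | zero => exact h0
  | add x y hx hy => exact hadd x y hx hy
  | tmul r x =>
    induction r using AddMonoidAlgebra.induction_linear with
    | zero => rw [TensorProduct.zero_tmul]; exact h0
    | add r s hr hs => rw [TensorProduct.add_tmul]; exact hadd _ _ hr hs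
    | single a c => exact hs a c x

theorem AlgInvolution.transport_mapDomain (σ : AlgInvolution k F n) {A B : Type}
    [AddCommMonoid A] [AddCommMonoid B] (f : A →+ B) (X : GL (Fin n) (AddMonoidAlgebra F A)) :
    σ.transport (monoidAlgebraBaseChange k F B)
      (Matrix.GeneralLinearGroup.map (AddMonoidAlgebra.mapDomainRingHom F f) X) =
      Matrix.GeneralLinearGroup.map (AddMonoidAlgebra.mapDomainRingHom F f)
        (σ.transport (monoidAlgebraBaseChange k F A) X) := by
  refine σ.transport_map (AddMonoidAlgebra.mapDomainAlgHom k k f) _ (fun x => ?_) X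
  induction x using tensor_monoidAlgebra_induction with
  | h0 => simp only [map_zero]
  | hadd x y hx hy => simp only [map_add, hx, hy]
  | hs a c x =>
    rw [Algebra.TensorProduct.map_tmul, monoidAlgebraBaseChange_single_tmul,
      AddMonoidAlgebra.mapDomainAlgHom_apply, AddMonoidAlgebra.mapDomain_single, AlgHom.id_apply,
      monoidAlgebraBaseChange_single_tmul, AddMonoidAlgebra.mapDomainRingHom_apply,
      AddMonoidAlgebra.mapDomain_single]

/-- The matrix over the monoid algebra with the constant entries of a given one. -/
noncomputable def constGL (A : Type) [AddCommMonoid A] :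
    GL (Fin n) F →* GL (Fin n) (AddMonoidAlgebra F A) :=
  Matrix.GeneralLinearGroup.map (AddMonoidAlgebra.singleZeroRingHom)

theorem AlgInvolution.transport_constGL (σ : AlgInvolution k F n) (A : Type) [AddCommMonoid A]
    (X : GL (Fin n) F) :
    σ.transport (monoidAlgebraBaseChange k F A) (constGL A X) = constGL A (σ.points X) := by
  rw [σ.points_eq_transport]
  refine σ.transport_map AddMonoidAlgebra.singleZeroAlgHom _ (fun x => ?_) X
  induction x using TensorProduct.induction_on with
  | zero => simp only [map_zero]
  | add x y hx hy => simp only [map_add, hx, hy]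
  | tmul c x =>
    rw [Algebra.TensorProduct.map_tmul, Algebra.TensorProduct.lid_tmul, AlgHom.id_apply]
    exact (monoidAlgebraBaseChange_single_tmul A 0 c x).symm

/-- Evaluation of the elements of the monoid algebra at a multiplicative character with values
in `{0, 1}`. -/
noncomputable def evalGL {A : Type} [AddCommMonoid A] (χ : ∀ E : Type u, [Field E] →
    (Multiplicative A →* E)) :
    GL (Fin n) (AddMonoidAlgebra F A) →* GL (Fin n) F :=
  Matrix.GeneralLinearGroup.map (AddMonoidAlgebra.lift F F A (χ F)).toRingHom

/-- Used for the specialisations T = 1 and T = 0. Naturality concerns the specialisation over `k`,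
whose base change must be the one over `F`; hence a character given for both fields, with `hχ`. -/
theorem AlgInvolution.points_evalGL (σ : AlgInvolution k F n) {A : Type} [AddCommMonoid A]
    (χ : ∀ E : Type u, [Field E] → (Multiplicative A →* E))
    (hχ : ∀ a, algebraMap k F (χ k a) = χ F a)
    (X : GL (Fin n) (AddMonoidAlgebra F A)) :
    σ.points (evalGL χ X) = evalGL χ (σ.transport (monoidAlgebraBaseChange k F A) X) := by
  rw [σ.points_eq_transport]
  refine σ.transport_map (AddMonoidAlgebra.lift k k A (χ k)) _ (fun x => ?_) X
  induction x using tensor_monoidAlgebra_induction with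
  | h0 => simp only [map_zero]
  | hadd x y hx hy => simp only [map_add, hx, hy]
  | hs a c x =>
    rw [Algebra.TensorProduct.map_tmul, monoidAlgebraBaseChange_single_tmul,
      AddMonoidAlgebra.lift_single, AlgHom.id_apply, Algebra.TensorProduct.lid_tmul]
    refine (AddMonoidAlgebra.lift_single _ _ _).trans ?_
    rw [← hχ, smul_eq_mul, smul_eq_mul, Algebra.smul_def, Algebra.smul_def, map_mul]
    ring

end Transport

/-! ### Laurent coefficients and orthogonal idempotents -/

section GroupLike

variable {F : Type*} [Field F] {n : ℕ}

/-- Together with `coeff_mapDomain_diag` this compares coefficients in μ(ST) = μ(S) μ(T), so that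
the coefficient matrices of μ become orthogonal idempotents. -/
theorem coeff_mapDomain_inl_mul_inr (a b : AddMonoidAlgebra F ℤ) (i j : ℤ) :
    (AddMonoidAlgebra.mapDomain (AddMonoidHom.inl ℤ ℤ) a *
      AddMonoidAlgebra.mapDomain (AddMonoidHom.inr ℤ ℤ) b).coeff (i, j) =
      a.coeff i * b.coeff j := by
  induction a using AddMonoidAlgebra.induction_linear with
  | zero => simp
  | add a a' h h' =>
    simp only [AddMonoidAlgebra.mapDomain_add, add_mul, AddMonoidAlgebra.coeff_add,
      Finsupp.add_apply, h, h']
  | single m x =>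
    induction b using AddMonoidAlgebra.induction_linear with
    | zero => simp
    | add b b' h h' =>
      simp only [AddMonoidAlgebra.mapDomain_add, mul_add, AddMonoidAlgebra.coeff_add,
        Finsupp.add_apply, h, h']
    | single l y =>
      rw [AddMonoidAlgebra.mapDomain_single, AddMonoidAlgebra.mapDomain_single,
        AddMonoidAlgebra.single_mul_single]
      simp only [AddMonoidAlgebra.coeff_single, Finsupp.single_apply, AddMonoidHom.inl_apply,
        AddMonoidHom.inr_apply, Prod.mk_add_mk, add_zero, zero_add, Prod.mk.injEq]
      by_cases h1 : m = i <;> by_cases h2 : l = j <;> simp [h1, h2]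

theorem coeff_mapDomain_diag (a : AddMonoidAlgebra F ℤ) (i j : ℤ) :
    (AddMonoidAlgebra.mapDomain ((AddMonoidHom.id ℤ).prod (AddMonoidHom.id ℤ)) a).coeff (i, j) =
      if i = j then a.coeff i else 0 := by
  induction a using AddMonoidAlgebra.induction_linear with
  | zero => simp
  | add a a' h h' =>
    simp only [AddMonoidAlgebra.mapDomain_add, AddMonoidAlgebra.coeff_add, Finsupp.add_apply, h, h']
    split_ifs <;> simp
  | single m x =>
    rw [AddMonoidAlgebra.mapDomain_single]
    simp only [AddMonoidAlgebra.coeff_single, Finsupp.single_apply, AddMonoidHom.prod_apply,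
      AddMonoidHom.id_apply, Prod.mk.injEq]
    by_cases h1 : m = i <;> by_cases h2 : m = j <;> by_cases h3 : i = j <;> simp_all

/-- A complete orthogonal family of idempotent matrices is diagonal in some basis. -/
theorem exists_basis_of_orthogonal_idempotents {e : ℤ → Matrix (Fin n) (Fin n) F} (S : Finset ℤ)
    (hmul : ∀ i j, e i * e j = if i = j then e i else 0)
    (hsum : ∑ i ∈ S, e i = 1) :
    ∃ (b : GL (Fin n) F) (w : Fin n → ℤ), ∀ i,
      e i = b.val * Matrix.diagonal (fun r => if w r = i then 1 else 0) * b⁻¹.val := by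
  classical
  let f : ℤ → ((Fin n → F) →ₗ[F] (Fin n → F)) := fun i => Matrix.toLin' (e i)
  have fmul : ∀ i j x, f i (f j x) = if i = j then f i x else 0 := by
    intro i j x
    have := congrArg (fun M => Matrix.toLin' M x) (hmul i j)
    simp only [Matrix.toLin'_mul, LinearMap.comp_apply] at this
    rw [this]
    split_ifs <;> simp [f]
  let W : S → Submodule F (Fin n → F) := fun i => LinearMap.range (f i)
  have hint : DirectSum.IsInternal W := by
    rw [DirectSum.isInternal_submodule_iff_iSupIndep_and_iSup_eq_top]
    constructor
    · rw [iSupIndep_def]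
      intro i
      rw [Submodule.disjoint_def]
      rintro _ ⟨x, rfl⟩ hx
      have hle : (⨆ j, ⨆ (_ : j ≠ i), W j) ≤ LinearMap.ker (f i) := by
        refine iSup₂_le fun j hj => ?_
        rintro _ ⟨y, rfl⟩
        rw [LinearMap.mem_ker, fmul, if_neg fun h => hj (Subtype.ext h.symm)]
      have := hle hx
      rwa [LinearMap.mem_ker, fmul, if_pos rfl] at this
    · rw [eq_top_iff]
      intro x _
      have hx : x = ∑ i ∈ S, f i x := by
        rw [← LinearMap.sum_apply, ← map_sum, hsum, Matrix.toLin'_one, LinearMap.id_apply]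
      rw [hx]
      exact Submodule.sum_mem _ fun i hi =>
        Submodule.mem_iSup_of_mem (⟨i, hi⟩ : S) ⟨x, rfl⟩
  let B := hint.collectedBasis fun i => Module.finBasis F (W i)
  have hcard : Fintype.card (Σ i : S, Fin (Module.finrank F (W i))) = n := by
    rw [← Module.finrank_eq_card_basis B, Module.finrank_fin_fun]
  let E := Fintype.equivFinOfCardEq hcard
  let B' := B.reindex E
  let w : Fin n → ℤ := fun r => ((E.symm r).1 : ℤ)
  have hB : ∀ i r, f i (B' r) = if w r = i then B' r else 0 := by
    intro i r
    have hmem : B' r ∈ W (E.symm r).1 := by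
      simp only [B', Module.Basis.reindex_apply]
      exact hint.collectedBasis_mem _ _
    obtain ⟨y, hy⟩ := hmem
    rw [← hy, fmul]
    by_cases h : i = w r
    · rw [if_pos h, if_pos h.symm, h]
    · rw [if_neg h, if_neg (Ne.symm h)]
  let b : GL (Fin n) F :=
    ⟨(Pi.basisFun F (Fin n)).toMatrix B', B'.toMatrix (Pi.basisFun F (Fin n)),
      Module.Basis.toMatrix_mul_toMatrix_flip _ _, Module.Basis.toMatrix_mul_toMatrix_flip _ _⟩
  have hb : ∀ r s, b.val r s = B' s r := fun r s => by
    simp [b, Module.Basis.toMatrix_apply]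
  refine ⟨b, w, fun i => ?_⟩
  have key : e i * b.val = b.val * Matrix.diagonal (fun r => if w r = i then 1 else 0) := by
    ext r s
    rw [Matrix.mul_diagonal, hb]
    have := congrFun (hB i s) r
    simp only [f, Matrix.toLin'_apply, Matrix.mulVec, dotProduct] at this
    rw [Matrix.mul_apply]
    simp only [hb]
    rw [this]
    split_ifs <;> simp
  rw [← key, mul_assoc, ← Units.val_mul, mul_inv_cancel, Units.val_one, mul_one]

end GroupLike

/-! ### Parabolic subgroups as limits along cocharacters -/

section Cocharacter

variable {F : Type u} [Field F] {n : ℕ}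

/-- The diagonal matrix with the entries `T ^ w i`. -/
noncomputable def diagGL (F : Type u) [Field F] (w : Fin n → ℤ) :
    GL (Fin n) (AddMonoidAlgebra F ℤ) where
  val := Matrix.diagonal fun i => AddMonoidAlgebra.single (w i) 1
  inv := Matrix.diagonal fun i => AddMonoidAlgebra.single (-w i) 1
  val_inv := by
    rw [Matrix.diagonal_mul_diagonal, ← Matrix.diagonal_one]
    congr 1
    ext1 i
    rw [AddMonoidAlgebra.single_mul_single, add_neg_cancel, mul_one]
    rfl
  inv_val := by
    rw [Matrix.diagonal_mul_diagonal, ← Matrix.diagonal_one]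
    congr 1
    ext1 i
    rw [AddMonoidAlgebra.single_mul_single, neg_add_cancel, mul_one]
    rfl

/-- The cocharacter with the weights `w` in the basis `b`. -/
noncomputable def cochar (b : GL (Fin n) F) (w : Fin n → ℤ) :
    GL (Fin n) (AddMonoidAlgebra F ℤ) :=
  constGL ℤ b * diagGL F w * (constGL ℤ b)⁻¹

/-- The computation behind all three descriptions below: absence of negative powers gives P, value 1
at T = 0 gives U, and constancy in T gives L. -/
theorem diagGL_conj_apply (w : Fin n → ℤ) (x : GL (Fin n) F) (r s : Fin n) :
    ((diagGL F w)⁻¹ * constGL ℤ x * diagGL F w).val r s =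
      AddMonoidAlgebra.single (w s - w r) (x.val r s) := by
  rw [Units.val_mul, Units.val_mul]
  change (Matrix.diagonal (fun i => AddMonoidAlgebra.single (-w i) (1 : F)) * (constGL ℤ x).val *
    Matrix.diagonal (fun i => AddMonoidAlgebra.single (w i) (1 : F)) :
      Matrix (Fin n) (Fin n) (AddMonoidAlgebra F ℤ)) r s = _
  rw [Matrix.mul_diagonal, Matrix.diagonal_mul]
  change AddMonoidAlgebra.single (-w r) (1 : F) * AddMonoidAlgebra.single 0 (x.val r s) *
    AddMonoidAlgebra.single (w s) (1 : F) = _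
  rw [AddMonoidAlgebra.single_mul_single, AddMonoidAlgebra.single_mul_single, one_mul, mul_one,
    add_zero, neg_add_eq_sub]

/-- Polynomial matrices as Laurent polynomial matrices. -/
noncomputable def polyGL : GL (Fin n) (AddMonoidAlgebra F ℕ) →* GL (Fin n) (AddMonoidAlgebra F ℤ) :=
  Matrix.GeneralLinearGroup.map (AddMonoidAlgebra.mapDomainRingHom F (Nat.castAddMonoidHom ℤ))

/-- The value of a polynomial matrix at `0`. -/
noncomputable def evalZeroGL : GL (Fin n) (AddMonoidAlgebra F ℕ) →* GL (Fin n) F :=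
  evalGL (A := ℕ) fun E _ => powersHom E 0

theorem polyGL_constGL (x : GL (Fin n) F) : polyGL (constGL ℕ x) = constGL ℤ x := by
  refine Units.ext (Matrix.ext fun r s => ?_)
  exact AddMonoidAlgebra.mapDomain_single

theorem evalZeroGL_constGL (x : GL (Fin n) F) : evalZeroGL (constGL ℕ x) = x := by
  refine Units.ext (Matrix.ext fun r s => ?_)
  change AddMonoidAlgebra.lift F F ℕ _ (AddMonoidAlgebra.single 0 (x.val r s)) = _
  rw [AddMonoidAlgebra.lift_single]
  simp

theorem polyGL_conj (b : GL (Fin n) F) (Y : GL (Fin n) (AddMonoidAlgebra F ℕ)) :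
    polyGL (constGL ℕ b * Y * (constGL ℕ b)⁻¹) = constGL ℤ b * polyGL Y * (constGL ℤ b)⁻¹ := by
  rw [map_mul, map_mul, map_inv, polyGL_constGL]

theorem evalZeroGL_conj (b : GL (Fin n) F) (Y : GL (Fin n) (AddMonoidAlgebra F ℕ)) :
    evalZeroGL (constGL ℕ b * Y * (constGL ℕ b)⁻¹) = b * evalZeroGL Y * b⁻¹ := by
  rw [map_mul, map_mul, map_inv, evalZeroGL_constGL]

theorem mapDomain_natCast_injective : Function.Injective
    (AddMonoidAlgebra.mapDomain (R := F) (Nat.castAddMonoidHom ℤ)) :=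
  AddMonoidAlgebra.mapDomain_injective fun _ _ h => Nat.cast_injective h

/-- The polynomial matrix which is conjugate to an element of the parabolic subgroup. -/
noncomputable def polyMatrix (w : Fin n → ℤ) (X : Matrix (Fin n) (Fin n) F) :
    Matrix (Fin n) (Fin n) (AddMonoidAlgebra F ℕ) :=
  Matrix.of fun r s => AddMonoidAlgebra.single (w s - w r).toNat (X r s)

theorem map_polyMatrix (w : Fin n → ℤ) {x : GL (Fin n) F} (hx : ∀ r s, w s < w r → x.val r s = 0) :
    (polyMatrix w x.val).map (AddMonoidAlgebra.mapDomainRingHom F (Nat.castAddMonoidHom ℤ)) =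
      ((diagGL F w)⁻¹ * constGL ℤ x * diagGL F w).val := by
  ext1 r s
  rw [diagGL_conj_apply, Matrix.map_apply, AddMonoidAlgebra.mapDomainRingHom_apply, polyMatrix,
    Matrix.of_apply, AddMonoidAlgebra.mapDomain_single]
  by_cases h : w s < w r
  · rw [hx r s h, AddMonoidAlgebra.single_zero, AddMonoidAlgebra.single_zero]
  · congr 1
    simp only [Nat.coe_castAddMonoidHom]
    omega

/-- Invertibility over polynomials needs the inverse to be polynomial too; that the two are inverse
is checked in the larger ring of Laurent polynomials. -/
theorem exists_polyGL (w : Fin n → ℤ) {x : GL (Fin n) F} (hx : ∀ r s, w s < w r → x.val r s = 0)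
    (hx' : ∀ r s, w s < w r → x⁻¹.val r s = 0) :
    ∃ Y : GL (Fin n) (AddMonoidAlgebra F ℕ), Y.val = polyMatrix w x.val ∧
      polyGL Y = (diagGL F w)⁻¹ * constGL ℤ x * diagGL F w := by
  have hinj : Function.Injective fun M : Matrix (Fin n) (Fin n) (AddMonoidAlgebra F ℕ) =>
      M.map (AddMonoidAlgebra.mapDomainRingHom F (Nat.castAddMonoidHom ℤ)) :=
    Matrix.map_injective mapDomain_natCast_injective
  have hone : ∀ y z : GL (Fin n) F, (∀ r s, w s < w r → y.val r s = 0) →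
      (∀ r s, w s < w r → z.val r s = 0) → y * z = 1 →
      polyMatrix w y.val * polyMatrix w z.val = 1 := by
    intro y z hy hz hyz
    apply hinj
    simp only
    rw [Matrix.map_mul, map_polyMatrix w hy, map_polyMatrix w hz, ← Units.val_mul,
      show (diagGL F w)⁻¹ * constGL ℤ y * diagGL F w * ((diagGL F w)⁻¹ * constGL ℤ z * diagGL F w)
        = (diagGL F w)⁻¹ * (constGL ℤ y * constGL ℤ z) * diagGL F w by group,
      ← map_mul, hyz, map_one, mul_one, inv_mul_cancel, Units.val_one,
      Matrix.map_one _ (map_zero _) (map_one _)]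
  exact ⟨⟨polyMatrix w x.val, polyMatrix w x⁻¹.val, hone _ _ hx hx' (mul_inv_cancel x),
    hone _ _ hx' hx (inv_mul_cancel x)⟩, rfl, Units.ext (map_polyMatrix w hx)⟩

/-- Only exponent 0 survives at T = 0. Since `Int.toNat` truncates, negative differences count as
exponent 0, whence `≤` and not `=`. -/
theorem evalZeroGL_polyMatrix (w : Fin n → ℤ) {X : Matrix (Fin n) (Fin n) F}
    {Y : GL (Fin n) (AddMonoidAlgebra F ℕ)} (hY : Y.val = polyMatrix w X) (r s : Fin n) :
    (evalZeroGL Y).val r s = if w s ≤ w r then X r s else 0 := by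
  change AddMonoidAlgebra.lift F F ℕ _ (Y.val r s) = _
  rw [hY]
  change AddMonoidAlgebra.lift F F ℕ _ (AddMonoidAlgebra.single (w s - w r).toNat (X r s)) = _
  rw [AddMonoidAlgebra.lift_single]
  simp only [powersHom_apply, toAdd_ofAdd, smul_eq_mul, zero_pow_eq, Int.toNat_eq_zero, mul_ite,
    mul_one, mul_zero, sub_nonpos]

/-- The weights `w` define the same ordered partition as the blocks of `D`. -/
def HasWeights (D : ParabolicPair n F) (w : Fin n → ℤ) : Prop :=
  ∀ r s, D.blk r < D.blk s ↔ w r < w s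

theorem cochar_conj (b : GL (Fin n) F) (w : Fin n → ℤ) (x : GL (Fin n) F) :
    (cochar b w)⁻¹ * constGL ℤ x * cochar b w = constGL ℤ b *
      ((diagGL F w)⁻¹ * constGL ℤ (b⁻¹ * x * b) * diagGL F w) * (constGL ℤ b)⁻¹ := by
  simp only [cochar, map_mul, map_inv]
  group

/-- Existence of `Y` says that λ(T)⁻¹ x λ(T) has a limit at T = 0. This criterion uses only
operations with which an algebraic involution is compatible. -/
theorem mem_parabolic_iff_cochar {D : ParabolicPair n F} {w : Fin n → ℤ} (hw : HasWeights D w)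
    (x : GL (Fin n) F) : x ∈ D.parabolic ↔
      ∃ Y, (cochar D.basis w)⁻¹ * constGL ℤ x * cochar D.basis w = polyGL Y := by
  rw [D.mem_parabolic, cochar_conj]
  constructor
  · intro h
    have h' := inv_mem h
    obtain ⟨Y, -, hY⟩ := exists_polyGL w (fun r s hrs => h r s ((hw s r).mpr hrs))
      (fun r s hrs => h' r s ((hw s r).mpr hrs))
    refine ⟨constGL ℕ D.basis * Y * (constGL ℕ D.basis)⁻¹, ?_⟩
    rw [polyGL_conj, hY]
  · rintro ⟨Y, hY⟩ r s hrs
    have h2 : (diagGL F w)⁻¹ * constGL ℤ (D.basis⁻¹ * x * D.basis) * diagGL F w =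
        polyGL (constGL ℕ D.basis⁻¹ * Y * (constGL ℕ D.basis⁻¹)⁻¹) := by
      rw [polyGL_conj, ← hY, map_inv (constGL ℤ) D.basis]
      group
    have h3 := diagGL_conj_apply w (D.basis⁻¹ * x * D.basis) r s
    rw [h2] at h3
    have h4 := congrArg (fun z => AddMonoidAlgebra.coeff z (w s - w r)) h3
    simp only [AddMonoidAlgebra.coeff_single, Finsupp.single_eq_same] at h4
    rw [← h4]
    change (AddMonoidAlgebra.mapDomain (Nat.castAddMonoidHom ℤ) _).coeff _ = 0
    rw [AddMonoidAlgebra.coeff_mapDomain]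
    refine Finsupp.mapDomain_of_notMem_range _ _ ?_
    rintro ⟨m, hm⟩
    have := (hw s r).mp hrs
    simp only [Nat.coe_castAddMonoidHom] at hm
    omega

theorem mem_unipotentRadical_iff_cochar {D : ParabolicPair n F} {w : Fin n → ℤ}
    (hw : HasWeights D w) (x : GL (Fin n) F) : x ∈ D.unipotentRadical ↔
      ∃ Y, (cochar D.basis w)⁻¹ * constGL ℤ x * cochar D.basis w = polyGL Y ∧
        evalZeroGL Y = 1 := by
  have hle : ∀ r s, w r ≤ w s ↔ D.blk r ≤ D.blk s := fun r s => by
    rw [← not_lt, ← hw, not_lt]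
  have key : ∀ x ∈ D.parabolic, ∃ Y,
      (cochar D.basis w)⁻¹ * constGL ℤ x * cochar D.basis w = polyGL Y ∧
        (evalZeroGL Y = 1 ↔ x ∈ D.unipotentRadical) := by
    intro x hx
    rw [D.mem_parabolic] at hx
    have hx' := inv_mem hx
    obtain ⟨Y, hY0, hY⟩ := exists_polyGL w (fun r s hrs => hx r s ((hw s r).mpr hrs))
      (fun r s hrs => hx' r s ((hw s r).mpr hrs))
    refine ⟨constGL ℕ D.basis * Y * (constGL ℕ D.basis)⁻¹, ?_, ?_⟩
    · rw [cochar_conj, polyGL_conj, hY]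
    · rw [evalZeroGL_conj, D.mem_unipotentRadical, conj_eq_one_iff]
      constructor
      · intro h r s hrs
        have h1 := evalZeroGL_polyMatrix w hY0 r s
        rw [h, if_pos ((hle s r).mpr hrs)] at h1
        exact h1.symm
      · intro h
        refine Units.ext (Matrix.ext fun r s => ?_)
        rw [evalZeroGL_polyMatrix w hY0 r s]
        split_ifs with hrs
        · exact h r s ((hle s r).mp hrs)
        · exact (Matrix.one_apply_ne fun e => hrs (congrArg w e.symm).le).symm
  -- The limit is unique, so the given `Y` is the one constructed in `key`.
  have hinj : Function.Injective (polyGL (F := F) (n := n)) := fun Y Z h =>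
    Units.ext (Matrix.map_injective mapDomain_natCast_injective (congrArg Units.val h))
  constructor
  · intro hx
    obtain ⟨Y, hY, hY1⟩ := key x (D.unipotentRadical_le_parabolic hx)
    exact ⟨Y, hY, hY1.mpr hx⟩
  · rintro ⟨Y, hY, hY1⟩
    obtain ⟨Z, hZ, hZ1⟩ := key x ((mem_parabolic_iff_cochar hw x).mpr ⟨Y, hY⟩)
    rw [← hZ1, ← hinj (hY.symm.trans hZ), hY1]

/-- The Levi subgroup is the centraliser of the cocharacter: an entry is unchanged by conjugation
exactly if it vanishes or its two weights agree. -/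
theorem mem_levi_iff_cochar {D : ParabolicPair n F} {w : Fin n → ℤ} (hw : HasWeights D w)
    (x : GL (Fin n) F) : x ∈ D.levi ↔
      (cochar D.basis w)⁻¹ * constGL ℤ x * cochar D.basis w = constGL ℤ x := by
  have hne : ∀ r s, D.blk r ≠ D.blk s ↔ w r ≠ w s := fun r s => by
    rw [← lt_or_lt_iff_ne, ← lt_or_lt_iff_ne, hw, hw]
  rw [D.mem_levi, cochar_conj]
  set y := D.basis⁻¹ * x * D.basis with hy
  have hx : x = D.basis * y * D.basis⁻¹ := by rw [hy]; group
  rw [show constGL ℤ x = constGL ℤ D.basis * constGL ℤ y * (constGL ℤ D.basis)⁻¹ by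
    rw [hx, map_mul, map_mul, map_inv], mul_left_inj, mul_right_inj]
  constructor
  · intro h
    refine Units.ext (Matrix.ext fun r s => ?_)
    rw [diagGL_conj_apply]
    change _ = AddMonoidAlgebra.single 0 (y.val r s)
    by_cases hrs : w r = w s
    · rw [hrs, sub_self]
    · rw [h r s ((hne r s).mpr hrs), AddMonoidAlgebra.single_zero, AddMonoidAlgebra.single_zero]
  · intro h r s hrs
    have h3 := diagGL_conj_apply w y r s
    rw [h] at h3
    have h4 := congrArg (fun z => AddMonoidAlgebra.coeff z (w s - w r)) h3
    simp only [AddMonoidAlgebra.coeff_single, Finsupp.single_eq_same] at h4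
    rw [← h4]
    change (AddMonoidAlgebra.single 0 (y.val r s)).coeff _ = 0
    rw [AddMonoidAlgebra.coeff_single, Finsupp.single_apply, if_neg]
    have := (hne r s).mp hrs
    omega

end Cocharacter

/-! ### Group-like Laurent matrices are cocharacters -/

section GroupLikeElements

variable {F : Type u} [Field F] {n : ℕ}

/-- The map on matrices over monoid algebras which is induced by a homomorphism of monoids. -/
noncomputable def mapDomainGL {A B : Type} [AddCommMonoid A] [AddCommMonoid B] (f : A →+ B) :
    GL (Fin n) (AddMonoidAlgebra F A) →* GL (Fin n) (AddMonoidAlgebra F B) :=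
  Matrix.GeneralLinearGroup.map (AddMonoidAlgebra.mapDomainRingHom F f)

theorem mapDomainGL_constGL {A B : Type} [AddCommMonoid A] [AddCommMonoid B] (f : A →+ B)
    (x : GL (Fin n) F) : mapDomainGL f (constGL A x) = constGL B x := by
  refine Units.ext (Matrix.ext fun r s => ?_)
  refine AddMonoidAlgebra.mapDomain_single.trans ?_
  rw [map_zero]
  rfl

/-- A Laurent polynomial matrix which defines a one-parameter group. -/
structure IsGroupLike (μ : GL (Fin n) (AddMonoidAlgebra F ℤ)) : Prop where
  diag : mapDomainGL ((AddMonoidHom.id ℤ).prod (AddMonoidHom.id ℤ)) μ =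
    mapDomainGL (AddMonoidHom.inl ℤ ℤ) μ * mapDomainGL (AddMonoidHom.inr ℤ ℤ) μ
  eval_one : evalGL (A := ℤ) (fun _ _ => 1) μ = 1

theorem mapDomainGL_diagGL_apply {B : Type} [AddCommMonoid B] (f : ℤ →+ B) (w : Fin n → ℤ) :
    (mapDomainGL f (diagGL F w)).val =
      Matrix.diagonal fun i => AddMonoidAlgebra.single (f (w i)) 1 := by
  ext1 r s
  change AddMonoidAlgebra.mapDomain f (Matrix.diagonal _ r s) = _
  by_cases h : r = s
  · subst h
    rw [Matrix.diagonal_apply_eq, Matrix.diagonal_apply_eq, AddMonoidAlgebra.mapDomain_single]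
  · rw [Matrix.diagonal_apply_ne _ h, Matrix.diagonal_apply_ne _ h,
      AddMonoidAlgebra.mapDomain_zero]

theorem isGroupLike_cochar (b : GL (Fin n) F) (w : Fin n → ℤ) : IsGroupLike (cochar b w) := by
  constructor
  · have hd : mapDomainGL ((AddMonoidHom.id ℤ).prod (AddMonoidHom.id ℤ)) (diagGL F w) =
        mapDomainGL (AddMonoidHom.inl ℤ ℤ) (diagGL F w) *
          mapDomainGL (AddMonoidHom.inr ℤ ℤ) (diagGL F w) := by
      refine Units.ext ?_
      rw [Units.val_mul, mapDomainGL_diagGL_apply, mapDomainGL_diagGL_apply,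
        mapDomainGL_diagGL_apply, Matrix.diagonal_mul_diagonal]
      congr 1
      ext1 i
      rw [AddMonoidAlgebra.single_mul_single, mul_one]
      simp
    simp only [cochar, map_mul, map_inv, mapDomainGL_constGL, hd]
    group
  · have hd : evalGL (A := ℤ) (fun _ _ => 1) (diagGL F w) = 1 := by
      refine Units.ext (Matrix.ext fun r s => ?_)
      change AddMonoidAlgebra.lift F F ℤ _ (Matrix.diagonal _ r s) = _
      by_cases h : r = s
      · subst h
        rw [Matrix.diagonal_apply_eq, AddMonoidAlgebra.lift_single]
        simp
      · rw [Matrix.diagonal_apply_ne _ h, map_zero, Units.val_one, Matrix.one_apply_ne h]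
    rw [cochar, map_mul, map_mul, hd, map_inv, mul_one, mul_inv_cancel]

theorem sum_coeff_eq_lift_one (a : AddMonoidAlgebra F ℤ) {S : Finset ℤ} (hS : a.coeff.support ⊆ S) :
    ∑ m ∈ S, a.coeff m = AddMonoidAlgebra.lift F F ℤ 1 a := by
  rw [AddMonoidAlgebra.lift_apply, Finsupp.sum_of_support_subset _ hS _ (by simp)]
  simp

/-- The coefficient matrices are orthogonal idempotents by `diag` and sum to 1 by `eval_one`; a
basis adapted to their images diagonalises μ, with the exponents as weights. -/
theorem IsGroupLike.exists_eq_cochar {μ : GL (Fin n) (AddMonoidAlgebra F ℤ)} (h : IsGroupLike μ) :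
    ∃ b w, μ = cochar b w := by
  classical
  let e : ℤ → Matrix (Fin n) (Fin n) F := fun m => Matrix.of fun r s => (μ.val r s).coeff m
  let S : Finset ℤ := Finset.univ.biUnion fun r => Finset.univ.biUnion fun s =>
    (μ.val r s).coeff.support
  have hS : ∀ r s, (μ.val r s).coeff.support ⊆ S := fun r s =>
    (Finset.subset_biUnion_of_mem (fun s => (μ.val r s).coeff.support) (Finset.mem_univ s)).trans
      (Finset.subset_biUnion_of_mem (fun r => Finset.univ.biUnion fun s =>
        (μ.val r s).coeff.support) (Finset.mem_univ r))
  have hmul : ∀ i j, e i * e j = if i = j then e i else 0 := by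
    intro i j
    ext r s
    have h1 := congrArg (fun M => (M.val r s).coeff (i, j)) h.diag
    simp only [Units.val_mul, Matrix.mul_apply] at h1
    change (AddMonoidAlgebra.mapDomain ((AddMonoidHom.id ℤ).prod (AddMonoidHom.id ℤ))
      (μ.val r s)).coeff (i, j) = (∑ t, AddMonoidAlgebra.mapDomain (AddMonoidHom.inl ℤ ℤ)
        (μ.val r t) * AddMonoidAlgebra.mapDomain (AddMonoidHom.inr ℤ ℤ)
        (μ.val t s)).coeff (i, j) at h1
    rw [coeff_mapDomain_diag, AddMonoidAlgebra.coeff_sum, Finsupp.finsetSum_apply] at h1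
    simp only [coeff_mapDomain_inl_mul_inr] at h1
    rw [Matrix.mul_apply]
    simp only [e, Matrix.of_apply]
    rw [← h1]
    split_ifs <;> rfl
  have hsum : ∑ i ∈ S, e i = 1 := by
    ext r s
    rw [Matrix.sum_apply]
    refine (sum_coeff_eq_lift_one (μ.val r s) (hS r s)).trans ?_
    exact congrArg (fun M => M.val r s) h.eval_one
  obtain ⟨b, w, hb⟩ := exists_basis_of_orthogonal_idempotents S hmul hsum
  refine ⟨b, w, Units.ext (Matrix.ext fun r s => AddMonoidAlgebra.ext (Finsupp.ext fun m => ?_))⟩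
  have h1 := congrFun (congrFun (hb m) r) s
  rw [Matrix.mul_apply] at h1
  simp only [Matrix.mul_diagonal] at h1
  refine h1.trans ?_
  have h2 : (cochar b w).val r s =
      ∑ t, AddMonoidAlgebra.single (w t) (b.val r t * b⁻¹.val t s) := by
    rw [cochar, ← map_inv, Units.val_mul, Units.val_mul, Matrix.mul_apply]
    refine Finset.sum_congr rfl fun t _ => ?_
    change ((constGL ℤ b).val * Matrix.diagonal _ : Matrix (Fin n) (Fin n) _) r t *
      AddMonoidAlgebra.single 0 (b⁻¹.val t s) = _
    rw [Matrix.mul_diagonal]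
    change AddMonoidAlgebra.single 0 (b.val r t) * AddMonoidAlgebra.single (w t) 1 *
      AddMonoidAlgebra.single 0 (b⁻¹.val t s) = _
    rw [AddMonoidAlgebra.single_mul_single, AddMonoidAlgebra.single_mul_single, mul_one, zero_add,
      add_zero]
  rw [h2, AddMonoidAlgebra.coeff_sum, Finsupp.finsetSum_apply]
  refine Finset.sum_congr rfl fun t _ => ?_
  rw [AddMonoidAlgebra.coeff_single, Finsupp.single_apply]
  split_ifs <;> simp

end GroupLikeElements

/-! ### Algebraic involutions permute parabolic pairs -/

section PermutesParabolics

variable {k F : Type u} [Field k] [Field F] [Algebra k F] {n : ℕ}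

/-- Both conditions are phrased by maps of exponents and a specialisation, which commute with the
involution by naturality. -/
theorem AlgInvolution.isGroupLike_transport (σ : AlgInvolution k F n)
    {μ : GL (Fin n) (AddMonoidAlgebra F ℤ)} (h : IsGroupLike μ) :
    IsGroupLike (σ.transport (monoidAlgebraBaseChange k F ℤ) μ) := by
  constructor
  · simp only [mapDomainGL]
    rw [← σ.transport_mapDomain, ← σ.transport_mapDomain, ← σ.transport_mapDomain, ← map_mul]
    exact congrArg _ h.diag
  · rw [← σ.points_evalGL _ fun a => by simp, h.eval_one, map_one]

theorem AlgInvolution.points_involutive (σ : AlgInvolution k F n) (X : GL (Fin n) F) :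
    σ.points (σ.points X) = X := σ.transport_involutive _ X

theorem exists_hasWeights (b : GL (Fin n) F) (w : Fin n → ℤ) :
    ∃ D : ParabolicPair n F, D.basis = b ∧ HasWeights D w := by
  -- Block labels are natural numbers, so the integral weights are shifted by a common constant.
  obtain ⟨C, hC⟩ : ∃ C : ℕ, ∀ i, 0 ≤ w i + C :=
    ⟨Finset.univ.sup fun i => (w i).natAbs, fun i => by
      have := Finset.le_sup (f := fun i => (w i).natAbs) (Finset.mem_univ i)
      omega⟩
  refine ⟨⟨b, fun i => (w i + C).toNat⟩, rfl, fun r s => ?_⟩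
  have := hC r
  have := hC s
  change (w r + C).toNat < (w s + C).toNat ↔ _
  omega

/-- An algebraic involution permutes the pairs of a parabolic subgroup and a Levi subgroup. -/
theorem AlgInvolution.exists_image_pair (σ : AlgInvolution k F n) (D : ParabolicPair n F) :
    ∃ E : ParabolicPair n F, (∀ x, x ∈ E.parabolic ↔ σ.points x ∈ D.parabolic) ∧
      (∀ x, x ∈ E.levi ↔ σ.points x ∈ D.levi) ∧
      (∀ x, x ∈ E.unipotentRadical ↔ σ.points x ∈ D.unipotentRadical) := by
  -- The labels of `D` serve as weights. The image of the resulting cocharacter is again a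
  -- cocharacter, and its basis and weights define `E`.
  let w : Fin n → ℤ := fun i => D.blk i
  have hw : HasWeights D w := fun r s => by simp [w]
  set τ := σ.transport (monoidAlgebraBaseChange k F ℤ) with hτ
  obtain ⟨b, v, hμ⟩ :=
    (σ.isGroupLike_transport (isGroupLike_cochar D.basis w)).exists_eq_cochar
  rw [← hτ] at hμ
  obtain ⟨E, rfl, hE⟩ := exists_hasWeights b v
  have hc : ∀ x, τ ((cochar D.basis w)⁻¹ * constGL ℤ (σ.points x) * cochar D.basis w) =
      (cochar E.basis v)⁻¹ * constGL ℤ x * cochar E.basis v := fun x => by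
    rw [map_mul, map_mul, map_inv, hμ, hτ, σ.transport_constGL, σ.points_involutive]
  have hc' : ∀ x, τ ((cochar E.basis v)⁻¹ * constGL ℤ x * cochar E.basis v) =
      (cochar D.basis w)⁻¹ * constGL ℤ (σ.points x) * cochar D.basis w := fun x => by
    rw [← hc, hτ, σ.transport_involutive]
  have hp : ∀ Y, τ (polyGL Y) = polyGL (σ.transport (monoidAlgebraBaseChange k F ℕ) Y) := fun Y =>
    σ.transport_mapDomain _ Y
  have hz : ∀ Y, evalZeroGL (σ.transport (monoidAlgebraBaseChange k F ℕ) Y) =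
      σ.points (evalZeroGL Y) := fun Y => by
    refine (σ.points_evalGL (A := ℕ) (fun E _ => powersHom E 0) (fun a => ?_) Y).symm
    simp [powersHom_apply]
  refine ⟨E, fun x => ?_, fun x => ?_, fun x => ?_⟩
  · rw [mem_parabolic_iff_cochar hE, mem_parabolic_iff_cochar hw]
    constructor
    · rintro ⟨Y, hY⟩
      exact ⟨_, by rw [← hc', hY, hp]⟩
    · rintro ⟨Y, hY⟩
      exact ⟨_, by rw [← hc, hY, hp]⟩
  · rw [mem_levi_iff_cochar hE, mem_levi_iff_cochar hw]
    constructor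
    · intro hY
      rw [← hc', hY, hτ, σ.transport_constGL]
    · intro hY
      rw [← hc, hY, hτ, σ.transport_constGL, σ.points_involutive]
  · rw [mem_unipotentRadical_iff_cochar hE, mem_unipotentRadical_iff_cochar hw]
    constructor
    · rintro ⟨Y, hY, hY1⟩
      exact ⟨_, by rw [← hc', hY, hp], by rw [hz, hY1, map_one]⟩
    · rintro ⟨Y, hY, hY1⟩
      exact ⟨_, by rw [← hc, hY, hp], by rw [hz, hY1, map_one]⟩

end PermutesParabolics

/-! ### A fixed point argument for groups of odd order -/

section TwistedFixedPoints

variable {G : Type*} [Group G]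

/-- If an involution maps the pair `(L₁, L₂)` to a conjugate of the pair `(L₂, L₁)` under a stable
group of odd order, then it interchanges the members of a conjugate pair. -/
theorem exists_conj_interchanged [Finite G] {σ : G →* G} (hσ : ∀ x, σ (σ x) = x) {Q : Subgroup G}
    (hQσ : ∀ y ∈ Q, σ y ∈ Q) (hQ : Odd (Nat.card Q)) {L₁ L₂ : Subgroup G} {x : G} (hx : x ∈ Q)
    (h₁ : ∀ y, x⁻¹ * y * x ∈ L₁ ↔ σ y ∈ L₂) (h₂ : ∀ y, x⁻¹ * y * x ∈ L₂ ↔ σ y ∈ L₁) :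
    ∃ y ∈ Q, ∀ z, y⁻¹ * σ z * y ∈ L₁ ↔ y⁻¹ * z * y ∈ L₂ := by
  classical
  have h₁' : ∀ y, x⁻¹ * σ y * x ∈ L₁ ↔ y ∈ L₂ := fun y => by rw [h₁, hσ]
  have h₂' : ∀ y, x⁻¹ * σ y * x ∈ L₂ ↔ y ∈ L₁ := fun y => by rw [h₂, hσ]
  -- The hypotheses say x L₁ x⁻¹ = σ(L₂) and x L₂ x⁻¹ = σ(L₁). The map y ↦ σ(y) x on `Q` has the
  -- square y ↦ y σ(x) x, and σ(x) x normalises both subgroups; so it becomes an involution modulo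
  -- `N`.
  let N : Subgroup G := Subgroup.normalizer L₁ ⊓ Subgroup.normalizer L₂
  have hN : ∀ s, s ∈ N ↔ (∀ y, y ∈ L₁ ↔ s * y * s⁻¹ ∈ L₁) ∧ ∀ y, y ∈ L₂ ↔ s * y * s⁻¹ ∈ L₂ :=
    fun s => by rw [Subgroup.mem_inf, Subgroup.mem_normalizer_iff, Subgroup.mem_normalizer_iff]
  have hNσ : ∀ s ∈ N, x⁻¹ * σ s * x ∈ N := by
    intro s hs
    rw [hN] at hs ⊢
    have e : ∀ y, x⁻¹ * σ s * x * y * (x⁻¹ * σ s * x)⁻¹ =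
        x⁻¹ * σ (s * σ (x * y * x⁻¹) * s⁻¹) * x := fun y => by
      simp only [map_mul, map_inv, hσ]; group
    have e' : ∀ y, y = x⁻¹ * σ (σ (x * y * x⁻¹)) * x := fun y => by rw [hσ]; group
    refine ⟨fun y => ?_, fun y => ?_⟩
    · rw [e, h₁', ← hs.2, ← h₁', ← e']
    · rw [e, h₂', ← hs.1, ← h₂', ← e']
  have hxN : σ x * x ∈ N := by
    rw [hN]
    have e2 : ∀ y, σ x * x * y * (σ x * x)⁻¹ = σ (x * σ (x * y * x⁻¹) * x⁻¹) := fun y => by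
      simp only [map_mul, map_inv, hσ]; group
    refine ⟨fun y => ?_, fun y => ?_⟩
    · rw [e2, ← h₂, show x⁻¹ * (x * σ (x * y * x⁻¹) * x⁻¹) * x = σ (x * y * x⁻¹) by group, ← h₁]
      rw [show x⁻¹ * (x * y * x⁻¹) * x = y by group]
    · rw [e2, ← h₁, show x⁻¹ * (x * σ (x * y * x⁻¹) * x⁻¹) * x = σ (x * y * x⁻¹) by group, ← h₂]
      rw [show x⁻¹ * (x * y * x⁻¹) * x = y by group]
  let S : Subgroup Q := N.subgroupOf Q
  let j : Q → Q := fun y => ⟨σ y * x, Q.mul_mem (hQσ y y.2) hx⟩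
  let ι : Q ⧸ S → Q ⧸ S := Quotient.map' j (by
    intro y y' h
    rw [QuotientGroup.leftRel_apply, Subgroup.mem_subgroupOf] at h ⊢
    have := hNσ _ h
    simpa [j, mul_assoc] using this)
  have hι : ∀ y : Q, ι (QuotientGroup.mk y) = QuotientGroup.mk (j y) := fun y => rfl
  have hinv : Function.Involutive ι := by
    intro y
    induction y using QuotientGroup.induction_on with
    | H y =>
      rw [hι, hι, eq_comm, QuotientGroup.eq, Subgroup.mem_subgroupOf]
      simpa [j, hσ, mul_assoc] using hxN
  have hodd : ¬ 2 ∣ Nat.card (Q ⧸ S) := fun h =>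
    (Nat.not_even_iff_odd.mpr hQ) (even_iff_two_dvd.mpr (h.trans S.card_quotient_dvd_card))
  let _ : Fintype (Q ⧸ S) := Fintype.ofFinite _
  rw [Nat.card_eq_fintype_card] at hodd
  -- An involution of a set of odd size has a fixed point. Here y⁻¹ σ(y) x lies in `N`, hence σ(y L₁
  -- y⁻¹) = σ(y) x L₂ x⁻¹ σ(y)⁻¹ = y L₂ y⁻¹.
  obtain ⟨y, hy⟩ := Equiv.Perm.exists_fixed_point_of_prime (p := 2) (n := 1) hodd
    (σ := hinv.toPerm) (by
      ext1 y
      rw [pow_one, pow_two]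
      exact hinv y)
  induction y using QuotientGroup.induction_on with
  | H y =>
    have hy : ι (QuotientGroup.mk y) = QuotientGroup.mk y := hy
    rw [hι, eq_comm, QuotientGroup.eq, Subgroup.mem_subgroupOf] at hy
    set s : G := (y : G)⁻¹ * (σ y * x) with hs
    have hs' := (hN s).mp hy
    refine ⟨y, y.2, fun z => ?_⟩
    have e1 : (y : G)⁻¹ * σ z * y = σ ((σ y)⁻¹ * z * σ y) := by simp only [map_mul, map_inv, hσ]
    have e2 : x⁻¹ * ((σ y)⁻¹ * z * σ y) * x = s⁻¹ * ((y : G)⁻¹ * z * y) * s := by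
      rw [hs]; group
    rw [e1, ← h₂, e2, hs'.2, show s * (s⁻¹ * ((y : G)⁻¹ * z * y) * s) * s⁻¹ =
      (y : G)⁻¹ * z * y by group]

end TwistedFixedPoints

/-! ### Commuting splittings of two flags -/

section RelativePosition

variable {F : Type*} [Field F] {n : ℕ}

/-- The projection to a block. -/
def blockProj (F : Type*) [Field F] (f : Fin n → ℕ) (i : ℕ) : Matrix (Fin n) (Fin n) F :=
  Matrix.diagonal fun r => if f r = i then 1 else 0

theorem mul_blockProj_apply (f : Fin n → ℕ) (i : ℕ) (X : Matrix (Fin n) (Fin n) F) (r s : Fin n) :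
    (X * blockProj F f i) r s = if f s = i then X r s else 0 := by
  rw [blockProj, Matrix.mul_diagonal]
  split_ifs <;> simp

theorem blockProj_mul_apply (f : Fin n → ℕ) (i : ℕ) (X : Matrix (Fin n) (Fin n) F) (r s : Fin n) :
    (blockProj F f i * X) r s = if f r = i then X r s else 0 := by
  rw [blockProj, Matrix.diagonal_mul]
  split_ifs <;> simp

theorem mem_stdLevi_iff_commute (f : Fin n → ℕ) (x : GL (Fin n) F) :
    x ∈ stdLevi F f ↔ ∀ i, x.val * blockProj F f i = blockProj F f i * x.val := by
  constructor
  · intro h i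
    ext r s
    rw [mul_blockProj_apply, blockProj_mul_apply]
    by_cases hrs : f r = f s
    · rw [hrs]
    · rw [h r s hrs, ite_self, ite_self]
  · intro h r s hrs
    have h1 := congrFun (congrFun (h (f s)) r) s
    rwa [mul_blockProj_apply, blockProj_mul_apply, if_pos rfl, if_neg hrs] at h1

theorem sum_blockProj (f : Fin n → ℕ) {S : Finset ℕ} (hS : ∀ r, f r ∈ S) :
    ∑ i ∈ S, blockProj F f i = 1 := by
  ext r s
  rw [Matrix.sum_apply]
  by_cases h : r = s
  · subst h
    simp [blockProj, hS]
  · simp [blockProj, Matrix.diagonal_apply_ne _ h, Matrix.one_apply_ne h]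

theorem blockProj_mul_blockProj (f : Fin n → ℕ) (i j : ℕ) :
    blockProj F f i * blockProj F f j = if i = j then blockProj F f i else 0 := by
  ext r s
  rw [blockProj_mul_apply]
  by_cases hij : i = j
  · subst hij
    rw [if_pos rfl]
    by_cases hrs : r = s
    · subst hrs; simp [blockProj]
    · simp [blockProj, Matrix.diagonal_apply_ne _ hrs]
  · rw [if_neg hij]
    by_cases hrs : r = s
    · subst hrs
      simp only [blockProj, Matrix.diagonal_apply_eq, Matrix.zero_apply]
      split_ifs with h1 h2
      · exact absurd (h1.symm.trans h2) hij
      all_goals rfl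
    · simp [blockProj, Matrix.diagonal_apply_ne _ hrs]

/-- The conjugate by `a` of the projection to a block. -/
def conjProj (f : Fin n → ℕ) (a : GL (Fin n) F) (i : ℕ) : Matrix (Fin n) (Fin n) F :=
  a.val * blockProj F f i * a⁻¹.val

theorem conjProj_mul_conjProj (f : Fin n → ℕ) (a : GL (Fin n) F) (i j : ℕ) :
    conjProj f a i * conjProj f a j = if i = j then conjProj f a i else 0 := by
  have h : conjProj f a i * conjProj f a j =
      a.val * (blockProj F f i * (a⁻¹ * a).val * blockProj F f j) * a⁻¹.val := by
    simp only [conjProj, Units.val_mul, mul_assoc]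
  rw [h, inv_mul_cancel, Units.val_one, mul_one, blockProj_mul_blockProj]
  split_ifs
  · rfl
  · rw [mul_zero, zero_mul]

theorem sum_conjProj (f : Fin n → ℕ) (a : GL (Fin n) F) {S : Finset ℕ} (hS : ∀ r, f r ∈ S) :
    ∑ i ∈ S, conjProj f a i = 1 := by
  simp only [conjProj]
  rw [← Finset.sum_mul, ← Finset.mul_sum, sum_blockProj f hS, mul_one, ← Units.val_mul,
    mul_inv_cancel, Units.val_one]

/-- Since `a` preserves the flag, the conjugated projection has its image in step i and, by
`conjProj_col`, kills the earlier steps. -/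
theorem conjProj_row {f : Fin n → ℕ} {a : GL (Fin n) F} (ha : a ∈ stdParabolic F f) {i : ℕ}
    {r : Fin n} (h : i < f r) (s : Fin n) : conjProj f a i r s = 0 := by
  rw [conjProj, Matrix.mul_apply]
  refine Finset.sum_eq_zero fun t _ => ?_
  rw [mul_blockProj_apply]
  split_ifs with ht
  · rw [ha r t (ht ▸ h), zero_mul]
  · rw [zero_mul]

theorem conjProj_col {f : Fin n → ℕ} {a : GL (Fin n) F} (ha : a ∈ stdParabolic F f) {i : ℕ}
    {s : Fin n} (h : f s < i) (r : Fin n) : conjProj f a i r s = 0 := by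
  rw [conjProj, mul_assoc, Matrix.mul_apply]
  refine Finset.sum_eq_zero fun t _ => ?_
  rw [blockProj_mul_apply]
  split_ifs with ht
  · rw [(stdParabolic F f).inv_mem ha t s (ht ▸ h), mul_zero]
  · rw [mul_zero]

theorem mul_row_zero {A B : Matrix (Fin n) (Fin n) F} {r : Fin n} (h : ∀ s, A r s = 0)
    (s : Fin n) : (A * B) r s = 0 := by
  rw [Matrix.mul_apply]
  exact Finset.sum_eq_zero fun t _ => by rw [h t, zero_mul]

theorem mul_col_zero {A B : Matrix (Fin n) (Fin n) F} {s : Fin n} (h : ∀ r, B r s = 0)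
    (r : Fin n) : (A * B) r s = 0 := by
  rw [Matrix.mul_apply]
  exact Finset.sum_eq_zero fun t _ => by rw [h t, mul_zero]

/-- The product of the unipotent parts of the intersection of two standard parabolic subgroups. -/
theorem mem_sup_of_unipotent {α β : Fin n → ℕ} {x : GL (Fin n) F} (h₁ : x ∈ stdParabolic F α)
    (h₂ : x ∈ stdParabolic F β)
    (h₃ : ∀ r s, α r = α s → β r = β s → x.val r s = (1 : Matrix (Fin n) (Fin n) F) r s) :
    x ∈ (stdUnipotent F α ⊓ stdParabolic F β) ⊔ (stdParabolic F α ⊓ stdUnipotent F β) := by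
  have hz := leviPart_mem h₁
  have hzβ : leviPart h₁ ∈ stdUnipotent F β := by
    intro r s hrs
    rw [leviPart_apply]
    split_ifs with h
    · rcases hrs.lt_or_eq with h' | h'
      · rw [h₂ r s h', Matrix.one_apply_ne fun e => h'.ne (congrArg β e.symm)]
      · exact h₃ r s h h'.symm
    · exact (Matrix.one_apply_ne fun e => h (congrArg α e)).symm
  have e : x = leviPart h₁ * ((leviPart h₁)⁻¹ * x) := by group
  rw [e]
  refine mul_mem (Subgroup.mem_sup_right ⟨stdLevi_le_stdParabolic α hz, hzβ⟩)
    (Subgroup.mem_sup_left ⟨leviPart_inv_mul_mem h₁, ?_⟩)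
  exact (stdParabolic F β).mul_mem
    ((stdParabolic F β).inv_mem (stdUnipotent_le_stdParabolic β hzβ)) h₂

/-- Two pairs of commuting splittings of the same two flags are conjugate under the unipotent part
of the intersection of the two parabolic subgroups. -/
theorem exists_conj_of_commuting {α β : Fin n → ℕ} {a c : GL (Fin n) F}
    (ha : a ∈ stdParabolic F α) (hc : c ∈ stdParabolic F β)
    (hac : ∀ i j, conjProj α a i * conjProj β c j = conjProj β c j * conjProj α a i) :
    ∃ x ∈ (stdUnipotent F α ⊓ stdParabolic F β) ⊔ (stdParabolic F α ⊓ stdUnipotent F β),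
      a⁻¹ * x ∈ stdLevi F α ∧ c⁻¹ * x ∈ stdLevi F β := by
  let ε : ℕ → ℕ → Matrix (Fin n) (Fin n) F := fun i j => conjProj α a i * conjProj β c j
  -- X is the sum of the products `ε i j` e_i f_j, where e_i and f_j are the standard block
  -- projections: every joint block is mapped by the corresponding joint projection of the
  -- conjugated splittings. Hence X intertwines the standard splittings with the conjugated ones,
  -- and by `h1`, `h2`, `h3` it is unipotent for the labels α + β.
  let X : Matrix (Fin n) (Fin n) F := Matrix.of fun r s => ε (α s) (β s) r s
  have h1 : ∀ r s, α s < α r → X r s = 0 := fun r s h =>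
    mul_row_zero (fun t => conjProj_row ha h t) s
  have h2 : ∀ r s, β s < β r → X r s = 0 := fun r s h => by
    change ε (α s) (β s) r s = 0
    simp only [ε]
    rw [hac]
    exact mul_row_zero (fun t => conjProj_row hc h t) s
  have h3 : ∀ r s, α r = α s → β r = β s → X r s = (1 : Matrix (Fin n) (Fin n) F) r s := by
    intro r s hα hβ
    have hone : (1 : Matrix (Fin n) (Fin n) F) =
        ∑ i ∈ Finset.univ.image α, ∑ j ∈ Finset.univ.image β, ε i j := by
      simp only [ε]
      rw [← Finset.sum_mul_sum, sum_conjProj α a (by simp), sum_conjProj β c (by simp), mul_one]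
    have hzero : ∀ i j, i ≠ α s ∨ j ≠ β s → ε i j r s = 0 := by
      intro i j hij
      have hcomm : ε i j = conjProj β c j * conjProj α a i := hac i j
      rcases hij with h | h
      · rcases lt_or_gt_of_ne h with h | h
        · exact mul_row_zero (fun t => conjProj_row ha (hα ▸ h) t) s
        · rw [hcomm]
          exact mul_col_zero (fun t => conjProj_col ha h t) r
      · rcases lt_or_gt_of_ne h with h | h
        · rw [hcomm]
          exact mul_row_zero (fun t => conjProj_row hc (hβ ▸ h) t) s
        · exact mul_col_zero (fun t => conjProj_col hc h t) r
    rw [hone, Matrix.sum_apply, Finset.sum_eq_single (α s), Matrix.sum_apply,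
      Finset.sum_eq_single (β s)]
    · rfl
    · exact fun j _ hj => hzero _ _ (Or.inr hj)
    · simp
    · intro i _ hi
      rw [Matrix.sum_apply]
      exact Finset.sum_eq_zero fun j _ => hzero _ _ (Or.inl hi)
    · simp
  have hnil : IsNilpotent (X - 1) := by
    refine isNilpotent_of_strictly_triangular (fun r => α r + β r) fun r s h => ?_
    rw [Matrix.sub_apply]
    by_cases hα : α s < α r
    · rw [h1 r s hα, Matrix.one_apply_ne fun e => hα.ne (congrArg α e.symm), sub_zero]
    by_cases hβ : β s < β r
    · rw [h2 r s hβ, Matrix.one_apply_ne fun e => hβ.ne (congrArg β e.symm), sub_zero]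
    rw [h3 r s (by omega) (by omega), sub_self]
  obtain ⟨x, hx⟩ : IsUnit X := by
    have := hnil.isUnit_one_add
    rwa [add_sub_cancel] at this
  have hxe : ∀ i, X * blockProj F α i = conjProj α a i * X := by
    intro i
    ext r s
    rw [mul_blockProj_apply, Matrix.mul_apply]
    change _ = ∑ t, conjProj α a i r t * ε (α s) (β s) t s
    rw [← Matrix.mul_apply]
    simp only [ε]
    rw [← mul_assoc, conjProj_mul_conjProj]
    by_cases h : α s = i
    · rw [if_pos h, if_pos h.symm, ← h]
      rfl
    · rw [if_neg h, if_neg (Ne.symm h), zero_mul, Matrix.zero_apply]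
  have hxf : ∀ j, X * blockProj F β j = conjProj β c j * X := by
    intro j
    ext r s
    rw [mul_blockProj_apply, Matrix.mul_apply]
    change _ = ∑ t, conjProj β c j r t * ε (α s) (β s) t s
    rw [← Matrix.mul_apply]
    simp only [ε]
    rw [hac, ← mul_assoc, conjProj_mul_conjProj]
    by_cases h : β s = j
    · rw [if_pos h, if_pos h.symm, ← h, ← hac]
      rfl
    · rw [if_neg h, if_neg (Ne.symm h), zero_mul, Matrix.zero_apply]
  refine ⟨x, mem_sup_of_unipotent (fun r s h => ?_) (fun r s h => ?_) (fun r s hα hβ => ?_),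
    ?_, ?_⟩
  · rw [hx]; exact h1 r s h
  · rw [hx]; exact h2 r s h
  · rw [hx]; exact h3 r s hα hβ
  · rw [mem_stdLevi_iff_commute]
    intro i
    rw [Units.val_mul, hx, mul_assoc, hxe, conjProj]
    simp only [← mul_assoc]
    rw [← Units.val_mul, inv_mul_cancel, Units.val_one, one_mul]
  · rw [mem_stdLevi_iff_commute]
    intro i
    rw [Units.val_mul, hx, mul_assoc, hxf, conjProj]
    simp only [← mul_assoc]
    rw [← Units.val_mul, inv_mul_cancel, Units.val_one, one_mul]

end RelativePosition

/-! ### Sign matrices as a substitute for tori and idempotents -/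

section SignMatrices

variable {F : Type*} [Field F] {n : ℕ}

/-- The diagonal matrix with entries `-1` on one block and `1` elsewhere. -/
def signGL (F : Type*) [Field F] (f : Fin n → ℕ) (i : ℕ) : GL (Fin n) F where
  val := Matrix.diagonal fun r => if f r = i then -1 else 1
  inv := Matrix.diagonal fun r => if f r = i then -1 else 1
  val_inv := by
    rw [Matrix.diagonal_mul_diagonal, ← Matrix.diagonal_one]
    congr 1
    ext1 r
    split_ifs <;> simp
  inv_val := by
    rw [Matrix.diagonal_mul_diagonal, ← Matrix.diagonal_one]
    congr 1
    ext1 r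
    split_ifs <;> simp

theorem signGL_eq (f : Fin n → ℕ) (i : ℕ) :
    (signGL F f i).val = 1 - (2 : F) • blockProj F f i := by
  ext r s
  rw [Matrix.sub_apply, Matrix.smul_apply, blockProj]
  change Matrix.diagonal _ r s = _
  by_cases h : r = s
  · subst h
    rw [Matrix.diagonal_apply_eq, Matrix.diagonal_apply_eq, Matrix.one_apply_eq]
    split_ifs
    · norm_num
    · simp
  · rw [Matrix.diagonal_apply_ne _ h, Matrix.diagonal_apply_ne _ h, Matrix.one_apply_ne h,
      smul_zero, sub_zero]

theorem signGL_commute {f : Fin n → ℕ} {x : GL (Fin n) F} (hx : x ∈ stdLevi F f) (i : ℕ) :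
    signGL F f i * x = x * signGL F f i := by
  refine Units.ext ?_
  rw [Units.val_mul, Units.val_mul, signGL_eq, sub_mul, mul_sub, one_mul, mul_one, smul_mul_assoc,
    mul_smul_comm, (mem_stdLevi_iff_commute f x).mp hx i]

theorem signGL_val_mem_stdLevi (f : Fin n → ℕ) (r : ℕ) :
    signGL F (Fin.val : Fin n → ℕ) r ∈ stdLevi F f := fun _ _ h =>
  Matrix.diagonal_apply_ne _ fun e => h (congrArg f e)

/-- Commutation with the sign at r gives 2 x_rs = 0 for s ≠ r. Signs therefore replace the full
diagonal torus, however small the field. -/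
theorem isDiag_of_commute_signGL (h2 : (2 : F) ≠ 0) {x : GL (Fin n) F}
    (hx : ∀ r : ℕ, signGL F (Fin.val : Fin n → ℕ) r * x = x * signGL F Fin.val r) :
    x.val.IsDiag := by
  intro r s hrs
  have h := Matrix.ext_iff.mpr (congrArg Units.val (hx r)) r s
  rw [Units.val_mul, Units.val_mul] at h
  change (Matrix.diagonal (fun t : Fin n => if (t : ℕ) = r then (-1 : F) else 1) * x.val) r s =
    (x.val * Matrix.diagonal (fun t : Fin n => if (t : ℕ) = r then (-1 : F) else 1)) r s at h
  rw [Matrix.mul_diagonal, Matrix.diagonal_mul, if_pos rfl,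
    if_neg fun e => hrs (Fin.ext e.symm), mul_one, neg_one_mul] at h
  have h3 : (2 : F) * x.val r s = 0 := by linear_combination -h
  exact (mul_eq_zero.mp h3).resolve_left h2

theorem commute_of_isDiag {x y : GL (Fin n) F} (hx : x.val.IsDiag) (hy : y.val.IsDiag) :
    x * y = y * x := by
  refine Units.ext ?_
  rw [Units.val_mul, Units.val_mul, ← hx.diagonal_diag, ← hy.diagonal_diag,
    Matrix.diagonal_mul_diagonal, Matrix.diagonal_mul_diagonal]
  congr 1
  ext1 i
  exact mul_comm _ _

theorem conj_signGL_eq (f : Fin n → ℕ) (a : GL (Fin n) F) (i : ℕ) :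
    (a * signGL F f i * a⁻¹).val = 1 - (2 : F) • conjProj f a i := by
  rw [Units.val_mul, Units.val_mul, signGL_eq, mul_sub, sub_mul, mul_one, ← Units.val_mul,
    mul_inv_cancel, Units.val_one, mul_smul_comm, smul_mul_assoc, conjProj]

/-- An involution of the group acts on invertible matrices only, so commutation is obtained for 1 -
2e and passed on to the idempotents e by cancelling 4. -/
theorem conjProj_commute (h2 : (2 : F) ≠ 0) {f f' : Fin n → ℕ} {a c : GL (Fin n) F} {i j : ℕ}
    (h : a * signGL F f i * a⁻¹ * (c * signGL F f' j * c⁻¹) =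
      c * signGL F f' j * c⁻¹ * (a * signGL F f i * a⁻¹)) :
    conjProj f a i * conjProj f' c j = conjProj f' c j * conjProj f a i := by
  have h1 := congrArg Units.val h
  rw [Units.val_mul, Units.val_mul _ (a * signGL F f i * a⁻¹), conj_signGL_eq, conj_signGL_eq] at h1
  simp only [sub_mul, mul_sub, one_mul, mul_one, smul_mul_assoc, mul_smul_comm, smul_sub,
    smul_smul] at h1
  have h3 : ((2 : F) * 2) • (conjProj f a i * conjProj f' c j) =
      ((2 : F) * 2) • (conjProj f' c j * conjProj f a i) := by
    have e : ∀ A B C D : Matrix (Fin n) (Fin n) F, 1 - A - (B - C) = 1 - B - (A - D) → C = D := by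
      intro A B C D h
      have : C - D = (1 - A - (B - C)) - (1 - B - (A - D)) := by abel
      rw [h, sub_self] at this
      exact sub_eq_zero.mp this
    exact e _ _ _ _ h1
  exact smul_right_injective _ (mul_ne_zero h2 h2) h3

end SignMatrices

/-! ### A Levi subgroup and its image in a common basis -/

namespace ParabolicPair

variable {F : Type*} [Field F] {n : ℕ}

/-- `E` is the image of `D` under the involution `σ`. -/
structure IsImage (σ : GL (Fin n) F →* GL (Fin n) F) (D E : ParabolicPair n F) : Prop where
  parabolic : ∀ x, x ∈ E.parabolic ↔ σ x ∈ D.parabolic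
  levi : ∀ x, x ∈ E.levi ↔ σ x ∈ D.levi
  unipotentRadical : ∀ x, x ∈ E.unipotentRadical ↔ σ x ∈ D.unipotentRadical

theorem map_conj_sup {G : Type*} [Group G] (A B C D : Subgroup G) (g : G) :
    (A ⊓ B ⊔ C ⊓ D).map (MulAut.conj g).toMonoidHom =
      (A.map (MulAut.conj g).toMonoidHom ⊓ B.map (MulAut.conj g).toMonoidHom) ⊔
      (C.map (MulAut.conj g).toMonoidHom ⊓ D.map (MulAut.conj g).toMonoidHom) := by
  rw [Subgroup.map_sup, Subgroup.map_inf _ _ _ (MulAut.conj g).injective,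
    Subgroup.map_inf _ _ _ (MulAut.conj g).injective]

/-- The version of `exists_conj_of_commuting` for pairs which are standard in a common basis. -/
theorem exists_conj_of_interchanged (h2 : (2 : F) ≠ 0) {σ : GL (Fin n) F →* GL (Fin n) F}
    (hσ : ∀ x, σ (σ x) = x) {g a c : GL (Fin n) F} {α β : Fin n → ℕ}
    (ha : a ∈ (⟨g, α⟩ : ParabolicPair n F).parabolic)
    (hc : c ∈ (⟨g, β⟩ : ParabolicPair n F).parabolic)
    (hα : ∀ y, a⁻¹ * y * a ∈ (⟨g, α⟩ : ParabolicPair n F).levi ↔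
      σ y ∈ (⟨g, β⟩ : ParabolicPair n F).levi)
    (hβ : ∀ y, c⁻¹ * y * c ∈ (⟨g, β⟩ : ParabolicPair n F).levi ↔
      σ y ∈ (⟨g, α⟩ : ParabolicPair n F).levi) :
    ∃ x ∈ ((⟨g, α⟩ : ParabolicPair n F).unipotentRadical ⊓
        (⟨g, β⟩ : ParabolicPair n F).parabolic) ⊔
        ((⟨g, α⟩ : ParabolicPair n F).parabolic ⊓
        (⟨g, β⟩ : ParabolicPair n F).unipotentRadical),
      (∀ y, x⁻¹ * y * x ∈ (⟨g, α⟩ : ParabolicPair n F).levi ↔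
        σ y ∈ (⟨g, β⟩ : ParabolicPair n F).levi) ∧
      (∀ y, x⁻¹ * y * x ∈ (⟨g, β⟩ : ParabolicPair n F).levi ↔
        σ y ∈ (⟨g, α⟩ : ParabolicPair n F).levi) := by
  set D₁ : ParabolicPair n F := ⟨g, α⟩ with hD₁
  set D₂ : ParabolicPair n F := ⟨g, β⟩ with hD₂
  have ha' := (D₁.mem_parabolic a).mp ha
  have hc' := (D₂.mem_parabolic c).mp hc
  have hT : ∀ (f : Fin n → ℕ) (r : ℕ),
      g * signGL F Fin.val r * g⁻¹ ∈ (⟨g, f⟩ : ParabolicPair n F).levi := fun f r => by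
    rw [mem_levi]
    simpa [mul_assoc] using signGL_val_mem_stdLevi f r
  -- the image under the involution of a central element is diagonal in the basis
  have key : ∀ (f f' : Fin n → ℕ) (d : GL (Fin n) F) (i : ℕ),
      (∀ y, d⁻¹ * y * d ∈ (⟨g, f⟩ : ParabolicPair n F).levi ↔
        σ y ∈ (⟨g, f'⟩ : ParabolicPair n F).levi) →
      (g⁻¹ * σ (d * (g * signGL F f i * g⁻¹) * d⁻¹) * g).val.IsDiag := by
    intro f f' d i hd
    refine isDiag_of_commute_signGL h2 fun r => ?_
    -- The diagonal signs lie in the Levi subgroup of `f'`, so their images lie in the conjugate by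
    -- `d` of the Levi subgroup of `f` and commute with the conjugated central sign. Applying σ once
    -- more gives commutation with the diagonal signs themselves.
    have h1 := (hd (σ (g * signGL F Fin.val r * g⁻¹))).mpr (by rw [hσ]; exact hT f' r)
    rw [mem_levi] at h1
    have h3 := signGL_commute h1 i
    simp only at h3
    have h4 : g * signGL F f i * g⁻¹ * (d⁻¹ * σ (g * signGL F Fin.val r * g⁻¹) * d) =
        d⁻¹ * σ (g * signGL F Fin.val r * g⁻¹) * d * (g * signGL F f i * g⁻¹) := by
      calc _ = g * (signGL F f i * (g⁻¹ * (d⁻¹ * σ (g * signGL F Fin.val r * g⁻¹) * d) * g)) *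
            g⁻¹ := by group
        _ = _ := by rw [h3]; group
    have h5 : d * (g * signGL F f i * g⁻¹) * d⁻¹ * σ (g * signGL F Fin.val r * g⁻¹) =
        σ (g * signGL F Fin.val r * g⁻¹) * (d * (g * signGL F f i * g⁻¹) * d⁻¹) := by
      calc _ = d * (g * signGL F f i * g⁻¹ *
            (d⁻¹ * σ (g * signGL F Fin.val r * g⁻¹) * d)) * d⁻¹ := by group
        _ = _ := by rw [h4]; group
    have h6 := congrArg σ h5
    rw [map_mul, map_mul σ (σ _), hσ] at h6
    generalize σ (d * (g * signGL F f i * g⁻¹) * d⁻¹) = z at h6 ⊢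
    calc _ = g⁻¹ * (g * signGL F Fin.val r * g⁻¹ * z) * g := by group
      _ = _ := by rw [← h6]; group
  have hcomm : ∀ i j, conjProj α (g⁻¹ * a * g) i * conjProj β (g⁻¹ * c * g) j =
      conjProj β (g⁻¹ * c * g) j * conjProj α (g⁻¹ * a * g) i := by
    intro i j
    -- The images under σ of the two conjugated signs are diagonal and so commute; σ is injective,
    -- so the conjugated signs commute as well.
    refine conjProj_commute h2 ?_
    have h := commute_of_isDiag (key α β a i hα) (key β α c j hβ)
    have h' : σ (a * (g * signGL F α i * g⁻¹) * a⁻¹ * (c * (g * signGL F β j * g⁻¹) * c⁻¹)) =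
        σ (c * (g * signGL F β j * g⁻¹) * c⁻¹ * (a * (g * signGL F α i * g⁻¹) * a⁻¹)) := by
      rw [map_mul, map_mul σ (c * _ * _)]
      generalize σ (c * (g * signGL F β j * g⁻¹) * c⁻¹) = z at h ⊢
      generalize σ (a * (g * signGL F α i * g⁻¹) * a⁻¹) = z' at h ⊢
      calc z' * z = g * (g⁻¹ * z' * g * (g⁻¹ * z * g)) * g⁻¹ := by group
        _ = _ := by rw [h]; group
    have h'' := congrArg (fun y => g⁻¹ * y * g) (congrArg σ h')
    simp only [hσ] at h''
    calc _ = g⁻¹ * (a * (g * signGL F α i * g⁻¹) * a⁻¹ *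
          (c * (g * signGL F β j * g⁻¹) * c⁻¹)) * g := by group
      _ = _ := by rw [h'']; group
  obtain ⟨x, hx, hxα, hxβ⟩ := exists_conj_of_commuting ha' hc' hcomm
  have hl₁ : a⁻¹ * (g * x * g⁻¹) ∈ D₁.levi := by
    rw [mem_levi]
    convert hxα using 1
    simp only [hD₁]
    group
  have hl₂ : c⁻¹ * (g * x * g⁻¹) ∈ D₂.levi := by
    rw [mem_levi]
    convert hxβ using 1
    simp only [hD₂]
    group
  refine ⟨g * x * g⁻¹, ?_, fun y => ?_, fun y => ?_⟩
  · have := Subgroup.mem_map_of_mem (MulAut.conj g).toMonoidHom hx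
    rw [map_conj_sup] at this
    exact this
  · rw [← hα, show a⁻¹ * y * a = (a⁻¹ * (g * x * g⁻¹)) * ((g * x * g⁻¹)⁻¹ * y * (g * x * g⁻¹)) *
      (a⁻¹ * (g * x * g⁻¹))⁻¹ by group, D₁.levi.mul_mem_cancel_right (inv_mem hl₁),
      D₁.levi.mul_mem_cancel_left hl₁]
  · rw [← hβ, show c⁻¹ * y * c = (c⁻¹ * (g * x * g⁻¹)) * ((g * x * g⁻¹)⁻¹ * y * (g * x * g⁻¹)) *
      (c⁻¹ * (g * x * g⁻¹))⁻¹ by group, D₂.levi.mul_mem_cancel_right (inv_mem hl₂),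
      D₂.levi.mul_mem_cancel_left hl₂]

/-- A parabolic subgroup contains a Levi subgroup which is standard in a common basis with its
image under an involution. -/
theorem exists_levi_common_basis [Finite F] (h2 : (2 : F) ≠ 0)
    {σ : GL (Fin n) F →* GL (Fin n) F} (hσ : ∀ x, σ (σ x) = x) {D E : ParabolicPair n F}
    (hE : IsImage σ D E) :
    ∃ q ∈ D.parabolic, ∃ (g : GL (Fin n) F) (α β : Fin n → ℕ),
      SameGroups ⟨g, α⟩ (D.move q) ∧ IsImage σ ⟨g, α⟩ ⟨g, β⟩ := by
  obtain ⟨ℓ, hℓ⟩ := CharP.exists F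
  have hℓp : Fact ℓ.Prime := ⟨CharP.char_is_prime F ℓ⟩
  have hℓ2 : ℓ ≠ 2 := by
    rintro rfl
    exact h2 (CharP.cast_eq_zero F 2)
  obtain ⟨p, hp, q, hq, g, α, β, hα, hβ⟩ := exists_common_basis D E
  set D₁ : ParabolicPair n F := ⟨g, α⟩ with hD₁
  set D₂ : ParabolicPair n F := ⟨g, β⟩ with hD₂
  have P₁ : D₁.parabolic = D.parabolic := hα.parabolic.trans (move_parabolic_of_mem hp)
  have P₂ : D₂.parabolic = E.parabolic := hβ.parabolic.trans (move_parabolic_of_mem hq)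
  have U₁ : D₁.unipotentRadical = D.unipotentRadical :=
    hα.unipotentRadical.trans (move_unipotentRadical_of_mem hp)
  have U₂ : D₂.unipotentRadical = E.unipotentRadical :=
    hβ.unipotentRadical.trans (move_unipotentRadical_of_mem hq)
  have L₁ : ∀ y, y ∈ D₁.levi ↔ p⁻¹ * y * p ∈ D.levi := fun y => by
    rw [hα.levi, move_levi, mem_map_conj_iff]
  have L₂ : ∀ y, y ∈ D₂.levi ↔ q⁻¹ * y * q ∈ E.levi := fun y => by
    rw [hβ.levi, move_levi, mem_map_conj_iff]
  have hP : ∀ x, x ∈ D₂.parabolic ↔ σ x ∈ D₁.parabolic := by rw [P₁, P₂]; exact hE.parabolic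
  have hU : ∀ x, x ∈ D₂.unipotentRadical ↔ σ x ∈ D₁.unipotentRadical := by
    rw [U₁, U₂]; exact hE.unipotentRadical
  have hP' : ∀ x, x ∈ D₁.parabolic ↔ σ x ∈ D₂.parabolic := fun x => by rw [hP, hσ]
  have hU' : ∀ x, x ∈ D₁.unipotentRadical ↔ σ x ∈ D₂.unipotentRadical := fun x => by rw [hU, hσ]
  have hpD : p ∈ D₁.parabolic := P₁ ▸ hp
  have hqE : q ∈ D₂.parabolic := P₂ ▸ hq
  -- Here L₁ = p L p⁻¹ and L₂ = q σ(L) q⁻¹, so σ(L₂) is the conjugate of L₁ by σ(q) p⁻¹, and σ(L₁)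
  -- that of L₂ by σ(p) q⁻¹.
  obtain ⟨x, hx, hx₁, hx₂⟩ := exists_conj_of_interchanged h2 hσ (g := g) (α := α) (β := β)
    (a := σ q * p⁻¹) (c := σ p * q⁻¹)
    (D₁.parabolic.mul_mem ((hP q).mp hqE) (D₁.parabolic.inv_mem hpD))
    (D₂.parabolic.mul_mem ((hP' p).mp hpD) (D₂.parabolic.inv_mem hqE))
    (fun y => by
      rw [L₁, L₂, hE.levi]
      simp only [map_mul, map_inv, hσ, mul_inv_rev, inv_inv]
      refine iff_of_eq (congrArg (· ∈ D.levi) ?_)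
      group)
    (fun y => by
      rw [L₁, L₂, hE.levi]
      simp only [map_mul, map_inv, hσ, mul_inv_rev, inv_inv]
      refine iff_of_eq (congrArg (· ∈ D.levi) ?_)
      group)
  -- The unipotent part of the intersection P₁ ∩ P₂. Its two factors are interchanged by σ, and it
  -- is an ℓ-group because the first factor normalises the second.
  set Q : Subgroup (GL (Fin n) F) :=
    (D₁.unipotentRadical ⊓ D₂.parabolic) ⊔ (D₁.parabolic ⊓ D₂.unipotentRadical) with hQ
  have hQσ : ∀ y ∈ Q, σ y ∈ Q := by
    have : Q ≤ Q.comap σ := by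
      refine sup_le ?_ ?_
      · rintro y ⟨h, h'⟩
        exact Subgroup.mem_sup_right ⟨(hP y).mp h', (hU' y).mp h⟩
      · rintro y ⟨h, h'⟩
        exact Subgroup.mem_sup_left ⟨(hU y).mp h', (hP' y).mp h⟩
    exact this
  have hQp : IsPGroup ℓ Q := by
    refine IsPGroup.to_sup_of_normal_right' ((isPGroup_unipotentRadical ℓ D₁).to_le inf_le_left)
      ((isPGroup_unipotentRadical ℓ D₂).to_le inf_le_right) ?_
    rintro y ⟨hy, hy'⟩
    have hy₁ := D₁.unipotentRadical_le_parabolic hy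
    rw [Subgroup.mem_normalizer_iff]
    intro z
    constructor
    · rintro ⟨h, h'⟩
      exact ⟨D₁.parabolic.mul_mem (D₁.parabolic.mul_mem hy₁ h) (D₁.parabolic.inv_mem hy₁), D₂.conj_mem_unipotentRadical hy' h'⟩
    · rintro ⟨h, h'⟩
      have e : z = y⁻¹ * (y * z * y⁻¹) * y⁻¹⁻¹ := by group
      rw [e]
      have hyi := D₁.parabolic.inv_mem hy₁
      exact ⟨D₁.parabolic.mul_mem (D₁.parabolic.mul_mem hyi h) (D₁.parabolic.inv_mem hyi),
        D₂.conj_mem_unipotentRadical (D₂.parabolic.inv_mem hy') h'⟩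
  have hQodd : Odd (Nat.card Q) := by
    obtain ⟨m, hm⟩ := IsPGroup.iff_card.mp hQp
    rw [hm]
    exact (hℓp.out.odd_of_ne_two hℓ2).pow
  have hQ₁ : Q ≤ D₁.parabolic :=
    sup_le (inf_le_left.trans D₁.unipotentRadical_le_parabolic) inf_le_left
  have hQ₂ : Q ≤ D₂.parabolic :=
    sup_le inf_le_right (inf_le_right.trans D₂.unipotentRadical_le_parabolic)
  obtain ⟨y, hyQ, hy⟩ := exists_conj_interchanged hσ hQσ hQodd hx hx₁ hx₂
  have hy₁ := hQ₁ hyQ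
  have hy₂ := hQ₂ hyQ
  have hyp : y * p ∈ D.parabolic := D.parabolic.mul_mem (P₁ ▸ hy₁) hp
  have M₁ : (⟨y * g, α⟩ : ParabolicPair n F) = D₁.move y := rfl
  have M₂ : (⟨y * g, β⟩ : ParabolicPair n F) = D₂.move y := rfl
  refine ⟨y * p, hyp, y * g, α, β, ?_, ?_⟩
  · rw [M₁]
    refine ⟨?_, ?_, ?_⟩
    · rw [move_parabolic_of_mem hyp, move_parabolic_of_mem hy₁, P₁]
    · rw [move_levi, move_levi, map_conj_mul, ← move_levi p, ← hα.levi]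
    · rw [move_unipotentRadical_of_mem hyp, move_unipotentRadical_of_mem hy₁, U₁]
  · rw [M₁, M₂]
    refine ⟨fun z => ?_, fun z => ?_, fun z => ?_⟩
    · rw [move_parabolic_of_mem hy₁, move_parabolic_of_mem hy₂, hP]
    · rw [move_levi, move_levi, mem_map_conj_iff, mem_map_conj_iff, hy]
    · rw [move_unipotentRadical_of_mem hy₁, move_unipotentRadical_of_mem hy₂, hU]

end ParabolicPair

/-! ### Similarity of a matrix to its transpose -/

section SimilarToTranspose

open Polynomial

variable {F : Type*} [Field F]

/-- A nondegenerate form on a cyclic torsion module for which the variable is self-adjoint. -/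
theorem exists_form_cyclic {p : F[X]} (hp : Irreducible p) (e : ℕ) :
    ∃ B : (F[X] ⧸ Ideal.span {p ^ e}) →ₗ[F] (F[X] ⧸ Ideal.span {p ^ e}) →ₗ[F] F,
      (∀ x y, B ((X : F[X]) • x) y = B x ((X : F[X]) • y)) ∧ ∀ x, (∀ y, B x y = 0) → x = 0 := by
  classical
  let mk := Ideal.Quotient.mk (Ideal.span {p ^ e})
  have hmk : ∀ a, mk a = 0 ↔ p ^ e ∣ a := fun a => by
    rw [Ideal.Quotient.eq_zero_iff_mem, Ideal.mem_span_singleton]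
  -- Every nonzero ideal of the quotient contains p^(e-1), so φ(xy) is nondegenerate once φ does not
  -- vanish there. For e = 0 the quotient is zero and any φ will do.
  obtain ⟨φ, hφ⟩ : ∃ φ : Module.Dual F (F[X] ⧸ Ideal.span {p ^ e}),
      0 < e → φ (mk (p ^ (e - 1))) ≠ 0 := by
    by_cases he : 0 < e
    · have hne : mk (p ^ (e - 1)) ≠ 0 := by
        rw [Ne, hmk, pow_dvd_pow_iff hp.ne_zero hp.not_isUnit]
        omega
      by_contra! hcon
      exact hne ((Module.forall_dual_apply_eq_zero_iff F _).mp fun φ => (hcon φ).2)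
    · exact ⟨0, fun h => absurd h he⟩
  refine ⟨(LinearMap.mul F (F[X] ⧸ Ideal.span {p ^ e})).compr₂ φ, fun x y => ?_, fun x hx => ?_⟩
  · simp only [LinearMap.compr₂_apply, LinearMap.mul_apply']
    rw [smul_mul_assoc, mul_smul_comm]
  · obtain ⟨a, rfl⟩ := Ideal.Quotient.mk_surjective x
    by_contra hne
    have hnd : ¬ p ^ e ∣ a := fun h => hne ((hmk a).mpr h)
    obtain ⟨i, hi, hassoc⟩ := (dvd_prime_pow hp.prime e).mp (EuclideanDomain.gcd_dvd_right a (p ^ e))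
    have hie : i ≠ e := by
      rintro rfl
      exact hnd (hassoc.symm.dvd.trans (EuclideanDomain.gcd_dvd_left a _))
    obtain ⟨c, hc⟩ := hassoc.dvd
    have hb := EuclideanDomain.gcd_eq_gcd_ab a (p ^ e)
    have hcalc : mk a * mk (EuclideanDomain.gcdA a (p ^ e) * c * p ^ (e - 1 - i)) =
        mk (p ^ (e - 1)) := by
      rw [← map_mul, ← sub_eq_zero, ← map_sub, hmk]
      refine ⟨-(EuclideanDomain.gcdB a (p ^ e) * c * p ^ (e - 1 - i)), ?_⟩
      have h1 : p ^ (e - 1) = p ^ i * p ^ (e - 1 - i) := by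
        rw [← pow_add]; congr 1; omega
      rw [h1, hc, hb]
      ring
    refine hφ (by omega) ?_
    rw [← hcalc]
    exact hx _

/-- Every matrix over a field is similar to its transpose. -/
theorem Matrix.exists_mul_transpose_eq {ι : Type*} [Fintype ι] [DecidableEq ι]
    (A : Matrix ι ι F) : ∃ s : GL ι F, s.val * A.transpose = A * s.val := by
  classical
  let f := Matrix.toLin' A
  obtain ⟨κ, hκ, p, hp, e, ⟨E⟩⟩ := Module.equiv_directSum_of_isTorsion
    (Module.AEval.isTorsion_of_finiteDimensional F (ι → F) f)
  let E' := (E.trans (DirectSum.linearEquivFunOnFintype F[X] κ _))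
  choose B hB hB' using fun i => exists_form_cyclic (hp i) (e i)
  let T : (ι → F) →ₗ[F] (∀ i : κ, F[X] ⧸ Ideal.span {p i ^ e i}) :=
    (E'.toLinearMap.restrictScalars F).comp (Module.AEval'.of f).toLinearMap
  have hTf : ∀ x, T (f x) = (X : F[X]) • T x := by
    intro x
    change E' (Module.AEval'.of f (f x)) = X • E' (Module.AEval'.of f x)
    rw [← Module.AEval'.X_smul_of, map_smul]
  have hTbij : Function.Bijective T := E'.bijective.comp (Module.AEval'.of f).bijective
  -- The orthogonal sum of the forms on the cyclic summands. It is nondegenerate with A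
  -- self-adjoint, so its Gram matrix S satisfies Aᵀ S = S A, and S⁻¹ is the required conjugator.
  let β : (ι → F) →ₗ[F] (ι → F) →ₗ[F] F :=
    ∑ i, (B i).compl₁₂ ((LinearMap.proj i).comp T) ((LinearMap.proj i).comp T)
  have hβ : ∀ x y, β x y = ∑ i, B i (T x i) (T y i) := fun x y => by
    simp [β, LinearMap.sum_apply]
  have hadj : β.comp f = β.compl₂ f := by
    refine LinearMap.ext₂ fun x y => ?_
    rw [LinearMap.comp_apply, LinearMap.compl₂_apply, hβ, hβ, hTf, hTf]
    exact Finset.sum_congr rfl fun i _ => hB i _ _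
  have hsep : β.SeparatingLeft := by
    intro x hx
    apply hTbij.1
    rw [map_zero]
    ext1 i
    refine hB' i _ fun y => ?_
    obtain ⟨z, hz⟩ := hTbij.2 (Pi.single i y)
    have h1 := hx z
    rw [hβ, hz, Finset.sum_eq_single i] at h1
    · rwa [Pi.single_eq_same] at h1
    · intro j _ hj
      rw [Pi.single_eq_of_ne hj, map_zero]
    · simp
  have hdet : (LinearMap.toMatrix₂' F β).det ≠ 0 := by
    rw [← LinearMap.separatingLeft_toLinearMap₂'_iff_det_ne_zero, Matrix.toLinearMap₂'_toMatrix']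
    exact hsep
  have hS : A.transpose * LinearMap.toMatrix₂' F β = LinearMap.toMatrix₂' F β * A := by
    have h1 := congrArg (LinearMap.toMatrix₂' F) hadj
    rwa [LinearMap.toMatrix₂'_comp, LinearMap.toMatrix₂'_compl₂, LinearMap.toMatrix'_toLin'] at h1
  let S : GL ι F := Matrix.GeneralLinearGroup.mk'' _ (isUnit_iff_ne_zero.mpr hdet)
  refine ⟨S⁻¹, ?_⟩
  have h2 : A.transpose * S.val = S.val * A := hS
  calc S⁻¹.val * A.transpose = S⁻¹.val * (A.transpose * S.val) * S⁻¹.val := by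
        rw [mul_assoc, mul_assoc, ← Units.val_mul, mul_inv_cancel, Units.val_one, mul_one]
    _ = (S⁻¹.val * S.val) * A * S⁻¹.val := by rw [h2]; simp only [mul_assoc]
    _ = _ := by rw [← Units.val_mul, inv_mul_cancel, Units.val_one, one_mul]

variable {n : ℕ}

/-- Every element of a standard Levi subgroup is similar to its transpose in the Levi subgroup. -/
theorem exists_stdLevi_mul_transpose_eq {f : Fin n → ℕ} {x : GL (Fin n) F}
    (hx : x ∈ stdLevi F f) : ∃ s ∈ stdLevi F f, s.val * x.val.transpose = x.val * s.val := by
  classical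
  let o := Set.range f
  let g : Fin n → o := fun r => ⟨f r, r, rfl⟩
  let ψ : (Σ c : o, {r // g r = c}) ≃ Fin n := Equiv.sigmaFiberEquiv g
  have : Fintype o := Set.fintypeRange f
  choose s hs using fun c : o =>
    Matrix.exists_mul_transpose_eq (x.val.submatrix (Subtype.val : {r // g r = c} → Fin n)
      Subtype.val)
  let φ := Matrix.reindexAlgEquiv F F ψ
  let R : (∀ c : o, Matrix {r // g r = c} {r // g r = c} F) → Matrix (Fin n) (Fin n) F :=
    fun M => φ (Matrix.blockDiagonal' M)
  have hRmul : ∀ M N, R (fun c => M c * N c) = R M * R N := fun M N => by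
    simp only [R]
    rw [Matrix.blockDiagonal'_mul, map_mul]
  have hRone : R (fun _ => 1) = 1 := by
    simp only [R]
    rw [show (fun c : o => (1 : Matrix {r // g r = c} {r // g r = c} F)) = 1 from rfl,
      Matrix.blockDiagonal'_one, map_one]
  have hRapply : ∀ M r t, R M r t = Matrix.blockDiagonal' M ⟨g r, r, rfl⟩ ⟨g t, t, rfl⟩ :=
    fun M r t => rfl
  have hRdiag : ∀ M r t, f r ≠ f t → R M r t = 0 := fun M r t h => by
    rw [hRapply, Matrix.blockDiagonal'_apply_ne]
    exact fun e => h (congrArg Subtype.val e)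
  have hRx : R (fun c => x.val.submatrix Subtype.val Subtype.val) = x.val := by
    ext r t
    by_cases h : f r = f t
    · rw [hRapply, Matrix.blockDiagonal'_apply, dif_pos (Subtype.ext h)]
      simp only [Matrix.submatrix_apply]
      generalize_proofs h1 h2
      revert h1
      have : g r = g t := Subtype.ext h
      rw [this]
      intros; rfl
    · rw [hRdiag _ _ _ h, hx r t h]
  have hRxT : R (fun c => (x.val.submatrix Subtype.val Subtype.val).transpose) =
      x.val.transpose := by
    refine Eq.trans ?_ (congrArg Matrix.transpose hRx)
    simp only [R]
    rw [← Matrix.blockDiagonal'_transpose]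
    rfl
  let S : GL (Fin n) F := ⟨R fun c => (s c).val, R fun c => (s c)⁻¹.val, by
      rw [← hRmul, ← hRone]
      congr 1
      ext1 c
      rw [← Units.val_mul, mul_inv_cancel, Units.val_one], by
      rw [← hRmul, ← hRone]
      congr 1
      ext1 c
      rw [← Units.val_mul, inv_mul_cancel, Units.val_one]⟩
  refine ⟨S, fun r t h => hRdiag _ _ _ h, ?_⟩
  change (R fun c => (s c).val) * _ = _ * R fun c => (s c).val
  rw [← hRxT, ← hRmul]
  simp only [hs]
  rw [hRmul, hRx]

end SimilarToTranspose

/-! ### Sums of class functions over cosets of unipotent radicals -/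

section UnipotentSums

theorem sum_subgroup_equiv {G M : Type*} [Group G] [Fintype G] [AddCommMonoid M] (S T : Subgroup G)
    [Fintype S] [Fintype T] (e : G ≃ G) (h : ∀ x, x ∈ S ↔ e x ∈ T) (g : G → M) :
    ∑ x : S, g (e x) = ∑ y : T, g y :=
  Fintype.sum_equiv (e.subtypeEquiv h) _ _ fun _ => rfl

theorem sum_subgroup_eq_sum_sum {G M : Type*} [Group G] [AddCommMonoid M] {A N W : Subgroup G}
    [Fintype A] [Fintype N] [Fintype W] (hA : A ≤ W) (hN : N ≤ W) (hAN : ∀ x ∈ A, x ∈ N → x = 1)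
    (hW : ∀ u ∈ W, ∃ v ∈ A, v⁻¹ * u ∈ N) (g : G → M) :
    ∑ u : W, g u = ∑ v : A, ∑ y : N, g (v * y) := by
  rw [← Fintype.sum_prod_type']
  symm
  refine Fintype.sum_bijective (fun p : A × N => (⟨p.1 * p.2, W.mul_mem (hA p.1.2) (hN p.2.2)⟩ : W))
    ⟨?_, ?_⟩ _ _ fun _ => rfl
  · rintro ⟨v, y⟩ ⟨v', y'⟩ h
    have h1 : (v : G) * y = v' * y' := congrArg Subtype.val h
    have h2 : (v' : G)⁻¹ * v = y' * (y : G)⁻¹ := by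
      rw [inv_mul_eq_iff_eq_mul, ← mul_assoc, ← h1, mul_inv_cancel_right]
    have h3 := hAN _ (A.mul_mem (A.inv_mem v'.2) v.2) (h2 ▸ N.mul_mem y'.2 (N.inv_mem y.2))
    have h4 : v = v' := Subtype.ext (inv_mul_eq_one.mp h3).symm
    subst h4
    rw [mul_right_inj] at h1
    exact Prod.ext rfl (Subtype.ext h1)
  · rintro ⟨u, hu⟩
    obtain ⟨v, hv, hvu⟩ := hW u hu
    exact ⟨⟨⟨v, hv⟩, ⟨_, hvu⟩⟩, Subtype.ext (mul_inv_cancel_left v u)⟩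

variable {n : ℕ} {F : Type*} [Field F]

/-- The transpose of an invertible matrix. -/
def transposeGL (x : GL (Fin n) F) : GL (Fin n) F where
  val := x.val.transpose
  inv := x⁻¹.val.transpose
  val_inv := by
    rw [← Matrix.transpose_mul, ← Units.val_mul, inv_mul_cancel, Units.val_one,
      Matrix.transpose_one]
  inv_val := by
    rw [← Matrix.transpose_mul, ← Units.val_mul, mul_inv_cancel, Units.val_one,
      Matrix.transpose_one]

theorem transposeGL_mul (x y : GL (Fin n) F) :
    transposeGL (x * y) = transposeGL y * transposeGL x :=
  Units.ext (Matrix.transpose_mul _ _)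

/-- Transposition as a permutation. -/
def transposeEquiv (n : ℕ) (F : Type*) [Field F] : GL (Fin n) F ≃ GL (Fin n) F where
  toFun := transposeGL
  invFun := transposeGL
  left_inv x := Units.ext (Matrix.transpose_transpose x.val)
  right_inv x := Units.ext (Matrix.transpose_transpose x.val)

theorem stdLevi_mono {f g : Fin n → ℕ} (h : ∀ r s, f r = f s → g r = g s) :
    stdLevi F f ≤ stdLevi F g := fun _ hx r s hrs => hx r s fun e => hrs (h r s e)

theorem eq_one_of_mem_stdLevi_of_mem_stdUnipotent {f : Fin n → ℕ} {x : GL (Fin n) F}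
    (hx : x ∈ stdLevi F f) (hx' : x ∈ stdUnipotent F f) : x = 1 := by
  refine Units.ext (Matrix.ext fun r s => ?_)
  by_cases h : f r = f s
  · exact hx' r s h.ge
  · rw [hx r s h]
    exact (Matrix.one_apply_ne fun e => h (congrArg f e)).symm

theorem conj_mem_iff_of_normalizes {G : Type*} [Group G] {A N : Subgroup G}
    (h : ∀ k ∈ A, ∀ x ∈ N, k * x * k⁻¹ ∈ N) {k : G} (hk : k ∈ A) (x : G) :
    x ∈ N ↔ k * x * k⁻¹ ∈ N := by
  refine ⟨h k hk x, fun hx => ?_⟩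
  have := h k⁻¹ (inv_mem hk) _ hx
  simpa [mul_assoc] using this

/-- The sum of a class function over a coset of a unipotent radical is not changed when the order
of the blocks is reversed inside the blocks of a coarser partition. -/
theorem sum_unipotent_eq_of_reversed [Finite F] {α δ δ' m : Fin n → ℕ}
    (hm : ∀ r s, m r < m s → δ r < δ s ∧ δ' r < δ' s)
    (hδ : ∀ r s, m r = m s → (δ r ≤ δ s ↔ δ' s ≤ δ' r))
    (hα : ∀ r s, δ r = δ s → α r = α s) {χ : GL (Fin n) F → ℂ}
    (hχ : ∀ c ∈ stdLevi F α, ∀ x, χ (c * x * c⁻¹) = χ x) {l : GL (Fin n) F}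
    (hl : l ∈ stdLevi F δ) [Fintype ↥(stdUnipotent F δ ⊓ stdLevi F α)]
    [Fintype ↥(stdUnipotent F δ' ⊓ stdLevi F α)] :
    ∑ x : ↥(stdUnipotent F δ ⊓ stdLevi F α), χ (l * x) =
      ∑ x : ↥(stdUnipotent F δ' ⊓ stdLevi F α), χ (l * x) := by
  classical
  have : Fintype F := Fintype.ofFinite F
  have hmδ : ∀ r s, δ r = δ s → m r = m s := fun r s h => by
    by_contra hne
    rcases lt_or_gt_of_ne hne with h' | h'
    · exact (hm r s h').1.ne h
    · exact (hm s r h').1.ne' h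
  have hδδ' : ∀ r s, δ r = δ s → δ' r = δ' s := fun r s h =>
    le_antisymm ((hδ s r (hmδ s r h.symm)).mp h.ge) ((hδ r s (hmδ r s h)).mp h.le)
  have hLα : stdLevi F δ ≤ stdLevi F α := stdLevi_mono hα
  have hLm : stdLevi F δ ≤ stdLevi F m := stdLevi_mono hmδ
  have hLδ' : stdLevi F δ ≤ stdLevi F δ' := stdLevi_mono hδδ'
  set N := stdUnipotent F m ⊓ stdLevi F α with hN
  -- Fubini for the unipotent radical of the coarser parabolic subgroup
  have split : ∀ (ε : Fin n → ℕ) [Fintype ↥(stdUnipotent F ε ⊓ stdLevi F α)],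
      (∀ r s, m r < m s → ε r < ε s) →
      ∑ x : ↥(stdUnipotent F ε ⊓ stdLevi F α), χ (l * x) =
        ∑ v : ↥(stdUnipotent F ε ⊓ (stdLevi F m ⊓ stdLevi F α)), ∑ y : N, χ (l * v * y) := by
    intro ε _ hε
    have hle : ∀ r s, ε r ≤ ε s → m r ≤ m s := fun r s h => by
      by_contra hcon
      exact absurd (hε s r (not_le.mp hcon)) (not_lt.mpr h)
    rw [sum_subgroup_eq_sum_sum (A := stdUnipotent F ε ⊓ (stdLevi F m ⊓ stdLevi F α)) (N := N)
      (W := stdUnipotent F ε ⊓ stdLevi F α) ?_ ?_ ?_ ?_ (fun x => χ (l * x))]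
    · simp only [mul_assoc]
    · exact inf_le_inf_left _ inf_le_right
    · exact inf_le_inf_right _ fun x hx r s h => hx r s (hle s r h)
    · exact fun x hx hx' => eq_one_of_mem_stdLevi_of_mem_stdUnipotent hx.2.1 hx'.1
    · rintro u ⟨huε, huα⟩
      have hum : u ∈ stdParabolic F m := fun r s h => by
        have h' := hε s r h
        rw [huε r s h'.le, Matrix.one_apply_ne fun e => h'.ne (congrArg ε e.symm)]
      have hvα : leviPart hum ∈ stdLevi F α := fun r s h => by
        rw [leviPart_apply, huα r s h, ite_self]
      refine ⟨leviPart hum, ⟨fun r s h => ?_, leviPart_mem hum, hvα⟩, leviPart_inv_mul_mem hum,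
        (stdLevi F α).mul_mem ((stdLevi F α).inv_mem hvα) huα⟩
      rw [leviPart_apply]
      split_ifs with hrs
      · exact huε r s h
      · exact (Matrix.one_apply_ne fun e => hrs (congrArg m e)).symm
  rw [split δ fun r s h => (hm r s h).1, split δ' fun r s h => (hm r s h).2]
  -- With s lᵀ = l s and c = l⁻¹ s, the bijection v ↦ c vᵀ c⁻¹ reverses the order inside the blocks
  -- of `m` and satisfies l c vᵀ c⁻¹ = s (l v)ᵀ s⁻¹. The right side is conjugate to l v under the
  -- Levi subgroups of `m` and `α` intersected, and the inner sum over `N` is invariant under that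
  -- group.
  obtain ⟨s, hs, hsl⟩ := exists_stdLevi_mul_transpose_eq hl
  have hsl' : s * transposeGL l = l * s := Units.ext hsl
  set c := l⁻¹ * s with hc
  have hcδ : c ∈ stdLevi F δ := (stdLevi F δ).mul_mem ((stdLevi F δ).inv_mem hl) hs
  -- conjugation invariance of the inner sum
  have hinv : ∀ k ∈ stdLevi F m ⊓ stdLevi F α, ∀ Y : GL (Fin n) F,
      ∑ y : N, χ (k * Y * k⁻¹ * y) = ∑ y : N, χ (Y * y) := by
    intro k hk Y
    rw [← sum_subgroup_equiv N N (MulAut.conj k).toEquiv (fun x => ?_)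
      (fun y => χ (k * Y * k⁻¹ * y))]
    · refine Finset.sum_congr rfl fun y _ => ?_
      rw [← hχ k hk.2 (Y * y)]
      congr 1
      simp only [MulEquiv.toEquiv_eq_coe, MulEquiv.coe_toEquiv, MulAut.conj_apply]
      group
    · refine conj_mem_iff_of_normalizes (A := stdLevi F m ⊓ stdLevi F α) ?_ hk x
      rintro k ⟨hk, hk'⟩ x ⟨hx, hx'⟩
      exact ⟨stdUnipotent_conj m hk hx, (stdLevi F α).mul_mem ((stdLevi F α).mul_mem hk' hx')
        ((stdLevi F α).inv_mem hk')⟩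
  -- The intersection is itself a standard Levi subgroup, so l v is similar to its transpose inside
  -- it.
  have hpair : stdLevi F (fun r => Nat.pair (m r) (α r)) = stdLevi F m ⊓ stdLevi F α := by
    refine le_antisymm (le_inf (stdLevi_mono fun r s h => (Nat.pair_eq_pair.mp h).1)
      (stdLevi_mono fun r s h => (Nat.pair_eq_pair.mp h).2)) ?_
    rintro x ⟨hx, hx'⟩ r s h
    by_cases h1 : m r = m s
    · exact hx' r s fun h2 => h (Nat.pair_eq_pair.mpr ⟨h1, h2⟩)
    · exact hx r s h1
  rw [← sum_subgroup_equiv (stdUnipotent F δ ⊓ (stdLevi F m ⊓ stdLevi F α))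
    (stdUnipotent F δ' ⊓ (stdLevi F m ⊓ stdLevi F α))
    ((transposeEquiv n F).trans (MulAut.conj c).toEquiv) (fun x => ?_)
    (fun v => ∑ y : N, χ (l * v * y))]
  · refine Finset.sum_congr rfl fun v _ => ?_
    obtain ⟨v, hv⟩ := v
    have hY : l * v ∈ stdLevi F (fun r => Nat.pair (m r) (α r)) := by
      rw [hpair]
      exact (stdLevi F m ⊓ stdLevi F α).mul_mem ⟨hLm hl, hLα hl⟩ hv.2
    obtain ⟨h, hh, hhY⟩ := exists_stdLevi_mul_transpose_eq hY
    rw [hpair] at hh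
    have hhY' : h * transposeGL (l * v) = l * v * h := Units.ext hhY
    have hk : s * h⁻¹ ∈ stdLevi F m ⊓ stdLevi F α :=
      (stdLevi F m ⊓ stdLevi F α).mul_mem ⟨hLm hs, hLα hs⟩
        ((stdLevi F m ⊓ stdLevi F α).inv_mem hh)
    rw [← hinv _ hk (l * v)]
    refine Finset.sum_congr rfl fun y _ => congrArg (fun z => χ (z * y)) ?_
    have e1 : s * h⁻¹ * (l * v) * (s * h⁻¹)⁻¹ = s * (h⁻¹ * (l * v * h)) * s⁻¹ := by group
    have e2 : transposeGL l = s⁻¹ * (l * s) := by rw [← hsl']; group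
    rw [e1, ← hhY', transposeGL_mul, e2]
    simp only [transposeEquiv, Equiv.trans_apply, Equiv.coe_fn_mk, MulEquiv.toEquiv_eq_coe,
      MulEquiv.coe_toEquiv, MulAut.conj_apply, hc]
    group
  · have hcA : c ∈ stdLevi F δ' ⊓ (stdLevi F m ⊓ stdLevi F α) := ⟨hLδ' hcδ, hLm hcδ, hLα hcδ⟩
    have h1 := conj_mem_iff_of_normalizes (A := stdLevi F δ' ⊓ (stdLevi F m ⊓ stdLevi F α))
      (N := stdUnipotent F δ' ⊓ (stdLevi F m ⊓ stdLevi F α)) (by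
        rintro k ⟨hk, hk'⟩ x ⟨hx, hx'⟩
        exact ⟨stdUnipotent_conj δ' hk hx, Subgroup.mul_mem _ (Subgroup.mul_mem _ hk' hx')
          (Subgroup.inv_mem _ hk')⟩) hcA (transposeGL x)
    refine Iff.trans ?_ h1
    have hT : ∀ (f : Fin n → ℕ) (y : GL (Fin n) F), y ∈ stdLevi F f ↔ transposeGL y ∈ stdLevi F f :=
      fun f y => ⟨fun h r s hrs => h s r hrs.symm, fun h r s hrs => h s r hrs.symm⟩
    rw [Subgroup.mem_inf, Subgroup.mem_inf, Subgroup.mem_inf, Subgroup.mem_inf, ← hT, ← hT]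
    refine and_congr_left ?_
    rintro ⟨hxm, -⟩
    constructor
    · intro h r s hrs
      change x.val s r = _
      by_cases he : m r = m s
      · rw [h s r ((hδ r s he).mpr hrs), ← Matrix.transpose_apply 1 r s, Matrix.transpose_one]
      · rw [hxm s r (Ne.symm he), Matrix.one_apply_ne fun e => he (congrArg m e)]
    · intro h r s hrs
      by_cases he : m r = m s
      · rw [← Matrix.transpose_apply 1 s r, Matrix.transpose_one]
        exact h s r ((hδ s r he.symm).mp hrs)
      · rw [hxm r s he, Matrix.one_apply_ne fun e => he (congrArg m e)]

/-- The sum of a function over a coset of a unipotent radical. -/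
noncomputable def unipotentSum [Finite F] (α δ : Fin n → ℕ) (χ : GL (Fin n) F → ℂ)
    (l : GL (Fin n) F) : ℂ :=
  let _ := Fintype.ofFinite ↥(stdUnipotent F δ ⊓ stdLevi F α)
  ∑ x : ↥(stdUnipotent F δ ⊓ stdLevi F α), χ (l * x)

/-- The sum of a class function over a coset of a unipotent radical does not depend on the order of
the blocks. -/
theorem unipotentSum_perm [Finite F] {α : Fin n → ℕ} {N : ℕ} (p : Equiv.Perm (Fin (N + 1)))
    {χ : GL (Fin n) F → ℂ} (hχ : ∀ c ∈ stdLevi F α, ∀ x, χ (c * x * c⁻¹) = χ x)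
    (δ : Fin n → Fin (N + 1)) (hα : ∀ r s, δ r = δ s → α r = α s) {l : GL (Fin n) F}
    (hl : l ∈ stdLevi F fun r => (δ r : ℕ)) :
    unipotentSum α (fun r => (δ r : ℕ)) χ l = unipotentSum α (fun r => (p (δ r) : ℕ)) χ l := by
  have hp : p ∈ Submonoid.closure (Set.range fun i : Fin N => Equiv.swap i.castSucc i.succ) := by
    rw [Equiv.Perm.mclosure_swap_castSucc_succ]
    trivial
  induction hp using Submonoid.closure_induction generalizing δ with
  | one => rfl
  | mul p q hp hq ihp ihq =>
    refine (ihq δ hα hl).trans ?_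
    refine ihp (fun r => q (δ r)) (fun r s h => hα r s (q.injective h)) ?_
    exact stdLevi_mono (fun r s h => congrArg (fun z => (q z : ℕ)) (Fin.ext h)) hl
  | mem p hp =>
    obtain ⟨i, rfl⟩ := hp
    have hv : ∀ z : Fin (N + 1), (Equiv.swap i.castSucc i.succ z : ℕ) =
        if (z : ℕ) = (i : ℕ) then (i : ℕ) + 1 else if (z : ℕ) = (i : ℕ) + 1 then (i : ℕ)
          else (z : ℕ) := by
      intro z
      rw [Equiv.swap_apply_def]
      simp only [Fin.ext_iff, Fin.val_castSucc, Fin.val_succ]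
      split_ifs <;> simp
    let _ := Fintype.ofFinite ↥(stdUnipotent F (fun r => (δ r : ℕ)) ⊓ stdLevi F α)
    let _ := Fintype.ofFinite ↥(stdUnipotent F
      (fun r => (Equiv.swap i.castSucc i.succ (δ r) : ℕ)) ⊓ stdLevi F α)
    -- Merging the labels i and i + 1 gives the coarser partition within which the adjacent
    -- transposition reverses the order.
    refine sum_unipotent_eq_of_reversed
      (m := fun r => if (δ r : ℕ) = (i : ℕ) + 1 then (i : ℕ) else δ r) ?_ ?_
      (fun r s h => hα r s (Fin.ext h)) hχ hl
    all_goals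
      intro r s
      simp only [hv]
      split_ifs <;> omega

/-- The sum of a class function over a coset of a unipotent radical depends only on the Levi
subgroup. -/
theorem unipotentSum_eq [Finite F] {α γ δ : Fin n → ℕ} (hγδ : ∀ r s, γ r = γ s ↔ δ r = δ s)
    {χ : GL (Fin n) F → ℂ} (hχ : ∀ c ∈ stdLevi F α, ∀ x, χ (c * x * c⁻¹) = χ x)
    (hα : ∀ r s, γ r = γ s → α r = α s) {l : GL (Fin n) F} (hl : l ∈ stdLevi F γ) :
    unipotentSum α γ χ l = unipotentSum α δ χ l := by
  obtain ⟨N, hN⟩ : ∃ N, ∀ r, γ r < N + 1 ∧ δ r < N + 1 :=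
    ⟨Finset.univ.sup γ + Finset.univ.sup δ, fun r => by
      have h1 := Finset.le_sup (f := γ) (Finset.mem_univ r)
      have h2 := Finset.le_sup (f := δ) (Finset.mem_univ r)
      omega⟩
  -- Both labellings are injective on the set of blocks, so they differ by a permutation of the
  -- bounded range of labels.
  let S := Quotient (Setoid.ker γ)
  let a : S → Fin (N + 1) := Quotient.lift (fun r => ⟨γ r, (hN r).1⟩) fun r s h => Fin.ext h
  let b : S → Fin (N + 1) :=
    Quotient.lift (fun r => ⟨δ r, (hN r).2⟩) fun r s h => Fin.ext ((hγδ r s).mp h)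
  obtain ⟨p, hp⟩ := Equiv.Perm.exists_extending_pair a b
    (by
      rintro ⟨r⟩ ⟨s⟩ h
      exact Quotient.sound (congrArg Fin.val h : γ r = γ s))
    (by
      rintro ⟨r⟩ ⟨s⟩ h
      exact Quotient.sound ((hγδ r s).mpr (congrArg Fin.val h : δ r = δ s)))
  have h := unipotentSum_perm p hχ (fun r => ⟨γ r, (hN r).1⟩)
    (fun r s h => hα r s (congrArg Fin.val h)) hl
  refine h.trans ?_
  congr 1
  ext1 r
  exact congrArg Fin.val (hp (Quotient.mk _ r))

end UnipotentSums

/-! ### Parabolic subgroups with a given Levi subgroup -/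

section LeviDeterminesBlocks

variable {n : ℕ} {F : Type*} [Field F]

/-- The transvection at (r, s) lies in the smaller Levi subgroup and would violate the block
condition of the larger one. -/
theorem fibre_le_of_stdLevi_le {f g : Fin n → ℕ} (h : stdLevi F f ≤ stdLevi F g) (r s : Fin n)
    (hrs : f r = f s) : g r = g s := by
  by_cases hne : r = s
  · rw [hne]
  by_contra hg
  let x : GL (Fin n) F := Matrix.GeneralLinearGroup.mk'' (Matrix.transvection r s 1) (by
    rw [Matrix.det_transvection_of_ne r s hne]
    exact isUnit_one)
  have hx : x ∈ stdLevi F f := by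
    intro i j hij
    change Matrix.transvection r s (1 : F) i j = 0
    rw [Matrix.transvection, Matrix.add_apply, Matrix.one_apply_ne fun e => hij (congrArg f e),
      zero_add, Matrix.single_apply, if_neg]
    rintro ⟨rfl, rfl⟩
    exact hij hrs
  have h1 := h hx r s hg
  change Matrix.transvection r s (1 : F) r s = 0 at h1
  rw [Matrix.transvection, Matrix.add_apply, Matrix.one_apply_ne hne, zero_add,
    Matrix.single_apply_same] at h1
  exact one_ne_zero h1

theorem apply_eq_zero_of_intertwines {f g : Fin n → ℕ} {c : Matrix (Fin n) (Fin n) F}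
    (h : ∀ i, c * blockProj F f i = blockProj F g i * c) {r s : Fin n} (hrs : g r ≠ f s) :
    c r s = 0 := by
  have h1 := congrFun (congrFun (h (f s)) r) s
  rwa [mul_blockProj_apply, blockProj_mul_apply, if_pos rfl, if_neg hrs] at h1

theorem conj_mem_stdUnipotent_of_intertwines {f g : Fin n → ℕ} {c x : GL (Fin n) F}
    (h : ∀ i, c.val * blockProj F f i = blockProj F g i * c.val)
    (h' : ∀ i, c⁻¹.val * blockProj F g i = blockProj F f i * c⁻¹.val)
    (hx : x ∈ stdUnipotent F f) : c * x * c⁻¹ ∈ stdUnipotent F g := by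
  intro r s hrs
  have h1 : c.val * c⁻¹.val = 1 := by rw [← Units.val_mul, mul_inv_cancel, Units.val_one]
  rw [Units.val_mul, Units.val_mul, ← h1, mul_assoc, Matrix.mul_apply, Matrix.mul_apply]
  refine Finset.sum_congr rfl fun t _ => ?_
  by_cases ht : g r = f t
  · congr 1
    rw [Matrix.mul_apply, ← one_mul c⁻¹.val, Matrix.mul_apply]
    refine Finset.sum_congr rfl fun u _ => ?_
    rw [one_mul]
    by_cases hu : f u = g s
    · rw [hx t u (by omega)]
    · rw [apply_eq_zero_of_intertwines h' hu, mul_zero, mul_zero]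
  · rw [apply_eq_zero_of_intertwines h ht, zero_mul, zero_mul]

theorem conj_mem_stdLevi_of_intertwines {f g : Fin n → ℕ} {c x : GL (Fin n) F}
    (h : ∀ i, c.val * blockProj F f i = blockProj F g i * c.val)
    (h' : ∀ i, c⁻¹.val * blockProj F g i = blockProj F f i * c⁻¹.val)
    (hx : x ∈ stdLevi F f) : c * x * c⁻¹ ∈ stdLevi F g := by
  rw [mem_stdLevi_iff_commute] at hx ⊢
  intro i
  rw [Units.val_mul, Units.val_mul, mul_assoc, h', ← mul_assoc, mul_assoc c.val, hx, ← mul_assoc,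
    h, mul_assoc, mul_assoc, mul_assoc]

theorem intertwines_inv {f g : Fin n → ℕ} {c : GL (Fin n) F}
    (h : ∀ i, c.val * blockProj F f i = blockProj F g i * c.val) (i : ℕ) :
    c⁻¹.val * blockProj F g i = blockProj F f i * c⁻¹.val := by
  have h1 : c⁻¹.val * c.val = 1 := by rw [← Units.val_mul, inv_mul_cancel, Units.val_one]
  have h2 : c.val * c⁻¹.val = 1 := by rw [← Units.val_mul, mul_inv_cancel, Units.val_one]
  calc _ = c⁻¹.val * (blockProj F g i * c.val) * c⁻¹.val := by
        rw [mul_assoc, mul_assoc, h2, mul_one]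
    _ = _ := by rw [← h, ← mul_assoc, h1, one_mul]

/-- The pairs with a given Levi subgroup are obtained by permuting the blocks. -/
theorem ParabolicPair.exists_blocks_of_levi_eq (h2 : (2 : F) ≠ 0) (E : ParabolicPair n F)
    {g : GL (Fin n) F} {γ : Fin n → ℕ} (hE : E.levi = (⟨g, γ⟩ : ParabolicPair n F).levi) :
    ∃ δ : Fin n → ℕ, (∀ r s, γ r = γ s ↔ δ r = δ s) ∧
      E.unipotentRadical = (⟨g, δ⟩ : ParabolicPair n F).unipotentRadical := by
  classical
  set c := g⁻¹ * E.basis with hc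
  have hL : ∀ x, x ∈ stdLevi F γ ↔ c⁻¹ * x * c ∈ stdLevi F E.blk := by
    intro x
    have h1 : g * x * g⁻¹ ∈ E.levi ↔ g * x * g⁻¹ ∈ (⟨g, γ⟩ : ParabolicPair n F).levi := by rw [hE]
    rw [mem_levi, mem_levi] at h1
    simp only at h1
    rw [show g⁻¹ * (g * x * g⁻¹) * g = x by group] at h1
    rw [← h1, hc]
    refine iff_of_eq (congrArg (· ∈ stdLevi F E.blk) ?_)
    group
  -- The signs diagonal in the basis `g` lie in the Levi subgroup of `E` and commute with its
  -- central signs. The block projections of `E` are therefore diagonal in that basis; each basis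
  -- vector belongs to exactly one block, whose label is `δ`.
  have hdiag : ∀ i, (conjProj E.blk c i).IsDiag := by
    intro i
    have h1 : (c * signGL F E.blk i * c⁻¹).val.IsDiag := by
      refine isDiag_of_commute_signGL h2 fun r => ?_
      have h3 := signGL_commute ((hL _).mp (signGL_val_mem_stdLevi γ r)) i
      calc _ = c * ((c⁻¹ * signGL F Fin.val r * c) * signGL F E.blk i) * c⁻¹ := by group
        _ = _ := by rw [← h3]; group
    intro r s hrs
    have h3 := h1 hrs
    rw [conj_signGL_eq, Matrix.sub_apply, Matrix.one_apply_ne hrs, zero_sub, neg_eq_zero,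
      Matrix.smul_apply, smul_eq_mul] at h3
    exact (mul_eq_zero.mp h3).resolve_left h2
  have hmulapp : ∀ i j r, conjProj E.blk c i r r * conjProj E.blk c j r r =
      if i = j then conjProj E.blk c i r r else 0 := by
    intro i j r
    have h1 := congrFun (congrFun (conjProj_mul_conjProj E.blk c i j) r) r
    rw [← (hdiag i).diagonal_diag, ← (hdiag j).diagonal_diag, Matrix.diagonal_mul_diagonal,
      Matrix.diagonal_apply_eq] at h1
    refine h1.trans ?_
    split_ifs <;> simp
  have hex : ∀ r, ∃ i, conjProj E.blk c i r r ≠ 0 := by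
    intro r
    by_contra! hcon
    have h1 := congrFun (congrFun
      (sum_conjProj E.blk c (S := Finset.univ.image E.blk) (by simp)) r) r
    rw [Matrix.sum_apply, Finset.sum_eq_zero fun i _ => hcon i, Matrix.one_apply_eq] at h1
    exact zero_ne_one h1
  choose δ hδ using hex
  have hproj : ∀ i, conjProj E.blk c i = blockProj F δ i := by
    intro i
    ext r s
    by_cases hrs : r = s
    · subst hrs
      rw [blockProj, Matrix.diagonal_apply_eq]
      split_ifs with h
      · subst h
        have h1 := hmulapp (δ r) (δ r) r
        rw [if_pos rfl] at h1
        exact mul_left_cancel₀ (hδ r) (h1.trans (mul_one _).symm)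
      · have h1 := hmulapp (δ r) i r
        rw [if_neg h] at h1
        exact (mul_eq_zero.mp h1).resolve_left (hδ r)
    · rw [hdiag i hrs, blockProj, Matrix.diagonal_apply_ne _ hrs]
  have hint : ∀ i, c.val * blockProj F E.blk i = blockProj F δ i * c.val := by
    intro i
    rw [← hproj, conjProj, mul_assoc (c.val * _), ← Units.val_mul, inv_mul_cancel, Units.val_one,
      mul_one]
  have hint' := intertwines_inv hint
  have hcx : ∀ x, c * (c⁻¹ * x * c) * c⁻¹ = x := fun x => by group
  have hLδ : stdLevi F γ = stdLevi F δ := by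
    ext x
    rw [hL]
    constructor
    · intro h
      have := conj_mem_stdLevi_of_intertwines hint hint' h
      rwa [hcx] at this
    · intro h
      have := conj_mem_stdLevi_of_intertwines hint' (by simpa using hint) h
      rwa [inv_inv] at this
  refine ⟨δ, fun r s => ⟨fibre_le_of_stdLevi_le hLδ.le r s, fibre_le_of_stdLevi_le hLδ.ge r s⟩, ?_⟩
  ext x
  have e : E.basis⁻¹ * x * E.basis = c⁻¹ * (g⁻¹ * x * g) * c := by rw [hc]; group
  rw [mem_unipotentRadical, mem_unipotentRadical, e]
  constructor
  · intro h
    have := conj_mem_stdUnipotent_of_intertwines hint hint' h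
    rwa [hcx] at this
  · intro h
    have := conj_mem_stdUnipotent_of_intertwines hint' (by simpa using hint) h
    rwa [inv_inv] at this

end LeviDeterminesBlocks

/-! ### Invariant vectors under a change of parabolic subgroup -/

section FixedVectors

variable {n : ℕ} {F : Type*} [Field F]

/-- The operator `T ε` is, up to a positive factor, the projection to the vectors fixed by `K` and
by the unipotent radical for `ε`. Its trace is a sum of unipotent sums of the character, hence equal
for γ and δ. It is nonzero for γ because of `w`, so `T δ` is nonzero, and its values are fixed
vectors. -/
theorem exists_fixed_vector_of_finiteDimensional [Finite F] {α γ δ : Fin n → ℕ}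
    (hγδ : ∀ r s, γ r = γ s ↔ δ r = δ s) (hα : ∀ r s, γ r = γ s → α r = α s)
    {W : Type*} [AddCommGroup W] [Module ℂ W] [FiniteDimensional ℂ W]
    (ρ : Representation ℂ (stdLevi F α) W) {K : Subgroup (GL (Fin n) F)} (hK : K ≤ stdLevi F γ)
    {w : W} (hw : w ≠ 0) (hwK : ∀ x : stdLevi F α, x.val ∈ K → ρ x w = w)
    (hwU : ∀ x : stdLevi F α, x.val ∈ stdUnipotent F γ → ρ x w = w) :
    ∃ w' : W, w' ≠ 0 ∧ (∀ x : stdLevi F α, x.val ∈ K → ρ x w' = w') ∧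
      ∀ x : stdLevi F α, x.val ∈ stdUnipotent F δ → ρ x w' = w' := by
  classical
  have hLα : stdLevi F γ ≤ stdLevi F α := stdLevi_mono hα
  have hLδ : stdLevi F γ ≤ stdLevi F δ := stdLevi_mono fun r s => (hγδ r s).mp
  let kk : K → stdLevi F α := fun k => ⟨k, hLα (hK k.2)⟩
  let uu : ∀ ε : Fin n → ℕ, ↥(stdUnipotent F ε ⊓ stdLevi F α) → stdLevi F α := fun ε x => ⟨x, x.2.2⟩
  let _ : Fintype K := Fintype.ofFinite K
  let _ : ∀ ε : Fin n → ℕ, Fintype ↥(stdUnipotent F ε ⊓ stdLevi F α) := fun ε => Fintype.ofFinite _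
  let T : (Fin n → ℕ) → Module.End ℂ W := fun ε => ∑ k : K, ∑ x, ρ (kk k * uu ε x)
  have hT : ∀ ε v, T ε v = ∑ k : K, ∑ x, ρ (kk k) (ρ (uu ε x) v) := fun ε v => by
    simp only [T, LinearMap.sum_apply, map_mul, Module.End.mul_apply]
  have hTK : ∀ ε v, ∀ x : stdLevi F α, x.val ∈ K → ρ x (T ε v) = T ε v := by
    intro ε v x hx
    rw [hT, map_sum]
    simp only [map_sum]
    refine Fintype.sum_equiv (Equiv.mulLeft (⟨x, hx⟩ : K)) _ _ fun k => ?_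
    refine Finset.sum_congr rfl fun y _ => ?_
    rw [← Module.End.mul_apply, ← map_mul]
    rfl
  have hTU : ∀ ε, stdLevi F γ ≤ stdLevi F ε → ∀ v, ∀ x : stdLevi F α, x.val ∈ stdUnipotent F ε →
      ρ x (T ε v) = T ε v := by
    intro ε hε v x hx
    rw [hT, map_sum]
    simp only [map_sum]
    refine Finset.sum_congr rfl fun k _ => ?_
    have hk := hε (hK k.2)
    have hy : (k : GL (Fin n) F)⁻¹ * x * k ∈ stdUnipotent F ε ⊓ stdLevi F α := by
      refine ⟨?_, (stdLevi F α).mul_mem ((stdLevi F α).mul_mem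
        ((stdLevi F α).inv_mem (hLα (hK k.2))) x.2) (hLα (hK k.2))⟩
      have := stdUnipotent_conj ε (inv_mem hk) hx
      rwa [inv_inv] at this
    refine Fintype.sum_equiv
      (Equiv.mulLeft (⟨_, hy⟩ : ↥(stdUnipotent F ε ⊓ stdLevi F α))) _ _ fun y => ?_
    rw [← Module.End.mul_apply, ← Module.End.mul_apply, ← map_mul, ← map_mul,
      ← Module.End.mul_apply, ← map_mul]
    congr 2
    ext1
    simp only [Subgroup.coe_mul, kk, uu, Equiv.coe_mulLeft]
    group
  have hfix : ∀ ε v, (∀ x : stdLevi F α, x.val ∈ K → ρ x v = v) →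
      (∀ x : stdLevi F α, x.val ∈ stdUnipotent F ε → ρ x v = v) →
      T ε v = ((Fintype.card K * Fintype.card ↥(stdUnipotent F ε ⊓ stdLevi F α) : ℕ) : ℂ) • v := by
    intro ε v hvK hvU
    have h1 : ∀ (k : K) x, ρ (kk k) (ρ (uu ε x) v) = v := fun k x => by
      rw [hvU _ x.2.1, hvK _ k.2]
    rw [hT]
    simp only [h1, Finset.sum_const, Finset.card_univ, smul_smul, ← Nat.cast_smul_eq_nsmul ℂ]
    push_cast
    rfl
  set N : ℂ := ((Fintype.card K * Fintype.card ↥(stdUnipotent F γ ⊓ stdLevi F α) : ℕ) : ℂ) with hN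
  have hN0 : N ≠ 0 := by
    rw [hN, Nat.cast_ne_zero]
    exact Nat.mul_ne_zero Fintype.card_ne_zero Fintype.card_ne_zero
  let e : Module.End ℂ W := N⁻¹ • T γ
  have he : IsIdempotentElem e := by
    refine LinearMap.ext fun v => ?_
    have h1 := hfix γ (T γ v) (hTK γ v) (hTU γ le_rfl v)
    simp only [e, Module.End.mul_apply, LinearMap.smul_apply, map_smul, h1]
    rw [← hN, smul_smul N⁻¹ N, inv_mul_cancel₀ hN0, one_smul]
  have hew : e w = w := by
    simp only [e, LinearMap.smul_apply, hfix γ w hwK hwU]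
    rw [← hN, smul_smul, inv_mul_cancel₀ hN0, one_smul]
  have htr : LinearMap.trace ℂ W (T γ) ≠ 0 := by
    -- The trace of an idempotent is its rank, and `w` lies in the range.
    have h1 : LinearMap.trace ℂ W e ≠ 0 := by
      rw [(LinearMap.IsIdempotentElem.isProj_range e he).trace, Nat.cast_ne_zero]
      have : Nontrivial (LinearMap.range e) :=
        ⟨⟨w, w, hew⟩, 0, fun h => hw (congrArg Subtype.val h)⟩
      exact Module.finrank_pos.ne'
    intro h
    apply h1
    simp only [e, map_smul, h, smul_zero]
  let χ : GL (Fin n) F → ℂ := fun x =>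
    if hx : x ∈ stdLevi F α then LinearMap.trace ℂ W (ρ ⟨x, hx⟩) else 0
  have hχ : ∀ c ∈ stdLevi F α, ∀ x, χ (c * x * c⁻¹) = χ x := by
    intro c hc x
    by_cases hx : x ∈ stdLevi F α
    · have hcx : c * x * c⁻¹ ∈ stdLevi F α := mul_mem (mul_mem hc hx) (inv_mem hc)
      simp only [χ, dif_pos hx, dif_pos hcx]
      have e1 : (⟨c * x * c⁻¹, hcx⟩ : stdLevi F α) = ⟨c, hc⟩ * ⟨x, hx⟩ * ⟨c, hc⟩⁻¹ := rfl
      rw [e1, map_mul, LinearMap.trace_mul_comm, ← map_mul]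
      congr 2
      group
    · have hcx : c * x * c⁻¹ ∉ stdLevi F α := fun h => hx (by
        have := mul_mem (mul_mem (inv_mem hc) h) hc
        rwa [show c⁻¹ * (c * x * c⁻¹) * c = x by group] at this)
      simp only [χ, dif_neg hx, dif_neg hcx]
  have htrT : ∀ ε, LinearMap.trace ℂ W (T ε) = ∑ k : K, unipotentSum α ε χ k := by
    intro ε
    simp only [T, map_sum]
    refine Finset.sum_congr rfl fun k _ => Finset.sum_congr rfl fun x _ => ?_
    have hkx : (k * x : GL (Fin n) F) ∈ stdLevi F α := (stdLevi F α).mul_mem (hLα (hK k.2)) x.2.2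
    change _ = χ (k * x)
    simp only [χ, dif_pos hkx]
    rfl
  have htr' : LinearMap.trace ℂ W (T δ) ≠ 0 := by
    have h1 : ∑ k : K, unipotentSum α δ χ k = ∑ k : K, unipotentSum α γ χ k :=
      Finset.sum_congr rfl fun k _ => (unipotentSum_eq hγδ hχ hα (hK k.2)).symm
    rw [htrT, h1, ← htrT]
    exact htr
  obtain ⟨v, hv⟩ : ∃ v, T δ v ≠ 0 := by
    by_contra! hcon
    have h1 : T δ = 0 := LinearMap.ext hcon
    exact htr' (by rw [h1, map_zero])
  exact ⟨T δ v, hv, hTK δ v, hTU δ hLδ v⟩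

/-- The group is finite, so the orbit of `w` spans a finite-dimensional subrepresentation, on which
traces make sense. -/
theorem exists_fixed_vector [Finite F] {α γ δ : Fin n → ℕ}
    (hγδ : ∀ r s, γ r = γ s ↔ δ r = δ s) (hα : ∀ r s, γ r = γ s → α r = α s)
    {V : Type*} [AddCommGroup V] [Module ℂ V]
    (ρ : Representation ℂ (stdLevi F α) V) {K : Subgroup (GL (Fin n) F)} (hK : K ≤ stdLevi F γ)
    {w : V} (hw : w ≠ 0) (hwK : ∀ x : stdLevi F α, x.val ∈ K → ρ x w = w)
    (hwU : ∀ x : stdLevi F α, x.val ∈ stdUnipotent F γ → ρ x w = w) :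
    ∃ w' : V, w' ≠ 0 ∧ (∀ x : stdLevi F α, x.val ∈ K → ρ x w' = w') ∧
      ∀ x : stdLevi F α, x.val ∈ stdUnipotent F δ → ρ x w' = w' := by
  let W : Submodule ℂ V := Submodule.span ℂ (Set.range fun x => ρ x w)
  have hfin : FiniteDimensional ℂ W := FiniteDimensional.span_of_finite ℂ (Set.finite_range _)
  have hWρ : ∀ x, ∀ v ∈ W, ρ x v ∈ W := by
    intro x v hv
    have : W ≤ W.comap (ρ x) := by
      refine Submodule.span_le.mpr ?_
      rintro _ ⟨y, rfl⟩
      refine Submodule.subset_span ⟨x * y, ?_⟩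
      simp only [map_mul, Module.End.mul_apply]
    exact this hv
  let ρW : Representation ℂ (stdLevi F α) W :=
    { toFun := fun x => (ρ x).restrict (hWρ x)
      map_one' := LinearMap.ext fun v => Subtype.ext (by simp [LinearMap.restrict_apply])
      map_mul' := fun x y => LinearMap.ext fun v =>
        Subtype.ext (by simp [LinearMap.restrict_apply, Module.End.mul_apply]) }
  have hρW : ∀ x v, ((ρW x v : W) : V) = ρ x v := fun x v => rfl
  have hwW : w ∈ W := Submodule.subset_span ⟨1, by simp⟩
  obtain ⟨w', h0, hK', hU'⟩ := exists_fixed_vector_of_finiteDimensional hγδ hα ρW hK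
    (w := ⟨w, hwW⟩) (fun h => hw (congrArg Subtype.val h))
    (fun x hx => Subtype.ext (hwK x hx)) (fun x hx => Subtype.ext (hwU x hx))
  exact ⟨w', fun h => h0 (Subtype.ext h), fun x hx => congrArg Subtype.val (hK' x hx),
    fun x hx => congrArg Subtype.val (hU' x hx)⟩

end FixedVectors

/-! ### The Levi subgroup L ∩ σ(L) -/

namespace ParabolicPair

variable {n : ℕ} {F : Type*} [Field F]

/-- With y = σ(x), the commutator c = y⁻¹ x⁻¹ y x lies in U, has odd order and is inverted by σ. Its
square root d, a power of c, is inverted too, so p = x y d satisfies σ(p) = y x d⁻¹ = x y c d⁻¹ = p.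
-/
theorem exists_fixed_mem_parabolic [Finite F] (h2 : (2 : F) ≠ 0) (D : ParabolicPair n F)
    {σ : GL (Fin n) F →* GL (Fin n) F} (hσ : ∀ x, σ (σ x) = x) {x : GL (Fin n) F}
    (hx : x ∈ D.levi) (hσx : σ x ∈ D.unipotentRadical) :
    ∃ p ∈ D.parabolic, σ p = p ∧ x⁻¹ * p ∈ D.unipotentRadical := by
  obtain ⟨ℓ, hℓ⟩ := CharP.exists F
  have hℓp : Fact ℓ.Prime := ⟨CharP.char_is_prime F ℓ⟩
  have hℓ2 : ℓ ≠ 2 := by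
    rintro rfl
    exact h2 (CharP.cast_eq_zero F 2)
  have hxP := D.levi_le_parabolic hx
  have hUP := D.unipotentRadical_le_parabolic
  set y := σ x with hy
  set c := y⁻¹ * (x⁻¹ * y * x) with hc
  have hcU : c ∈ D.unipotentRadical := by
    have h1 := D.conj_mem_unipotentRadical (inv_mem hxP) hσx
    rw [inv_inv] at h1
    exact mul_mem (inv_mem hσx) h1
  have hσc : σ c = c⁻¹ := by
    simp only [hc, map_mul, map_inv, ← hy, show σ y = x from hσ x]
    group
  obtain ⟨m, hm⟩ : ∃ m, c ^ (2 * m + 1) = 1 := by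
    obtain ⟨e, he⟩ := D.isPGroup_unipotentRadical ℓ ⟨c, hcU⟩
    obtain ⟨m, hm⟩ := (hℓp.out.odd_of_ne_two hℓ2).pow (n := e)
    exact ⟨m, by rw [← hm]; exact congrArg Subtype.val he⟩
  have hd : c ^ (m + 1) * c ^ (m + 1) = c := by
    rw [← pow_add, show m + 1 + (m + 1) = 2 * m + 1 + 1 by ring, pow_succ, hm, one_mul]
  refine ⟨x * (y * c ^ (m + 1)), mul_mem hxP (hUP (mul_mem hσx (pow_mem hcU _))), ?_, ?_⟩
  · simp only [map_mul, map_pow, hσc, ← hy, show σ y = x from hσ x]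
    rw [inv_pow, ← mul_assoc, ← mul_assoc, mul_inv_eq_iff_eq_mul, mul_assoc (x * y), hd, hc]
    group
  · rw [inv_mul_cancel_left]
    exact mul_mem hσx (pow_mem hcU _)

/-- The Levi subgroup is L ∩ σ(L). The vector `w` itself serves for the parabolic subgroup of L with
radical L ∩ σ(U), by `exists_fixed_mem_parabolic`; every other choice is reached by
`exists_fixed_vector`. -/
theorem exists_levi_isDistinguished [Finite F] (h2 : (2 : F) ≠ 0) {D : ParabolicPair n F}
    {V : Type*} [AddCommGroup V] [Module ℂ V] (π : Representation ℂ D.levi V)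
    {σ : GL (Fin n) F →* GL (Fin n) F} (hσ : ∀ x, σ (σ x) = x) {g : GL (Fin n) F}
    {α β : Fin n → ℕ} (hD : SameGroups ⟨g, α⟩ D) (hI : IsImage σ ⟨g, α⟩ ⟨g, β⟩) {w : V}
    (hw : w ≠ 0) (hfix : ∀ x ∈ D.parabolic, σ x = x → ∀ l : D.levi,
      (l : GL (Fin n) F)⁻¹ * x ∈ D.unipotentRadical → π l w = w) :
    ∃ (D' : ParabolicPair n F) (hL : D'.levi ≤ D.levi), D'.levi.map σ = D'.levi ∧
      ∀ (E : ParabolicPair n F) (hE : E.levi = D'.levi),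
        IsDistinguished (E.jacquetRestriction π (hE.le.trans hL))
          ((fixedSubgroup σ).subgroupOf E.levi) := by
  obtain ⟨N, hN⟩ : ∃ N, ∀ r, β r < N :=
    ⟨Finset.univ.sup β + 1, fun r => Nat.lt_succ_of_le (Finset.le_sup (Finset.mem_univ r))⟩
  -- Lexicographic order with α first, as β < N. Within a block of α the order is that of β, so the
  -- radical for γ meets L in elements that σ maps into U.
  let γ : Fin n → ℕ := fun r => β r + N * α r
  have hγ : ∀ r s, γ r = γ s ↔ α r = α s ∧ β r = β s := by
    refine fun r s => ⟨fun h => ?_, fun h => by simp only [γ, h.1, h.2]⟩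
    have hN0 : 0 < N := (Nat.zero_le _).trans_lt (hN r)
    have h1 := congrArg (· / N) h
    have h3 := congrArg (· % N) h
    simp only [γ, Nat.add_mul_div_left _ _ hN0, Nat.div_eq_of_lt (hN _), zero_add] at h1
    simp only [γ, Nat.add_mul_mod_self_left, Nat.mod_eq_of_lt (hN _)] at h3
    exact ⟨h1, h3⟩
  have hLev : ∀ x, x ∈ (⟨g, γ⟩ : ParabolicPair n F).levi ↔ x ∈ D.levi ∧ σ x ∈ D.levi := by
    intro x
    rw [← hD.levi, ← hI.levi, mem_levi, mem_levi, mem_levi]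
    refine ⟨fun h => ⟨fun r s hrs => h r s fun e => hrs ((hγ r s).mp e).1,
      fun r s hrs => h r s fun e => hrs ((hγ r s).mp e).2⟩, fun h r s hrs => ?_⟩
    by_cases hα : α r = α s
    · exact h.2 r s fun e => hrs ((hγ r s).mpr ⟨hα, e⟩)
    · exact h.1 r s hα
  have hLD : (⟨g, γ⟩ : ParabolicPair n F).levi ≤ D.levi := fun x hx => ((hLev x).mp hx).1
  refine ⟨⟨g, γ⟩, hLD, ?_, fun E hE => ?_⟩
  · ext x
    constructor
    · rintro ⟨y, hy, rfl⟩
      rw [hLev, hσ]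
      exact ((hLev y).mp hy).symm
    · intro hx
      refine ⟨σ x, ?_, hσ x⟩
      change σ x ∈ (⟨g, γ⟩ : ParabolicPair n F).levi
      rw [hLev, hσ]
      exact ((hLev x).mp hx).symm
  obtain ⟨δ, hγδ, hδ⟩ := exists_blocks_of_levi_eq h2 E hE
  have hgα : ∀ x : stdLevi F α, g * x * g⁻¹ ∈ D.levi := fun x => by
    rw [← hD.levi]
    exact ⟨x, x.2, rfl⟩
  let c : stdLevi F α →* D.levi :=
    ((MulAut.conj g).toMonoidHom.comp (stdLevi F α).subtype).codRestrict D.levi hgα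
  have hc : ∀ x, (c x : GL (Fin n) F) = g * x * g⁻¹ := fun x => rfl
  let K : Subgroup (GL (Fin n) F) :=
    ((⟨g, γ⟩ : ParabolicPair n F).levi ⊓ fixedSubgroup σ).comap (MulAut.conj g).toMonoidHom
  have hK : ∀ x, x ∈ K ↔ g * x * g⁻¹ ∈ (⟨g, γ⟩ : ParabolicPair n F).levi ∧
      σ (g * x * g⁻¹) = g * x * g⁻¹ := fun x => Iff.rfl
  have hg : ∀ x : GL (Fin n) F, g⁻¹ * (g * x * g⁻¹) * g = x := fun x => by group
  have hKL : K ≤ stdLevi F γ := fun x hx => by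
    have h1 := ((hK x).mp hx).1
    rw [mem_levi] at h1
    rwa [← hg x]
  obtain ⟨w', h0, hK', hU'⟩ := exists_fixed_vector hγδ (fun r s h => ((hγ r s).mp h).1)
    (π.comp c) hKL hw
    (fun x hx => by
      refine hfix (g * x * g⁻¹) (D.levi_le_parabolic (hgα x)) ((hK x).mp hx).2 (c x) ?_
      rw [hc, inv_mul_cancel]
      exact one_mem _)
    (fun x hx => by
      obtain ⟨p, hp, hσp, hpU⟩ := D.exists_fixed_mem_parabolic h2 hσ (hgα x) (by
        rw [← hD.unipotentRadical, ← hI.unipotentRadical, mem_unipotentRadical]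
        simp only [hg]
        intro r s hrs
        by_cases hα : α r = α s
        · exact hx r s (by simp only [γ, hα]; omega)
        · rw [x.2 r s hα, Matrix.one_apply_ne fun e => hα (congrArg α e)])
      exact hfix p hp hσp (c x) hpU)
  have hsurj : ∀ x : D.levi, ∃ y, c y = x := by
    rintro ⟨x, hx⟩
    have hx' := hx
    rw [← hD.levi] at hx'
    obtain ⟨y, hy, rfl⟩ := hx'
    exact ⟨⟨y, hy⟩, rfl⟩
  have hmem : w' ∈ E.jacquetSpace π := by
    intro x hx
    obtain ⟨y, rfl⟩ := hsurj x
    refine hU' y ?_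
    rw [hδ, mem_unipotentRadical, hc] at hx
    simpa only [hg] using hx
  refine ⟨⟨w', hmem⟩, fun h => h0 (congrArg Subtype.val h), fun x hx => Subtype.ext ?_⟩
  change π (Subgroup.inclusion (hE.le.trans hLD) x) w' = w'
  obtain ⟨y, hy⟩ := hsurj (Subgroup.inclusion (hE.le.trans hLD) x)
  rw [← hy]
  refine hK' y ((hK y).mpr ?_)
  rw [← hc, hy]
  exact ⟨hE.le x.2, hx⟩

end ParabolicPair

/-! ### Twists by coboundaries and the conclusion -/

theorem two_ne_zero_of_odd_natCard {k : Type*} [Field k] [Finite k] (h : Odd (Nat.card k)) :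
    (2 : k) ≠ 0 := by
  intro h2
  have h1 : ((Nat.card k : ℕ) : k) = 0 := by
    let _ := Fintype.ofFinite k
    rw [Nat.card_eq_fintype_card, FiniteField.cast_card_eq_zero]
  obtain ⟨m, hm⟩ := h
  rw [hm] at h1
  push_cast at h1
  rw [h2, zero_mul, zero_add] at h1
  exact one_ne_zero h1

theorem conjTwist_apply {G : Type*} [Group G] (A : G) (σ : G →* G) (x : G) :
    conjTwist A σ x = A * σ x * A⁻¹ := rfl

/-- For A of the form g σ(g)⁻¹ the twist is σ carried over by conjugation with g, which makes the
first assertion about A automatic. -/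
theorem conjTwist_coboundary_apply {G : Type*} [Group G] (g : G) (σ : G →* G) (x : G) :
    conjTwist (g * (σ g)⁻¹) σ x = g * σ (g⁻¹ * x * g) * g⁻¹ := by
  simp only [conjTwist_apply, map_mul, map_inv]
  group

theorem conjTwist_coboundary_involutive {G : Type*} [Group G] (g : G) {σ : G →* G}
    (hσ : ∀ x, σ (σ x) = x) (x : G) :
    conjTwist (g * (σ g)⁻¹) σ (conjTwist (g * (σ g)⁻¹) σ x) = x := by
  rw [conjTwist_coboundary_apply, conjTwist_coboundary_apply,
    show ∀ y, g⁻¹ * (g * y * g⁻¹) * g = y from fun y => by group, hσ]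
  group

theorem eq_id_of_conjTwist_coboundary_eq_id {G : Type*} [Group G] {g : G} {σ : G →* G}
    (h : conjTwist (g * (σ g)⁻¹) σ = MonoidHom.id G) : σ = MonoidHom.id G := by
  ext x
  have h1 := DFunLike.congr_fun h (g * x * g⁻¹)
  rw [conjTwist_coboundary_apply, show g⁻¹ * (g * x * g⁻¹) * g = x by group] at h1
  simpa using h1

namespace ParabolicPair

variable {n : ℕ} {F : Type*} [Field F]

theorem IsImage.of_move {σ τ : GL (Fin n) F →* GL (Fin n) F} {D E : ParabolicPair n F}
    {q : GL (Fin n) F} (hτ : ∀ x, τ x = q * σ (q⁻¹ * x * q) * q⁻¹)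
    (h : IsImage σ (D.move q⁻¹) E) : IsImage τ D (E.move q) := by
  refine ⟨fun x => ?_, fun x => ?_, fun x => ?_⟩
  · rw [move_parabolic, mem_map_conj_iff, h.parabolic, move_parabolic, mem_map_conj_iff, hτ,
      inv_inv]
  · rw [move_levi, mem_map_conj_iff, h.levi, move_levi, mem_map_conj_iff, hτ, inv_inv]
  · rw [move_unipotentRadical, mem_map_conj_iff, h.unipotentRadical, move_unipotentRadical,
      mem_map_conj_iff, hτ, inv_inv]

theorem SameGroups.move {D E : ParabolicPair n F} (h : SameGroups D E) (q : GL (Fin n) F) :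
    SameGroups (D.move q) (E.move q) :=
  ⟨by rw [move_parabolic, move_parabolic, h.parabolic], by rw [move_levi, move_levi, h.levi],
    by rw [move_unipotentRadical, move_unipotentRadical, h.unipotentRadical]⟩

end ParabolicPair

theorem mainTheorem2
    {k F : Type u} [Field k] [Finite k] [Field F] [Algebra k F]
    (hq : Odd (Nat.card k))
    (hm : Module.finrank k F = 1 ∨ Module.finrank k F = 2)
    (n : ℕ) (σ : AlgInvolution k F n)
    (D : ParabolicPair n F)
    {V : Type v} [AddCommGroup V] [Module ℂ V] (π : Representation ℂ D.levi V)
    (hπ : IsDistinguished (D.parabolicInduction π) (fixedSubgroup σ.points)) :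
    ∃ (D' : ParabolicPair n F) (hL : D'.levi ≤ D.levi) (A : GL (Fin n) F),
      (∀ X, conjTwist A σ.points (conjTwist A σ.points X) = X) ∧
      (σ.points ≠ MonoidHom.id _ → conjTwist A σ.points ≠ MonoidHom.id _) ∧
      D'.levi.map (conjTwist A σ.points) = D'.levi ∧
      ∀ (E : ParabolicPair n F) (hE : E.levi = D'.levi),
        IsDistinguished (E.jacquetRestriction π (hE.le.trans hL))
          ((fixedSubgroup (conjTwist A σ.points)).subgroupOf E.levi) := by
  have hfin : Module.Finite k F := Module.finite_of_finrank_pos (by omega)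
  have hF : Finite F := Module.finite_of_finite k
  have h2 : (2 : F) ≠ 0 := by
    rw [← map_ofNat (algebraMap k F) 2, map_ne_zero]
    exact two_ne_zero_of_odd_natCard hq
  have hσ := σ.points_involutive
  obtain ⟨φ, hφ0, hφ⟩ := hπ
  have hinv : ∀ h, σ.points h = h → ∀ g, φ.1 (g * h) = φ.1 g := fun h hh g =>
    congrFun (congrArg Subtype.val (hφ h hh)) g
  obtain ⟨g₀, hg₀⟩ : ∃ g, φ.1 g ≠ 0 := by
    by_contra! hcon
    exact hφ0 (Subtype.ext (funext hcon))
  obtain ⟨E, hE1, hE2, hE3⟩ := σ.exists_image_pair (D.move g₀⁻¹)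
  obtain ⟨q, hq, g, α, β, hs, hI⟩ := ParabolicPair.exists_levi_common_basis h2
    (conjTwist_coboundary_involutive g₀ hσ)
    (ParabolicPair.IsImage.of_move (conjTwist_coboundary_apply g₀ σ.points) ⟨hE1, hE2, hE3⟩)
  have hq' := inv_mem hq
  have hg₁ : φ.1 (q⁻¹ * g₀) ≠ 0 := by
    obtain ⟨l, hl⟩ := D.exists_levi_component hq'
    rw [φ.2 _ hq' l hl]
    intro h0
    apply hg₀
    rw [← Module.End.one_apply (R := ℂ) (φ.1 g₀), ← map_one π, ← inv_mul_cancel l, map_mul,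
      Module.End.mul_apply, h0, map_zero]
  -- Moving the base point by q⁻¹ conjugates the twist by q⁻¹, which brings the Levi subgroup q L
  -- q⁻¹ found above back to L itself.
  set g₁ := q⁻¹ * g₀ with hg₁_def
  have hτ := conjTwist_coboundary_apply g₁ σ.points
  have hs' : ParabolicPair.SameGroups ⟨q⁻¹ * g, α⟩ D := by
    have := hs.move q⁻¹
    rwa [ParabolicPair.move, ParabolicPair.move, ParabolicPair.move, inv_mul_cancel_left] at this
  have hI' : ParabolicPair.IsImage (conjTwist (g₁ * (σ.points g₁)⁻¹) σ.points) ⟨q⁻¹ * g, α⟩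
      ⟨q⁻¹ * g, β⟩ := by
    refine ParabolicPair.IsImage.of_move (E := ⟨g, β⟩) (fun x => ?_)
      (σ := conjTwist (g₀ * (σ.points g₀)⁻¹) σ.points) ?_
    · rw [hτ, conjTwist_coboundary_apply, hg₁_def]
      simp only [map_mul, map_inv]
      group
    · rwa [ParabolicPair.move, inv_inv, mul_inv_cancel_left]
  obtain ⟨D', hL, hD', hdist⟩ := ParabolicPair.exists_levi_isDistinguished h2 π
    (conjTwist_coboundary_involutive g₁ hσ) hs' hI' hg₁ (by
      intro x hx hfx l hl
      rw [← φ.2 x hx l hl]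
      rw [hτ] at hfx
      -- If the twist fixes x, then σ fixes g₁⁻¹ x g₁, and invariance of φ gives φ(x g₁) = φ(g₁).
      have h1 := hinv (g₁⁻¹ * x * g₁) (by
        conv_rhs => rw [← hfx]
        group) g₁
      rwa [show g₁ * (g₁⁻¹ * x * g₁) = x * g₁ by group] at h1)
  exact ⟨D', hL, _, conjTwist_coboundary_involutive g₁ hσ,
    fun h h' => h (eq_id_of_conjTwist_coboundary_eq_id h'), hD', hdist⟩
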